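/- **Setting.** Let $X$ be a CAT(0) cube complex with its CAT(0) metric $d$, and let $G$ be a group acting properly and cocompactly on $X$ by isometries that map cubes to cubes. A *wall* of $X$ is (the image in $X$ of) a connected component of the complex of midcubes of $X$; an edge is *dual* to the wall that it intersects, and the midpoints of the edges dual to a wall $W$ are called the *vertices of $W$*. The *half-spaces* of $W$ are the closures of the connected components of $X-W$. Let $R>1$ be such that the $G$-translates of every $R$-ball cover $X$, and let $W_1,\dots,W_n$ represent the $G$-orbits of walls of $X$. Let $\phi:G\to\mathcal G$ be a surjective homomorphism with torsion-free kernel $K$, and let $H_i\triangleleft G_{W_i}$ be finite index normal subgroups of the stabilisers $G_{W_i}$ of the $W_i$ such that every $\phi(H_i)$ is finite, and $\phi(g)\notin\phi(H_i)$ whenever $g\in G-H_i$ and $d(gW_i,W_i)\le 2R$. Let $m:X\to\mathcal X:=X/K$, $x\mapsto\bar x$, be the quotient map; the walls of $\mathcal X$ are the images $\overline W=m(W)$ of the walls $W$ of $X$. Let $\Gamma$ be the graph whose vertices are the walls of $\mathcal X$, two distinct walls being adjacent if their distance in $\mathcal X$ is at most $R$; let $k$ be a bound on the vertex degrees of $\Gamma$,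 and let $C_{k+1}(\Gamma)$ be the set of proper colourings of $\Gamma$ with colours $1,\dots,k+1$. For $c\in C_{k+1}(\Gamma)$ and a wall $W$ of $X$, let $[c]_W$ be the set of all $c'\in C_{k+1}(\Gamma)$ that agree with $c$ on the ball of radius $c(\overline W)$ about $\overline W$ in $\Gamma$. The group $G$ acts on $C_{k+1}(\Gamma)$ by $(gc)(\overline W)=c(\overline{g^{-1}W})$. If the edge $e$ is dual to $W$, write $[c]_e:=[c]_W$ and $c(e):=c(\overline W)$. Let $j\ge 0$ be an integer and let $(Z,H,(c_x))$ be a triple in which $Z\subset X$ is a non-empty intersection of half-spaces, $H\le G$ is a subgroup that preserves $Z$ and acts on it freely and cocompactly, and $c_x\in C_{k+1}(\Gamma)$ for every vertex $x\in Z$ of $X$, with $c_{hx}=hc_x$ for $h\in H$, such that for every edge $e$ of $X$ with endpoints $x,y$: if $x,y\in Z$ then $[c_x]_e=[c_y]_e$; and if $x\in Z$ then $y\in Z\Leftrightarrow c_x(e)>j$. For every edge $e$ that meets $Z$ fix $c_e\in C_{k+1}(\Gamma)$ with $[c_e]_e=[c_x]_e$ whenever $e$ is incident at a vertex $x\in Z$.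 An edge *crosses out of $Z$* if exactly one of its endpoints is in $Z$; a *boundary wall* of $Z$ is a wall dual to such an edge $e$, and it is a *$j$-boundary wall* if moreover $c_e(e)=j$ for such an edge. For a $j$-boundary wall $W$, the *portal* is $P=Z\cap W$, and the edges dual to $W$ that cross out of $Z$ are called *dual to $P$*. For $c\in C_{k+1}(\Gamma)$, let $\overline W-c$ be $\overline W$ minus all walls $\overline{W'}\ne\overline W$ of $\mathcal X$ with $c(\overline{W'})\le j$, and for $\bar x\in\overline W-c$ let $(\overline W-c)(\bar x)$ be the connected component of $\overline W-c$ containing $\bar x$. **Lemma (Portal covers).** Let $W$ be a $j$-boundary wall of $Z$ with portal $P=Z\cap W$, let $e$ be an edge dual to $P$ and let $x_0$ be the midpoint of $e$. Let $\mathring P$ be the interior of $P$ in the topology of $W$. 1. $\mathring P$ equals $P$ minus all boundary walls $W'\ne W$ of $Z$. 2. The quotient map $m$ restricts to a universal covering map $m|_{\mathring P}:\mathring P\to(\overline W-c_e)(\bar x_0)$; that is, a surjective covering map with simply connected domain. 3. $(\overline W-c_e)(\bar x_0)=(\overline W-c)(\bar x)$ for every $x\in P$ that is a vertex of $W$ and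 every $c\in[c_e]_W$. In particular $(\overline W-c_e)(\bar x_0)=(\overline W-c_{e'})(\bar x_0')$ for every edge $e'$ dual to $P$, with midpoint $x_0'$. 4. $K_P:=\{g\in K\mid gx_0\in P\}$ is a subgroup of $G$, its elements preserve $\mathring P$, and restriction to $\mathring P$ is an isomorphism from $K_P$ onto the group of deck transformations of $m|_{\mathring P}$. -/

import Mathlib

open Set Topology Pointwise

namespace PortalCovers

universe u v w

/-! ### Metric preliminaries -/

section Metric

variable {X : Type u} [MetricSpace X]

/-- `u` lies on a geodesic segment from `x` to `y` (in a geodesic space). -/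
def OnSegment (x u y : X) : Prop := dist x u + dist u y = dist x y

/-- CAT(0) spaces: geodesic metric spaces all of whose geodesic triangles are at least as thin as
their Euclidean comparison triangles. -/
structure IsCAT0 (X : Type u) [MetricSpace X] : Prop where
  geodesic : ∀ x y : X, ∃ γ : ℝ → X, γ 0 = x ∧ γ (dist x y) = y ∧
    ∀ s ∈ Icc 0 (dist x y), ∀ t ∈ Icc 0 (dist x y), dist (γ s) (γ t) = |s - t|
  comparison : ∀ x y z p q : X, OnSegment x p y → OnSegment x q z →
    ∀ x' y' z' p' q' : EuclideanSpace ℝ (Fin 2),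
      dist x' y' = dist x y → dist y' z' = dist y z → dist x' z' = dist x z →
      dist x' p' = dist x p → dist p' y' = dist p y →
      dist x' q' = dist x q → dist q' z' = dist q z →
      dist p q ≤ dist p' q'

/-- The distance between two subsets, `d(A,B) = inf {d(a,b) | a ∈ A, b ∈ B}`. -/
noncomputable def setDist (A B : Set X) : ℝ := sInf {r | ∃ a ∈ A, ∃ b ∈ B, r = dist a b}

/-- The unit cube `[0,1]^n` in Euclidean space. -/
def unitCube (n : ℕ) : Set (EuclideanSpace ℝ (Fin n)) := {t | ∀ i, t i ∈ Icc (0 : ℝ) 1}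

/-- The face of `[0,1]^n` on which the coordinates `i` with `σ i = some b` are frozen, to `1` if
`b` is true and to `0` otherwise. -/
def stdFace {n : ℕ} (σ : Fin n → Option Bool) : Set (EuclideanSpace ℝ (Fin n)) :=
  {t ∈ unitCube n | ∀ i b, σ i = some b → t i = if b then 1 else 0}

/-- `f` identifies `[0,1]^n` isometrically with the subset `C`. -/
def IsChart (n : ℕ) (f : EuclideanSpace ℝ (Fin n) → X) (C : Set X) : Prop :=
  f '' unitCube n = C ∧ ∀ s ∈ unitCube n, ∀ t ∈ unitCube n, dist (f s) (f t) = dist s t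

/-- `C` is isometric to the unit cube `[0,1]^n`. -/
def IsUnitCube (n : ℕ) (C : Set X) : Prop := ∃ f, IsChart n f C

/-- `F` is a face of the unit cube `C` (possibly `C` itself). -/
def IsFace (F C : Set X) : Prop :=
  ∃ n f, IsChart n f C ∧ ∃ σ : Fin n → Option Bool, F = f '' stdFace σ

/-- `M` is a midcube of the unit cube `C`: one coordinate is set to `1/2`. -/
def IsMidcube (M C : Set X) : Prop :=
  ∃ n f, IsChart n f C ∧ ∃ i : Fin n, M = f '' {t ∈ unitCube n | t i = 1 / 2}

end Metric

/-! ### Cube complexes, walls and half-spaces -/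

/-- A cube complex structure on the metric space `X`: `X` is a union of unit Euclidean cubes, any
two of which meet in a common face or not at all, and the metric of `X` is the intrinsic one, the
infimum of the lengths of strings whose consecutive points lie in a common cube. (That cubes are
isometrically embedded and meet in single faces holds for every CAT(0) cube complex.) -/
structure CubeComplex (X : Type u) [MetricSpace X] where
  cubes : Set (Set X)
  isUnitCube : ∀ C ∈ cubes, ∃ n, IsUnitCube n C
  face_mem : ∀ C ∈ cubes, ∀ F, IsFace F C → F ∈ cubes
  inter_face : ∀ C ∈ cubes, ∀ D ∈ cubes, (C ∩ D).Nonempty → IsFace (C ∩ D) C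
  cover : ∀ x, ∃ C ∈ cubes, x ∈ C
  dist_eq : ∀ x y : X, IsGLB {L : ℝ | ∃ (n : ℕ) (p : ℕ → X), p 0 = x ∧ p n = y ∧
    (∀ i < n, ∃ C ∈ cubes, p i ∈ C ∧ p (i + 1) ∈ C) ∧
    L = ∑ i ∈ Finset.range n, dist (p i) (p (i + 1))} (dist x y)

namespace CubeComplex

variable {X : Type u} [MetricSpace X] (S : CubeComplex X)

def IsVertex (x : X) : Prop := {x} ∈ S.cubes

def IsEdge (e : Set X) : Prop := e ∈ S.cubes ∧ IsUnitCube 1 e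

/-- `e` is an edge with the two endpoints `x` and `y`. -/
def Joins (e : Set X) (x y : X) : Prop :=
  S.IsEdge e ∧ S.IsVertex x ∧ S.IsVertex y ∧ x ≠ y ∧ x ∈ e ∧ y ∈ e

/-- The midcubes of all cubes; they are the cells of the wall complex. -/
def midcubes : Set (Set X) := {M | ∃ C ∈ S.cubes, IsMidcube M C}

/-- Two midcubes lie in the same component of the wall complex: the equivalence relation generated
by one being a face of the other, which for midcubes amounts to inclusion. -/
def SameComponent : Set X → Set X → Prop :=
  Relation.EqvGen fun M N => M ∈ S.midcubes ∧ N ∈ S.midcubes ∧ M ⊆ N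

/-- A wall: the union of the midcubes in one component of the wall complex. -/
def IsWall (W : Set X) : Prop :=
  ∃ M ∈ S.midcubes, W = ⋃₀ {N ∈ S.midcubes | S.SameComponent M N}

def Wall : Type u := {W : Set X // S.IsWall W}

/-- The edge `e` is dual to the wall `W`, i.e. `W = W(e)` is the wall that `e` intersects. -/
def Dual (e : Set X) (W : S.Wall) : Prop := S.IsEdge e ∧ (e ∩ W.1).Nonempty

/-- `x` is the midpoint of the edge `e`. -/
def IsMidpoint (e : Set X) (x : X) : Prop := S.IsEdge e ∧ IsMidcube {x} e

/-- A vertex of the wall `W` in its own cube structure: the midpoint of an edge dual to `W`. -/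
def IsWallVertex (W : S.Wall) (x : X) : Prop := ∃ e, S.Dual e W ∧ S.IsMidpoint e x

/-- A half-space: the closure of a component of the complement of a wall. -/
def IsHalfSpace (A : Set X) : Prop :=
  ∃ W : S.Wall, ∃ x ∉ W.1, A = closure (connectedComponentIn W.1ᶜ x)

end CubeComplex

/-! ### Group actions and the quotient complex -/

section Action

variable {X : Type u} [MetricSpace X] {G : Type v} [Group G] [MulAction G X]

/-- Properness: each point has a ball that only finitely many group elements fail to move off
itself. -/
def ActsProperly (G : Type v) (X : Type u) [MetricSpace X] [Group G] [MulAction G X] : Prop :=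
  ∀ x : X, ∃ r > 0, {g : G | ((g • Metric.ball x r) ∩ Metric.ball x r).Nonempty}.Finite

/-- Cocompactness of the action of `H` on an invariant subset `Z`. -/
def ActsCocompactlyOn (H : Subgroup G) (Z : Set X) : Prop :=
  ∃ C ⊆ Z, IsCompact C ∧ Z ⊆ ⋃ h ∈ H, h • C

/-- The quotient space `X/K`, with the quotient topology. -/
abbrev QuotSpace (K : Subgroup G) (X : Type u) [MetricSpace X] [MulAction G X] : Type u :=
  Quotient (MulAction.orbitRel K X)

/-- The quotient map `m : X → X/K`. -/
def quotMap (K : Subgroup G) (x : X) : QuotSpace K X := Quotient.mk _ x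

/-- The quotient metric on `X/K`. -/
noncomputable def quotDist (K : Subgroup G) (p q : QuotSpace K X) : ℝ :=
  sInf {r | ∃ x y : X, quotMap K x = p ∧ quotMap K y = q ∧ r = dist x y}

/-- The distance between two subsets of `X/K`. -/
noncomputable def quotSetDist (K : Subgroup G) (A B : Set (QuotSpace K X)) : ℝ :=
  sInf {r | ∃ p ∈ A, ∃ q ∈ B, r = quotDist K p q}

/-- The defining properties of a quotient `φ : G → 𝒢` that makes walls finite at scale `R`: for
orbit representatives `W₁, …, Wₙ` of the walls of `X` there are finite index normal subgroups
`Hᵢ` of the stabilisers of the `Wᵢ` with `φ(Hᵢ)` finite, and with `φ(g) ∉ φ(Hᵢ)` whenever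
`g ∉ Hᵢ` and `d(g Wᵢ, Wᵢ) ≤ 2R`; moreover `ker φ` is torsion-free. -/
structure MakesWallsFinite {Q : Type w} [Group Q] (S : CubeComplex X) (R : ℝ) (φ : G →* Q) :
    Prop where
  surjective : Function.Surjective φ
  exists_subgroups : ∃ (n : ℕ) (W : Fin n → S.Wall) (H : Fin n → Subgroup G),
    (∀ V : S.Wall, ∃! i, ∃ g : G, V.1 = g • (W i).1) ∧
    (∀ i, H i ≤ MulAction.stabilizer G (W i).1) ∧
    (∀ i, ((H i).subgroupOf (MulAction.stabilizer G (W i).1)).Normal) ∧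
    (∀ i, ((H i).subgroupOf (MulAction.stabilizer G (W i).1)).FiniteIndex) ∧
    (∀ i, (φ '' (H i : Set G)).Finite) ∧
    (∀ i, ∀ g ∉ H i, setDist (g • (W i).1) (W i).1 ≤ 2 * R → φ g ∉ φ '' (H i : Set G))
  torsionFree : ∀ g ∈ φ.ker, IsOfFinOrder g → g = 1

/-- The walls of `X/K`: since `X → X/K` is a covering of cube complexes, these are the images of
the walls of `X`. -/
def QWall (S : CubeComplex X) (K : Subgroup G) : Type u :=
  {V : Set (QuotSpace K X) // ∃ W : S.Wall, V = quotMap K '' W.1}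

/-- The image of the wall `W` in `X/K`. -/
def bar (S : CubeComplex X) (K : Subgroup G) (W : S.Wall) : QWall S K :=
  ⟨quotMap K '' W.1, W, rfl⟩

/-! ### Colourings -/

/-- The graph on the walls of `X/K`, distinct walls being adjacent if their distance is at most
`R`. -/
def wallGraph (S : CubeComplex X) (K : Subgroup G) (R : ℝ) : SimpleGraph (QWall S K) :=
  SimpleGraph.fromRel fun V V' => quotSetDist K V.1 V'.1 ≤ R

/-- The set of proper colourings of the wall graph with colours `1, …, k + 1`. -/
structure Colouring (S : CubeComplex X) (K : Subgroup G) (R : ℝ) (k : ℕ) where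
  colour : QWall S K → ℕ
  one_le : ∀ V, 1 ≤ colour V
  le_succ : ∀ V, colour V ≤ k + 1
  proper : ∀ V V', (wallGraph S K R).Adj V V' → colour V ≠ colour V'

variable {S : CubeComplex X} {K : Subgroup G} {R : ℝ} {k : ℕ}

/-- The class `[c]_W` of the colourings that agree with `c` on the ball of radius `c(W)` about
the wall `W` of `X/K` in the wall graph. -/
def Colouring.cls (c : Colouring S K R k) (V : QWall S K) : Set (Colouring S K R k) :=
  {c' | ∀ V', (wallGraph S K R).edist V V' ≤ (c.colour V : ℕ∞) → c'.colour V' = c.colour V'}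

/-- The wall `V` of `X/K` split along `c` (at level `j`): remove from `V` all *other* walls of
colour at most `j`. -/
def splitAlong (V : QWall S K) (c : Colouring S K R k) (j : ℕ) : Set (QuotSpace K X) :=
  V.1 \ ⋃ V' ∈ {V' : QWall S K | V' ≠ V ∧ c.colour V' ≤ j}, V'.1

/-! ### Coloured pieces, boundary walls and portals -/

/-- The triple `(Z, H, (c_x))` is a coloured piece at level `j`: `Z` is a non-empty intersection of
half-spaces on which `H` acts freely and cocompactly, the colourings `c_x` (which matter only for
vertices `x ∈ Z`) are `H`-equivariant, adjacent vertices of `Z` have equivalent colourings with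
respect to the edge joining them, and an edge at a vertex `x ∈ Z` stays in `Z` precisely when its
colour `c_x(e)` exceeds `j`. -/
structure IsColouredPiece (j : ℕ) (Z : Set X) (H : Subgroup G) (c : X → Colouring S K R k) :
    Prop where
  halfSpaces : ∃ A : Set (Set X), (∀ B ∈ A, S.IsHalfSpace B) ∧ Z = ⋂₀ A
  nonempty : Z.Nonempty
  invariant : ∀ h ∈ H, h • Z = Z
  free : ∀ h ∈ H, ∀ z ∈ Z, h • z = z → h = 1
  cocompact : ActsCocompactlyOn H Z
  equivariant : ∀ h ∈ H, ∀ x ∈ Z, S.IsVertex x → ∀ W W' : S.Wall, W'.1 = h • W.1 →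
    (c (h • x)).colour (bar S K W') = (c x).colour (bar S K W)
  adjacent : ∀ e x y, S.Joins e x y → x ∈ Z → y ∈ Z → ∀ W, S.Dual e W →
    (c x).cls (bar S K W) = (c y).cls (bar S K W)
  mem_iff : ∀ e x y, S.Joins e x y → x ∈ Z → ∀ W, S.Dual e W →
    (y ∈ Z ↔ j < (c x).colour (bar S K W))

/-- Colourings `c_e` of the edges that meet `Z`, with `[c_e]_e = [c_x]_e` whenever `e` is incident
at the vertex `x ∈ Z`. -/
def IsEdgeColouring (Z : Set X) (c : X → Colouring S K R k) (cE : Set X → Colouring S K R k) :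
    Prop :=
  ∀ e W x, S.Dual e W → S.IsVertex x → x ∈ Z → x ∈ e →
    (cE e).cls (bar S K W) = (c x).cls (bar S K W)

/-- The edge `e` crosses out of `Z`. -/
def CrossesOut (S : CubeComplex X) (Z e : Set X) : Prop := ∃ x y, S.Joins e x y ∧ x ∈ Z ∧ y ∉ Z

/-- `W` is a boundary wall of `Z`: it is dual to an edge that crosses out of `Z`. -/
def IsBoundaryWall (Z : Set X) (W : S.Wall) : Prop := ∃ e, S.Dual e W ∧ CrossesOut S Z e

/-- `W` is a boundary wall of `Z` of colour `j`. -/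
def IsJBoundaryWall (j : ℕ) (Z : Set X) (cE : Set X → Colouring S K R k) (W : S.Wall) : Prop :=
  ∃ e, S.Dual e W ∧ CrossesOut S Z e ∧ (cE e).colour (bar S K W) = j

/-- The portal `P = Z ∩ W`. -/
def portal (Z : Set X) (W : S.Wall) : Set X := Z ∩ W.1

/-- The edge `e` is dual to the portal `Z ∩ W`. -/
def DualToPortal (Z : Set X) (W : S.Wall) (e : Set X) : Prop := S.Dual e W ∧ CrossesOut S Z e

/-- The interior of the portal `Z ∩ W` with respect to the topology of `W`. -/
def portalInterior (Z : Set X) (W : S.Wall) : Set X :=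
  Subtype.val '' interior (Subtype.val ⁻¹' portal Z W : Set W.1)

/-- The group of deck transformations of a map `f`. -/
def deckGroup {A B : Type*} [TopologicalSpace A] (f : A → B) : Subgroup (A ≃ₜ A) where
  carrier := {h | ∀ a, f (h a) = f a}
  mul_mem' {a b} ha hb x := by
    change f (a (b x)) = f x
    rw [ha, hb]
  one_mem' _ := rfl
  inv_mem' {a} ha x := by
    have h := ha (a⁻¹ x)
    have h' : a (a⁻¹ x) = x := a.apply_symm_apply x
    rw [h'] at h
    exact h.symm

end Action

end PortalCovers

open PortalCovers

/-! Everything rests on convexity. Walls of `X` are closed and geodesically convex, a wall meets a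
cube in at most one midcube, and its complement has at most two sides; hence `Z` and `P = Z ∩ W` are
closed and convex. All of `Z` lies on one closed side of each boundary wall, so a geodesic between
points of `Z` off a boundary wall misses that wall. The interior of `P`, being `P` minus the other
boundary walls, is therefore convex too, and contracts along geodesics.

The colourings enter through one observation. Between vertices of `Z` along `P` one crosses walls
`V` that meet `W`. The edge crossed stays in `Z`, so `V` has colour above `j`, whereas `W` has
colour at most `j`. Walls that meet have adjacent images in the wall graph, so the ball of radius
`c(W)` about `W` lies in the ball of radius `c(V)` about `V`, and `[c_x]_W` does not change
(`Colouring.cls_eq_of_adj`, `cls_eq_of_mem_cube`, `cls_eq_of_portal`). This class is `[c_e]_W`, and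
it determines the colours of all walls that meet `W`. So a wall other than `W` through a point of
`P` is a boundary wall exactly if its `c_e`-colour is at most `j`: within `P`, the interior is the
preimage of the split wall (`mem_portalInterior_iff_quotMap_mem`).

Translates of `W` under `K` are equal or disjoint, and `K` acts as a group of deck transformations.
A geodesic of `W` that starts in the interior of `P` and avoids the removed walls cannot leave it
(`mem_portalInterior_of_geo`). Hence the interior is open, and its translates are locally open and
closed, in the preimage of the split wall, and an element of `K` that maps one point of the interior
into it preserves it. `exists_covering` turns this into the covering and its deck group.

The geometry of walls is derived from the metric. Near a point of a midcube the function `hgt a b`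
of a dual edge is a signed coordinate; reflections in its level sets are 1-Lipschitz, which makes it
affine on short geodesics (`EdgeAt.hgt_midpoint`). Germs of midcubes can then be carried along
varying geodesics (`IsTrack.push`), which shows that walls are convex and do not cross themselves.
-/

namespace PortalCovers

universe u v w

/-! ### Charts of cubes -/

section Charts

variable {X : Type u} [MetricSpace X]

lemma euclidean_dist_sq {n : ℕ} (s t : EuclideanSpace ℝ (Fin n)) :
    dist s t ^ 2 = ∑ i, (s i - t i) ^ 2 := by
  rw [EuclideanSpace.dist_sq_eq]
  exact Finset.sum_congr rfl fun i _ => by rw [Real.dist_eq, sq_abs]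

lemma dist_sq_le_of_mem_unitCube {n : ℕ} {s t : EuclideanSpace ℝ (Fin n)}
    (hs : s ∈ unitCube n) (ht : t ∈ unitCube n) : dist s t ^ 2 ≤ n := by
  rw [euclidean_dist_sq]
  calc ∑ i, (s i - t i) ^ 2 ≤ ∑ _i : Fin n, (1 : ℝ) := Finset.sum_le_sum fun i _ => by
        have h1 := hs i; have h2 := ht i
        simp only [mem_Icc] at h1 h2
        nlinarith
    _ = n := by simp

/-- A point of the unit cube at maximal distance from another one is a corner. -/
lemma corner_of_dist_sq_eq {n : ℕ} {s t : EuclideanSpace ℝ (Fin n)}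
    (hs : s ∈ unitCube n) (ht : t ∈ unitCube n) (h : dist s t ^ 2 = n) (i : Fin n) :
    s i = 0 ∨ s i = 1 := by
  rw [euclidean_dist_sq] at h
  have hle : ∀ i ∈ Finset.univ, (s i - t i) ^ 2 ≤ 1 := fun i _ => by
    have h1 := hs i; have h2 := ht i
    simp only [mem_Icc] at h1 h2
    nlinarith
  have heq : ∑ i, (s i - t i) ^ 2 = ∑ _i : Fin n, (1 : ℝ) := by simpa using h
  have := (Finset.sum_eq_sum_iff_of_le hle).1 heq i (Finset.mem_univ _)
  have h1 := hs i; have h2 := ht i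
  simp only [mem_Icc] at h1 h2
  have h3 : (s i - t i - 1) * (s i - t i + 1) = 0 := by linarith [this, sq (s i - t i)]
  rcases mul_eq_zero.1 h3 with h | h
  · right; linarith
  · left; linarith

/-- The diagonal of `[0,1]^n` has squared length `n`, and no squared distance in `[0,1]^m` exceeds
`m`. -/
lemma IsChart.dim_le {n m : ℕ} {f : EuclideanSpace ℝ (Fin n) → X}
    {g : EuclideanSpace ℝ (Fin m) → X} {C : Set X} (hf : IsChart n f C) (hg : IsChart m g C) :
    n ≤ m := by
  set o : EuclideanSpace ℝ (Fin n) := WithLp.toLp 2 fun _ => 0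
  set w : EuclideanSpace ℝ (Fin n) := WithLp.toLp 2 fun _ => 1
  have ho : o ∈ unitCube n := fun i => by simp [o]
  have hw : w ∈ unitCube n := fun i => by simp [w]
  obtain ⟨s, hs, hs'⟩ : f o ∈ g '' unitCube m := by rw [hg.1, ← hf.1]; exact ⟨o, ho, rfl⟩
  obtain ⟨t, ht, ht'⟩ : f w ∈ g '' unitCube m := by rw [hg.1, ← hf.1]; exact ⟨w, hw, rfl⟩
  have h1 := dist_sq_le_of_mem_unitCube hs ht
  rw [← hg.2 s hs t ht, hs', ht', hf.2 o ho w hw, euclidean_dist_sq] at h1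
  have : (n : ℝ) ≤ m := by simpa [o, w] using h1
  exact_mod_cast this

lemma IsChart.dim_eq {n m : ℕ} {f : EuclideanSpace ℝ (Fin n) → X}
    {g : EuclideanSpace ℝ (Fin m) → X} {C : Set X} (hf : IsChart n f C) (hg : IsChart m g C) :
    n = m := le_antisymm (hf.dim_le hg) (hg.dim_le hf)

/-- Two charts of the same cube differ by a permutation of the coordinates and by reflections. -/
lemma IsChart.transition {n : ℕ} {f g : EuclideanSpace ℝ (Fin n) → X} {C : Set X}
    (hf : IsChart n f C) (hg : IsChart n g C) :
    ∃ (π : Equiv.Perm (Fin n)) (b : Fin n → Bool), ∀ s ∈ unitCube n, ∀ t ∈ unitCube n,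
      f s = g t → ∀ i, t (π i) = if b i then 1 - s i else s i := by
  classical
  have hex : ∀ s ∈ unitCube n, ∃ t ∈ unitCube n, g t = f s := fun s hs => by
    have : f s ∈ g '' unitCube n := by rw [hg.1, ← hf.1]; exact ⟨s, hs, rfl⟩
    simpa using this
  have hd : ∀ s ∈ unitCube n, ∀ s' ∈ unitCube n, ∀ t ∈ unitCube n, ∀ t' ∈ unitCube n,
      g t = f s → g t' = f s' → dist t t' = dist s s' := fun s hs s' hs' t ht t' ht' h h' => by
    rw [← hg.2 t ht t' ht', h, h', hf.2 s hs s' hs']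
  -- A corner has an antipode at the maximal squared distance `n`. This is a metric property, so
  -- corners correspond to corners.
  have corner : ∀ s ∈ unitCube n, (∀ i, s i = 0 ∨ s i = 1) → ∀ t ∈ unitCube n, g t = f s →
      ∀ i, t i = 0 ∨ t i = 1 := by
    intro s hs hc t ht h
    set s' : EuclideanSpace ℝ (Fin n) := WithLp.toLp 2 fun i => 1 - s i
    have hs' : s' ∈ unitCube n := fun i => by
      have := hs i; simp only [mem_Icc, s'] at this ⊢; constructor <;> linarith
    obtain ⟨t', ht', h'⟩ := hex s' hs'
    refine corner_of_dist_sq_eq ht ht' ?_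
    rw [hd s hs s' hs' t ht t' ht' h h', euclidean_dist_sq]
    have : ∀ i, (s i - s' i) ^ 2 = 1 := fun i => by
      rcases hc i with h | h <;> simp [s', h]
    simp [this]
  set o : EuclideanSpace ℝ (Fin n) := WithLp.toLp 2 fun _ => 0
  have ho : o ∈ unitCube n := fun i => by simp [o]
  set ε : Fin n → EuclideanSpace ℝ (Fin n) := fun k => WithLp.toLp 2 fun i => if i = k then 1 else 0
  have hε : ∀ k, ε k ∈ unitCube n := fun k i => by simp only [ε]; split_ifs <;> simp
  have hεc : ∀ k i, ε k i = 0 ∨ ε k i = 1 := fun k i => by simp only [ε]; split_ifs <;> simp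
  obtain ⟨v, hv, hfv⟩ := hex o ho
  choose w hw hfw using fun k => hex (ε k) (hε k)
  have hvc := corner o ho (fun i => by simp [o]) v hv hfv
  have hwc := fun k => corner (ε k) (hε k) (hεc k) (w k) (hw k) (hfw k)
  have hdist1 : ∀ k, ∑ i, (v i - w k i) ^ 2 = 1 := fun k => by
    rw [← euclidean_dist_sq, hd o ho _ (hε k) v hv _ (hw k) hfv (hfw k), euclidean_dist_sq]
    simp [o, ε]
  -- The points `v` and `w k` that correspond to the origin and to the unit vector `ε k` are corners
  -- at distance 1, so exactly one coordinate differs; it becomes `π k`.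
  have hone : ∀ k, ∃ i, v i ≠ w k i ∧ ∀ i', i' ≠ i → v i' = w k i' := by
    intro k
    have : ∃ i, v i ≠ w k i := by
      by_contra! hcon
      have h1 := hdist1 k
      simp [hcon] at h1
    obtain ⟨i, hi⟩ := this
    refine ⟨i, hi, fun i' hi' => ?_⟩
    by_contra hne
    have hsq : ∀ l, v l ≠ w k l → (v l - w k l) ^ 2 = 1 := fun l hl => by
      rcases hvc l with h | h <;> rcases hwc k l with h' | h' <;> simp_all
    have h2 : ∑ l ∈ ({i, i'} : Finset (Fin n)), (v l - w k l) ^ 2 ≤ 1 := by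
      rw [← hdist1 k]
      exact Finset.sum_le_sum_of_subset_of_nonneg (Finset.subset_univ _)
        fun _ _ _ => sq_nonneg _
    rw [Finset.sum_pair hi'.symm, hsq i hi, hsq i' hne] at h2
    norm_num at h2
  choose π hπ hπ' using hone
  -- If `π k = π k'`, then `w k` and `w k'` are both `v` with the same coordinate flipped, but `ε k
  -- ≠ ε k'`.
  have hinj : Function.Injective π := by
    intro k k' hkk
    by_contra hne
    have : w k = w k' := by
      ext i
      by_cases hi : i = π k
      · subst hi
        have h1 := hπ k
        have h2 := hπ k'
        rw [← hkk] at h2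
        rcases hvc (π k) with h | h <;> rcases hwc k (π k) with h' | h' <;>
          rcases hwc k' (π k) with h'' | h'' <;> simp_all
      · rw [← hπ' k i hi, ← hπ' k' i (hkk ▸ hi)]
    have h3 : dist (w k) (w k') = dist (ε k) (ε k') :=
      hd _ (hε k) _ (hε k') _ (hw k) _ (hw k') (hfw k) (hfw k')
    rw [this, dist_self] at h3
    have h4 := congrArg (fun x : EuclideanSpace ℝ (Fin n) => x k) (dist_eq_zero.1 h3.symm)
    simp [ε, hne] at h4
  refine ⟨Equiv.ofBijective π (Finite.injective_iff_bijective.1 hinj), fun k => decide (v (π k) = 1),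
    fun s hs t ht hst k => ?_⟩
  -- Coordinates are read off from distances: the difference of squared distances to the origin and
  -- to `ε k` is `2 s k - 1`, and in the other chart it involves only the coordinate `π k`.
  have e1 : dist t v ^ 2 - dist t (w k) ^ 2 = dist s o ^ 2 - dist s (ε k) ^ 2 := by
    rw [hd s hs o ho t ht v hv hst.symm hfv, hd s hs _ (hε k) t ht _ (hw k) hst.symm (hfw k)]
  have e2 : dist s o ^ 2 - dist s (ε k) ^ 2 = 2 * s k - 1 := by
    rw [euclidean_dist_sq, euclidean_dist_sq, ← Finset.sum_sub_distrib,
      Finset.sum_eq_single k]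
    · simp [o, ε]; ring
    · intro i _ hi; simp [o, ε, hi]
    · simp
  have e3 : dist t v ^ 2 - dist t (w k) ^ 2 =
      (t (π k) - v (π k)) ^ 2 - (t (π k) - w k (π k)) ^ 2 := by
    rw [euclidean_dist_sq, euclidean_dist_sq, ← Finset.sum_sub_distrib,
      Finset.sum_eq_single (π k)]
    · intro i _ hi; rw [hπ' k i hi]; ring
    · simp
  rw [e3, e2] at e1
  have h1 := hπ k
  simp only [Equiv.ofBijective_apply, decide_eq_true_eq]
  rcases hvc (π k) with h | h <;> rcases hwc k (π k) with h' | h'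
  · exact absurd (h.trans h'.symm) h1
  · rw [h, h'] at e1
    simp only [h, zero_ne_one, if_false]
    nlinarith
  · rw [h, h'] at e1
    simp only [h, if_true]
    nlinarith
  · exact absurd (h.trans h'.symm) h1

/-- Permutations and reflections of the coordinates permute the faces, so faces can be described in
one fixed chart. -/
lemma IsChart.image_stdFace {n m : ℕ} {f : EuclideanSpace ℝ (Fin n) → X}
    {g : EuclideanSpace ℝ (Fin m) → X} {C : Set X} (hf : IsChart n f C) (hg : IsChart m g C)
    (σ : Fin n → Option Bool) : ∃ τ : Fin m → Option Bool, f '' stdFace σ = g '' stdFace τ := by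
  obtain rfl := hf.dim_eq hg
  obtain ⟨π, b, h⟩ := hf.transition hg
  refine ⟨fun k => (σ (π.symm k)).map fun c => xor (b (π.symm k)) c, ?_⟩
  ext x
  have key : ∀ s ∈ unitCube n, ∀ t ∈ unitCube n, f s = g t → ((s ∈ stdFace σ) ↔
      t ∈ stdFace fun k => (σ (π.symm k)).map fun c => xor (b (π.symm k)) c) := by
    intro s hs t ht hst
    have h' := h s hs t ht hst
    constructor
    · rintro ⟨-, h1⟩
      refine ⟨ht, fun k c hc => ?_⟩
      obtain ⟨c', hc', rfl⟩ := Option.map_eq_some_iff.1 hc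
      have h2 := h' (π.symm k)
      rw [Equiv.apply_symm_apply, h1 _ _ hc'] at h2
      rw [h2]
      cases b (π.symm k) <;> cases c' <;> simp
    · rintro ⟨-, h1⟩
      refine ⟨hs, fun k c hc => ?_⟩
      have h2 := h' k
      rw [h1 (π k) (xor (b k) c) (by simp [hc])] at h2
      cases hb : b k <;> cases c <;> simp [hb] at h2 ⊢ <;> linarith
  constructor
  · rintro ⟨s, hs, rfl⟩
    obtain ⟨t, ht, hst⟩ : f s ∈ g '' unitCube n := by rw [hg.1, ← hf.1]; exact ⟨s, hs.1, rfl⟩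
    exact ⟨t, (key s hs.1 t ht hst.symm).1 hs, hst⟩
  · rintro ⟨t, ht, rfl⟩
    obtain ⟨s, hs, hst⟩ : g t ∈ f '' unitCube n := by rw [hf.1, ← hg.1]; exact ⟨t, ht.1, rfl⟩
    exact ⟨s, (key s hs t ht.1 hst).2 ht, hst⟩

lemma IsChart.image_midcube {n m : ℕ} {f : EuclideanSpace ℝ (Fin n) → X}
    {g : EuclideanSpace ℝ (Fin m) → X} {C : Set X} (hf : IsChart n f C) (hg : IsChart m g C)
    (i : Fin n) : ∃ k : Fin m,
      f '' {t ∈ unitCube n | t i = 1 / 2} = g '' {t ∈ unitCube m | t k = 1 / 2} := by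
  obtain rfl := hf.dim_eq hg
  obtain ⟨π, b, h⟩ := hf.transition hg
  refine ⟨π i, ?_⟩
  have key : ∀ s ∈ unitCube n, ∀ t ∈ unitCube n, f s = g t → (s i = 1 / 2 ↔ t (π i) = 1 / 2) := by
    intro s hs t ht hst
    rw [h s hs t ht hst i]
    split_ifs
    · constructor <;> intro <;> linarith
    · rfl
  ext x
  constructor
  · rintro ⟨s, hs, rfl⟩
    obtain ⟨t, ht, hst⟩ : f s ∈ g '' unitCube n := by rw [hg.1, ← hf.1]; exact ⟨s, hs.1, rfl⟩
    exact ⟨t, ⟨ht, (key s hs.1 t ht hst.symm).1 hs.2⟩, hst⟩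
  · rintro ⟨t, ht, rfl⟩
    obtain ⟨s, hs, hst⟩ : g t ∈ f '' unitCube n := by rw [hf.1, ← hg.1]; exact ⟨t, ht.1, rfl⟩
    exact ⟨s, ⟨hs, (key s hs t ht.1 hst).2 ht.2⟩, hst⟩

end Charts

/-! ### Coordinates on the cubes of a cube complex -/

section Coordinates

variable {X : Type u} [MetricSpace X]

/-- The dimension of a cube. -/
noncomputable def cubeDim (C : Set X) : ℕ := Classical.epsilon fun n => IsUnitCube n C

/-- A fixed chart of a cube. -/
noncomputable def cubeChart [Nonempty X] (C : Set X) : EuclideanSpace ℝ (Fin (cubeDim C)) → X :=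
  Classical.epsilon fun f => IsChart (cubeDim C) f C

/-- The coordinates of a point of a cube with respect to the fixed chart. -/
noncomputable def coord [Nonempty X] (C : Set X) (x : X) : EuclideanSpace ℝ (Fin (cubeDim C)) :=
  Function.invFunOn (cubeChart C) (unitCube _) x

/-- The point of the cube `C` obtained from `x` by setting the coordinate `i` to `v`. -/
noncomputable def move [Nonempty X] (C : Set X) (x : X) (i : Fin (cubeDim C)) (v : ℝ) : X :=
  cubeChart C (WithLp.toLp 2 (Function.update (coord C x) i v))

/-- The midcube of `C` in which the coordinate `i` is `1/2`. -/
def mid [Nonempty X] (C : Set X) (i : Fin (cubeDim C)) : Set X := {x ∈ C | coord C x i = 1 / 2}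

/-- The face of `C` in which the coordinates are frozen according to `σ`. -/
def faceOf [Nonempty X] (C : Set X) (σ : Fin (cubeDim C) → Option Bool) : Set X :=
  {x ∈ C | ∀ i b, σ i = some b → coord C x i = if b then 1 else 0}

/-- The signed distance from the bisector of `a` and `b`, for points of a cube that contains the
edge with endpoints `a` and `b`. -/
noncomputable def hgt (a b x : X) : ℝ := (dist x a ^ 2 - dist x b ^ 2) / 2

lemma continuous_hgt (a b : X) : Continuous (hgt a b) := by
  unfold hgt; fun_prop

variable [Nonempty X] (S : CubeComplex X) {C D : Set X}

namespace CubeComplex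

lemma isChart (hC : C ∈ S.cubes) : IsChart (cubeDim C) (cubeChart C) C := by
  have h : IsUnitCube (cubeDim C) C := Classical.epsilon_spec (S.isUnitCube C hC)
  exact Classical.epsilon_spec (p := fun f => IsChart (cubeDim C) f C) h

lemma coord_spec (hC : C ∈ S.cubes) {x : X} (hx : x ∈ C) :
    coord C x ∈ unitCube (cubeDim C) ∧ cubeChart C (coord C x) = x := by
  have h : x ∈ cubeChart C '' unitCube (cubeDim C) := by rwa [(S.isChart hC).1]
  exact ⟨Function.invFunOn_mem h, Function.invFunOn_eq h⟩

lemma coord_nonneg (hC : C ∈ S.cubes) {x : X} (hx : x ∈ C) (i) : 0 ≤ coord C x i :=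
  ((S.coord_spec hC hx).1 i).1

lemma coord_le_one (hC : C ∈ S.cubes) {x : X} (hx : x ∈ C) (i) : coord C x i ≤ 1 :=
  ((S.coord_spec hC hx).1 i).2

lemma chart_mem (hC : C ∈ S.cubes) {t} (ht : t ∈ unitCube (cubeDim C)) : cubeChart C t ∈ C := 
  (S.isChart hC).1.subset ⟨t, ht, rfl⟩

lemma coord_chart (hC : C ∈ S.cubes) {t} (ht : t ∈ unitCube (cubeDim C)) :
    coord C (cubeChart C t) = t := by
  obtain ⟨h1, h2⟩ := S.coord_spec hC (S.chart_mem hC ht)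
  have h := (S.isChart hC).2 _ h1 _ ht
  rw [h2, dist_self] at h
  exact dist_eq_zero.1 h.symm

lemma dist_coord (hC : C ∈ S.cubes) {x y : X} (hx : x ∈ C) (hy : y ∈ C) :
    dist x y = dist (coord C x) (coord C y) := by
  rw [← (S.isChart hC).2 _ (S.coord_spec hC hx).1 _ (S.coord_spec hC hy).1,
    (S.coord_spec hC hx).2, (S.coord_spec hC hy).2]

lemma dist_sq_coord (hC : C ∈ S.cubes) {x y : X} (hx : x ∈ C) (hy : y ∈ C) :
    dist x y ^ 2 = ∑ i, (coord C x i - coord C y i) ^ 2 := by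
  rw [S.dist_coord hC hx hy, euclidean_dist_sq]

lemma coord_ext (hC : C ∈ S.cubes) {x y : X} (hx : x ∈ C) (hy : y ∈ C)
    (h : ∀ i, coord C x i = coord C y i) : x = y := by
  rw [← (S.coord_spec hC hx).2, ← (S.coord_spec hC hy).2]
  congr 1
  ext i
  exact h i

lemma abs_coord_sub_le (hC : C ∈ S.cubes) {x y : X} (hx : x ∈ C) (hy : y ∈ C) (i) :
    |coord C x i - coord C y i| ≤ dist x y := by
  refine abs_le_of_sq_le_sq ?_ dist_nonneg
  rw [S.dist_sq_coord hC hx hy]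
  exact Finset.single_le_sum (f := fun i => (coord C x i - coord C y i) ^ 2)
    (fun _ _ => sq_nonneg _) (Finset.mem_univ i)

/-- Every point of the unit cube is the coordinate vector of a point of `C`. -/
lemma exists_coord_eq (hC : C ∈ S.cubes) (t : Fin (cubeDim C) → ℝ) (ht : ∀ i, t i ∈ Icc (0 : ℝ) 1) :
    ∃ x ∈ C, ∀ i, coord C x i = t i := by
  have h : (WithLp.toLp 2 t : EuclideanSpace ℝ _) ∈ unitCube (cubeDim C) := fun i => ht i
  exact ⟨cubeChart C (WithLp.toLp 2 t), S.chart_mem hC h, fun i => by rw [S.coord_chart hC h]⟩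

lemma move_spec (hC : C ∈ S.cubes) {x : X} (hx : x ∈ C) (i) {v : ℝ} (hv : v ∈ Icc (0 : ℝ) 1) :
    move C x i v ∈ C ∧ ∀ k, coord C (move C x i v) k = if k = i then v else coord C x k := by
  have h : (WithLp.toLp 2 (Function.update (coord C x) i v) : EuclideanSpace ℝ _) ∈
      unitCube (cubeDim C) := fun k => by
    by_cases hk : k = i
    · subst hk; simpa using hv
    · simpa [hk] using (S.coord_spec hC hx).1 k
  refine ⟨S.chart_mem hC h, fun k => ?_⟩
  rw [move, S.coord_chart hC h]
  by_cases hk : k = i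
  · subst hk; simp
  · simp [hk]

lemma move_mem (hC : C ∈ S.cubes) {x : X} (hx : x ∈ C) (i) {v : ℝ} (hv : v ∈ Icc (0 : ℝ) 1) :
    move C x i v ∈ C := (S.move_spec hC hx i hv).1

lemma coord_move_self (hC : C ∈ S.cubes) {x : X} (hx : x ∈ C) (i) {v : ℝ} (hv : v ∈ Icc (0 : ℝ) 1) :
    coord C (move C x i v) i = v := by simp [(S.move_spec hC hx i hv).2]

lemma coord_move_of_ne (hC : C ∈ S.cubes) {x : X} (hx : x ∈ C) {i k} {v : ℝ}
    (hv : v ∈ Icc (0 : ℝ) 1) (h : k ≠ i) :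
    coord C (move C x i v) k = coord C x k := by simp [(S.move_spec hC hx i hv).2, h]

lemma dist_move (hC : C ∈ S.cubes) {x : X} (hx : x ∈ C) (i) {v : ℝ} (hv : v ∈ Icc (0 : ℝ) 1) :
    dist x (move C x i v) = |coord C x i - v| := by
  rw [← abs_of_nonneg (dist_nonneg (x := x)), ← sq_eq_sq_iff_abs_eq_abs,
    S.dist_sq_coord hC hx (S.move_mem hC hx i hv), Finset.sum_eq_single i]
  · rw [S.coord_move_self hC hx i hv]
  · intro k _ hk; rw [S.coord_move_of_ne hC hx hv hk]; simp
  · simp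

/-! #### Faces, vertices and midcubes -/

lemma image_stdFace (hC : C ∈ S.cubes) (σ) : cubeChart C '' stdFace σ = faceOf C σ := by
  ext x
  constructor
  · rintro ⟨t, ht, rfl⟩
    exact ⟨S.chart_mem hC ht.1, by rw [S.coord_chart hC ht.1]; exact ht.2⟩
  · rintro ⟨hx, h⟩
    exact ⟨coord C x, ⟨(S.coord_spec hC hx).1, h⟩, (S.coord_spec hC hx).2⟩

lemma image_mid (hC : C ∈ S.cubes) (i) :
    cubeChart C '' {t ∈ unitCube _ | t i = 1 / 2} = mid C i := by
  ext x
  constructor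
  · rintro ⟨t, ht, rfl⟩
    exact ⟨S.chart_mem hC ht.1, by rw [S.coord_chart hC ht.1]; exact ht.2⟩
  · rintro ⟨hx, h⟩
    exact ⟨coord C x, ⟨(S.coord_spec hC hx).1, h⟩, (S.coord_spec hC hx).2⟩

lemma faceOf_mem (hC : C ∈ S.cubes) (σ) : faceOf C σ ∈ S.cubes :=
  S.face_mem C hC _ ⟨_, _, S.isChart hC, σ, (S.image_stdFace hC σ).symm⟩

lemma exists_inter_eq_faceOf (hC : C ∈ S.cubes) (hD : D ∈ S.cubes) (h : (C ∩ D).Nonempty) :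
    ∃ σ, C ∩ D = faceOf C σ := by
  obtain ⟨n, f, hf, σ, hσ⟩ := S.inter_face C hC D hD h
  obtain ⟨τ, hτ⟩ := hf.image_stdFace (S.isChart hC) σ
  exact ⟨τ, by rw [hσ, hτ, S.image_stdFace hC]⟩

/-- A face of `C` that contains a point with interior `i`-coordinate is closed under changes of the
`i`-coordinate. -/
lemma move_mem_of_mem (hC : C ∈ S.cubes) (hD : D ∈ S.cubes) {x : X} (hx : x ∈ C) (hx' : x ∈ D) {i}
    (h0 : coord C x i ≠ 0) (h1 : coord C x i ≠ 1) {v : ℝ} (hv : v ∈ Icc (0 : ℝ) 1) :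
    move C x i v ∈ D := by
  obtain ⟨σ, hσ⟩ := S.exists_inter_eq_faceOf hC hD ⟨x, hx, hx'⟩
  have hxσ : x ∈ faceOf C σ := hσ ▸ ⟨hx, hx'⟩
  suffices move C x i v ∈ faceOf C σ by rw [← hσ] at this; exact this.2
  refine ⟨S.move_mem hC hx i hv, fun k b hk => ?_⟩
  have hki : k ≠ i := by
    rintro rfl
    have := hxσ.2 k b hk
    cases b <;> simp_all
  rw [S.coord_move_of_ne hC hx hv hki]
  exact hxσ.2 k b hk

/-- If the coordinate were interior, the face `C ∩ {x}` would be closed under changing it. -/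
lemma coord_vertex (hC : C ∈ S.cubes) {x : X} (hx : x ∈ C) (hv : S.IsVertex x) (i) :
    coord C x i = 0 ∨ coord C x i = 1 := by
  by_contra! h
  have h1 := S.move_mem_of_mem hC hv hx rfl h.1 h.2 (v := 0) (by simp)
  have h2 := S.coord_move_self hC hx i (v := 0) (by simp)
  rw [mem_singleton_iff.1 h1] at h2
  exact h.1 h2

lemma isVertex_of_coord (hC : C ∈ S.cubes) {x : X} (hx : x ∈ C)
    (h : ∀ i, coord C x i = 0 ∨ coord C x i = 1) : S.IsVertex x := by
  classical
  have : {x} = faceOf C fun i => some (decide (coord C x i = 1)) := by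
    ext y
    constructor
    · rintro rfl
      refine ⟨hx, fun i b hb => ?_⟩
      obtain rfl := Option.some_injective _ hb
      rcases h i with h | h <;> simp [h]
    · rintro ⟨hy, hy'⟩
      refine S.coord_ext hC hy hx fun i => ?_
      rw [hy' i _ rfl]
      rcases h i with h | h <;> simp [h]
  rw [IsVertex, this]
  exact S.faceOf_mem hC _

lemma mid_mem (hC : C ∈ S.cubes) (i) : mid C i ∈ S.midcubes :=
  ⟨C, hC, _, _, S.isChart hC, i, (S.image_mid hC i).symm⟩

lemma isMidcube_iff (hC : C ∈ S.cubes) {M : Set X} : IsMidcube M C ↔ ∃ i, M = mid C i := by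
  constructor
  · rintro ⟨n, f, hf, i, hM⟩
    obtain ⟨k, hk⟩ := hf.image_midcube (S.isChart hC) i
    exact ⟨k, by rw [hM, hk, S.image_mid hC]⟩
  · rintro ⟨i, rfl⟩
    exact ⟨_, _, S.isChart hC, i, (S.image_mid hC i).symm⟩

lemma exists_eq_mid {M : Set X} (hM : M ∈ S.midcubes) : ∃ C ∈ S.cubes, ∃ i, M = mid C i := by
  obtain ⟨C, hC, h⟩ := hM
  exact ⟨C, hC, (S.isMidcube_iff hC).1 h⟩

lemma mid_nonempty (hC : C ∈ S.cubes) (i) : (mid C i).Nonempty := by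
  obtain ⟨x, hx, h⟩ := S.exists_coord_eq hC (fun _ => 1 / 2) (fun _ => by norm_num)
  exact ⟨x, hx, h i⟩

/-! #### Edges -/

/-- `a` and `b` are the endpoints of an edge of the cube `C`. -/
structure EdgeIn (a b : X) (C : Set X) : Prop where
  left : S.IsVertex a
  right : S.IsVertex b
  dist_eq : dist a b = 1
  left_mem : a ∈ C
  right_mem : b ∈ C

omit [Nonempty X] in
lemma EdgeIn.mono {S : CubeComplex X} {a b : X} (h : S.EdgeIn a b C) (ha : a ∈ D) (hb : b ∈ D) :
    S.EdgeIn a b D := ⟨h.1, h.2, h.3, ha, hb⟩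

/-- The endpoints of an edge of `C` differ in exactly one coordinate, and their height function is
that coordinate, up to sign and translation. -/
lemma EdgeIn.exists_coord {S : CubeComplex X} {a b : X} (hC : C ∈ S.cubes) (h : S.EdgeIn a b C) :
    ∃ i, (∀ k ≠ i, coord C a k = coord C b k) ∧ ∃ s : ℝ, (s = 1 ∨ s = -1) ∧
      ∀ x ∈ C, hgt a b x = s * (coord C x i - 1 / 2) := by
  classical
  have hac := S.coord_vertex hC h.left_mem h.left
  have hbc := S.coord_vertex hC h.right_mem h.right
  have hsum : ∑ i, (coord C a i - coord C b i) ^ 2 = 1 := by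
    rw [← S.dist_sq_coord hC h.left_mem h.right_mem, h.dist_eq, one_pow]
  have hsq : ∀ l, coord C a l ≠ coord C b l → (coord C a l - coord C b l) ^ 2 = 1 := fun l hl => by
    rcases hac l with h | h <;> rcases hbc l with h' | h' <;> simp_all
  have : ∃ i, coord C a i ≠ coord C b i := by
    by_contra! hcon
    simp [hcon] at hsum
  obtain ⟨i, hi⟩ := this
  have hne : ∀ k ≠ i, coord C a k = coord C b k := by
    intro k hk
    by_contra hne
    have h2 : ∑ l ∈ ({i, k} : Finset _), (coord C a l - coord C b l) ^ 2 ≤ 1 := by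
      rw [← hsum]
      exact Finset.sum_le_sum_of_subset_of_nonneg (Finset.subset_univ _)
        fun _ _ _ => sq_nonneg _
    rw [Finset.sum_pair hk.symm, hsq i hi, hsq k hne] at h2
    norm_num at h2
  refine ⟨i, hne, ?_⟩
  have key : ∀ x ∈ C, hgt a b x =
      ((coord C x i - coord C a i) ^ 2 - (coord C x i - coord C b i) ^ 2) / 2 := by
    intro x hx
    rw [hgt, S.dist_sq_coord hC hx h.left_mem, S.dist_sq_coord hC hx h.right_mem,
      ← Finset.sum_sub_distrib, Finset.sum_eq_single i]
    · intro k _ hk; rw [hne k hk]; ring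
    · simp
  rcases hac i with ha | ha <;> rcases hbc i with hb | hb
  · exact absurd (ha.trans hb.symm) hi
  · exact ⟨1, Or.inl rfl, fun x hx => by rw [key x hx, ha, hb]; ring⟩
  · exact ⟨-1, Or.inr rfl, fun x hx => by rw [key x hx, ha, hb]; ring⟩
  · exact absurd (ha.trans hb.symm) hi

/-- If the `i`-coordinate in `C` of a point of `C ∩ D` is interior, there is an edge of `C ∩ D` in
this direction. -/
lemma exists_edgeIn (hC : C ∈ S.cubes) (hD : D ∈ S.cubes) {x : X} (hx : x ∈ C) (hx' : x ∈ D) {i}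
    (h0 : coord C x i ≠ 0) (h1 : coord C x i ≠ 1) :
    ∃ a b, S.EdgeIn a b C ∧ a ∈ D ∧ b ∈ D ∧ (∀ y ∈ C, hgt a b y = coord C y i - 1 / 2) := by
  obtain ⟨σ, hσ⟩ := S.exists_inter_eq_faceOf hC hD ⟨x, hx, hx'⟩
  have hxσ : x ∈ faceOf C σ := hσ ▸ ⟨hx, hx'⟩
  have hσi : σ i = none := by
    by_contra hcon
    obtain ⟨b, hb⟩ := Option.ne_none_iff_exists'.1 hcon
    have := hxσ.2 i b hb
    cases b <;> simp_all
  obtain ⟨a, ha, hac⟩ := S.exists_coord_eq hC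
    (fun k => match σ k with | none => 0 | some b => if b then 1 else 0) (fun k => by
      cases σ k with
      | none => simp
      | some b => cases b <;> simp)
  have hav : ∀ k, coord C a k = 0 ∨ coord C a k = 1 := fun k => by
    rw [hac]
    cases σ k with
    | none => simp
    | some b => cases b <;> simp
  have hv1 : (1 : ℝ) ∈ Icc (0 : ℝ) 1 := by simp
  have hai : coord C a i = 0 := by rw [hac, hσi]
  have haσ : a ∈ faceOf C σ := ⟨ha, fun k b hk => by rw [hac, hk]⟩
  have hbC := S.move_mem hC ha i hv1
  have hbσ : move C a i 1 ∈ faceOf C σ := ⟨hbC, fun k b hk => by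
    have hki : k ≠ i := by rintro rfl; simp [hσi] at hk
    rw [S.coord_move_of_ne hC ha hv1 hki]; exact haσ.2 k b hk⟩
  rw [← hσ] at haσ hbσ
  refine ⟨a, move C a i 1, ⟨S.isVertex_of_coord hC ha hav, S.isVertex_of_coord hC hbC fun k => ?_,
    ?_, ha, hbC⟩, haσ.2, hbσ.2, fun y hy => ?_⟩
  · rw [(S.move_spec hC ha i hv1).2]
    split_ifs
    · right; rfl
    · exact hav k
  · rw [S.dist_move hC ha i hv1, hai]; norm_num
  · rw [hgt, S.dist_sq_coord hC hy ha, S.dist_sq_coord hC hy hbC, ← Finset.sum_sub_distrib,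
      Finset.sum_eq_single i]
    · rw [hai, S.coord_move_self hC ha i hv1]; ring
    · intro k _ hk; rw [S.coord_move_of_ne hC ha hv1 hk]; ring
    · simp

/-! #### The smallest cube containing a point -/

/-- In any cube around `q`, freeze the coordinates of `q` that are `0` or `1`; a face that contains
`q` can freeze no others. -/
lemma exists_hull (q : X) : ∃ C ∈ S.cubes, q ∈ C ∧ ∀ D ∈ S.cubes, q ∈ D → C ⊆ D := by
  classical
  obtain ⟨D₀, hD₀, hq⟩ := S.cover q
  set σ : Fin (cubeDim D₀) → Option Bool := fun i =>
    if coord D₀ q i = 0 then some false else if coord D₀ q i = 1 then some true else none with hσ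
  refine ⟨faceOf D₀ σ, S.faceOf_mem hD₀ σ, ⟨hq, fun i b h => ?_⟩, fun D hD hqD => ?_⟩
  · simp only [hσ] at h
    split_ifs at h with h1 h2
    · simp only [Option.some.injEq] at h; subst h; simpa using h1
    · simp only [Option.some.injEq] at h; subst h; simpa using h2
  · obtain ⟨τ, hτ⟩ := S.exists_inter_eq_faceOf hD₀ hD ⟨q, hq, hqD⟩
    have hqτ : q ∈ faceOf D₀ τ := hτ ▸ ⟨hq, hqD⟩
    intro y hy
    suffices y ∈ faceOf D₀ τ by rw [← hτ] at this; exact this.2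
    refine ⟨hy.1, fun i b hb => ?_⟩
    have h1 := hqτ.2 i b hb
    refine hy.2 i b ?_
    cases b <;> simp [hσ, h1]

/-- The smallest cube that contains `q`. -/
noncomputable def hull (q : X) : Set X := (S.exists_hull q).choose

lemma hull_mem (q : X) : S.hull q ∈ S.cubes := (S.exists_hull q).choose_spec.1

lemma mem_hull (q : X) : q ∈ S.hull q := (S.exists_hull q).choose_spec.2.1

lemma hull_subset {q : X} (hD : D ∈ S.cubes) (h : q ∈ D) : S.hull q ⊆ D :=
  (S.exists_hull q).choose_spec.2.2 D hD h

/-! #### Germs of midcubes -/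

/-- For `k ≠ i`, moving the `k`-coordinate of `x` off `1/2` stays in `C ∩ D` and in `mid C i` but
leaves `mid C k`. So a germ determines the index of its midcube. -/
lemma mid_index_unique (hC : C ∈ S.cubes) (hD : D ∈ S.cubes) {x : X} (hx : x ∈ D) {i k}
    (hi : x ∈ mid C i) (h : ∀ y ∈ C ∩ D, y ∈ mid C i → y ∈ mid C k) : i = k := by
  by_contra hne
  have hk := h x ⟨hi.1, hx⟩ hi
  have hv : (1 / 4 : ℝ) ∈ Icc (0 : ℝ) 1 := by norm_num
  have hy := S.move_mem_of_mem hC hD hi.1 hx (i := k) (by rw [hk.2]; norm_num)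
    (by rw [hk.2]; norm_num) hv
  have hy' := S.move_mem hC hi.1 k hv
  have h1 := h _ ⟨hy', hy⟩ ⟨hy', by rw [S.coord_move_of_ne hC hi.1 hv hne]; exact hi.2⟩
  have h2 := h1.2
  rw [S.coord_move_self hC hi.1 k hv] at h2
  norm_num at h2

/-- The edge with endpoints `a`, `b` of the smallest cube around `q` is dual to the midcube `M`
that contains `q`. -/
structure EdgeAt (q : X) (M : Set X) (a b : X) : Prop where
  edge : S.EdgeIn a b (S.hull q)
  mem_iff : ∀ y ∈ S.hull q, y ∈ M ↔ hgt a b y = 0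

lemma EdgeAt.edgeIn {S : CubeComplex X} {q a b : X} {M : Set X} (h : S.EdgeAt q M a b)
    (hD : D ∈ S.cubes) (hq : q ∈ D) : S.EdgeIn a b D :=
  h.edge.mono (S.hull_subset hD hq h.edge.left_mem) (S.hull_subset hD hq h.edge.right_mem)

lemma exists_edgeAt {M : Set X} (hM : M ∈ S.midcubes) {q : X} (hq : q ∈ M) :
    ∃ a b, S.EdgeAt q M a b := by
  obtain ⟨C, hC, i, rfl⟩ := S.exists_eq_mid hM
  obtain ⟨a, b, hab, ha, hb, h⟩ := S.exists_edgeIn hC (S.hull_mem q) hq.1 (S.mem_hull q) (i := i)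
    (by rw [hq.2]; norm_num) (by rw [hq.2]; norm_num)
  refine ⟨a, b, hab.mono ha hb, fun y hy => ?_⟩
  have hyC := S.hull_subset hC hq.1 hy
  rw [h y hyC, sub_eq_zero]
  exact ⟨fun h => h.2, fun h => ⟨hyC, h⟩⟩

/-- A midcube that contains `q` extends to every cube that contains `q`. -/
lemma EdgeAt.exists_mid {S : CubeComplex X} {M : Set X} {q a b : X} (h : S.EdgeAt q M a b)
    (hD : D ∈ S.cubes) (hq : q ∈ D) :
    ∃ i, (∀ y ∈ D, |hgt a b y| = |coord D y i - 1 / 2|) ∧ (∀ y ∈ D, y ∈ mid D i ↔ hgt a b y = 0) ∧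
      M ∩ S.hull q = mid D i ∩ S.hull q := by
  obtain ⟨i, -, s, hs, hi⟩ := (h.edgeIn hD hq).exists_coord hD
  have hiff : ∀ y ∈ D, y ∈ mid D i ↔ hgt a b y = 0 := fun y hy => by
    rw [hi y hy]
    constructor
    · intro h; rw [h.2]; ring
    · intro h
      refine ⟨hy, ?_⟩
      rcases hs with rfl | rfl <;> linarith
  refine ⟨i, fun y hy => ?_, hiff, ?_⟩
  · rw [hi y hy, abs_mul]
    rcases hs with rfl | rfl <;> simp
  · ext y
    simp only [mem_inter_iff, and_congr_left_iff]
    intro hy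
    rw [h.mem_iff y hy, hiff y (S.hull_subset hD hq hy)]

/-- If two midcubes have the same germ at one common point, they agree on the intersection of their
cubes. -/
lemma mid_agree (hC : C ∈ S.cubes) (hD : D ∈ S.cubes) {i k} {x : X} (hi : x ∈ mid C i)
    (hk : x ∈ mid D k) (h : mid C i ∩ S.hull x = mid D k ∩ S.hull x) {y : X} (hy : y ∈ C)
    (hy' : y ∈ D) : y ∈ mid C i ↔ y ∈ mid D k := by
  obtain ⟨a, b, hab⟩ := S.exists_edgeAt (S.mid_mem hC i) hi
  obtain ⟨i', -, hi', hi''⟩ := hab.exists_mid hC hi.1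
  obtain ⟨k', -, hk', hk''⟩ := hab.exists_mid hD hk.1
  obtain rfl : i = i' := S.mid_index_unique hC (S.hull_mem x) (S.mem_hull x) hi fun y hy hyi =>
    (hi''.subset ⟨hyi, hy.2⟩).1
  rw [h] at hk''
  obtain rfl : k = k' := S.mid_index_unique hD (S.hull_mem x) (S.mem_hull x) hk fun y hy hyi =>
    (hk''.subset ⟨hyi, hy.2⟩).1
  rw [hi' y hy, hk' y hy']

/-- Equality of germs of midcubes does not depend on the common point. -/
lemma germ_eq_of_germ_eq {M N : Set X} (hM : M ∈ S.midcubes) (hN : N ∈ S.midcubes) {x y : X}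
    (hxM : x ∈ M) (hxN : x ∈ N) (hyM : y ∈ M) (hyN : y ∈ N)
    (h : M ∩ S.hull x = N ∩ S.hull x) : M ∩ S.hull y = N ∩ S.hull y := by
  obtain ⟨C, hC, i, rfl⟩ := S.exists_eq_mid hM
  obtain ⟨D, hD, k, rfl⟩ := S.exists_eq_mid hN
  ext z
  simp only [mem_inter_iff, and_congr_left_iff]
  intro hz
  exact S.mid_agree hC hD hxM hxN h (S.hull_subset hC hyM.1 hz) (S.hull_subset hD hyN.1 hz)

/-- The unsigned height functions of a midcube at two of its points agree on cubes that contain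
both points. -/
lemma EdgeAt.abs_hgt_eq {S : CubeComplex X} {M : Set X} (hM : M ∈ S.midcubes) {q q' a b a' b' : X}
    (hq : q ∈ M) (hq' : q' ∈ M) (h : S.EdgeAt q M a b) (h' : S.EdgeAt q' M a' b')
    (hD : D ∈ S.cubes) (hqD : q ∈ D) (hqD' : q' ∈ D) {z : X} (hz : z ∈ D) :
    |hgt a b z| = |hgt a' b' z| := by
  obtain ⟨k, hk, hk', hk''⟩ := h.exists_mid hD hqD
  obtain ⟨l, hl, hl', hl''⟩ := h'.exists_mid hD hqD'
  obtain ⟨C, hC, i, rfl⟩ := S.exists_eq_mid hM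
  have hqk : q ∈ mid D k := (hk''.subset ⟨hq, S.mem_hull q⟩).1
  have hql : q' ∈ mid D l := (hl''.subset ⟨hq', S.mem_hull q'⟩).1
  -- Both `mid D k` and `mid D l` agree with `M` on `C ∩ D`, so their indices coincide.
  obtain rfl : k = l := S.mid_index_unique hD hC hq.1 hqk fun y hy hyk =>
    (S.mid_agree hC hD hq' hql hl'' hy.2 hy.1).1 ((S.mid_agree hC hD hq hqk hk'' hy.2 hy.1).2 hyk)
  rw [hk z hz, hl z hz]

end CubeComplex

end Coordinates

/-! ### Geodesics in CAT(0) spaces -/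

section Geodesics

variable {X : Type u} [MetricSpace X]

/-- Existence of Euclidean comparison triangles. -/
lemma exists_comparison_triangle (x y z : X) : ∃ x' y' z' : EuclideanSpace ℝ (Fin 2),
    dist x' y' = dist x y ∧ dist y' z' = dist y z ∧ dist x' z' = dist x z := by
  set c := dist x y with hc
  set a := dist y z with ha
  set b := dist x z with hb
  have hc0 : 0 ≤ c := dist_nonneg
  have ha0 : 0 ≤ a := dist_nonneg
  have hb0 : 0 ≤ b := dist_nonneg
  have h1 : c ≤ b + a := by rw [hc, hb, ha, dist_comm y z]; exact dist_triangle _ _ _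
  have h2 : b ≤ c + a := dist_triangle _ _ _
  have h3 : a ≤ c + b := by rw [ha, hc, hb, dist_comm x y]; exact dist_triangle _ _ _
  have dist2 : ∀ s t : EuclideanSpace ℝ (Fin 2), ∀ r : ℝ, 0 ≤ r →
      (s 0 - t 0) ^ 2 + (s 1 - t 1) ^ 2 = r ^ 2 → dist s t = r := by
    intro s t r hr h
    rw [← abs_of_nonneg hr, ← abs_of_nonneg (dist_nonneg (x := s)), ← sq_eq_sq_iff_abs_eq_abs,
      euclidean_dist_sq, Fin.sum_univ_two, h]
  rcases hc0.eq_or_lt with h0 | h0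
  · refine ⟨!₂[0, 0], !₂[0, 0], !₂[b, 0], dist2 _ _ _ hc0 ?_, dist2 _ _ _ ha0 ?_,
      dist2 _ _ _ hb0 ?_⟩
    · simp [← h0]
    · have : a = b := by linarith
      simp [this]
    · simp
  -- Law of cosines: with `x'` at the origin and `y'` on the first axis, `p` is the first coordinate
  -- of `z'`.
  · set p := (c ^ 2 + b ^ 2 - a ^ 2) / (2 * c) with hp
    have hpc : p * (2 * c) = c ^ 2 + b ^ 2 - a ^ 2 := div_mul_cancel₀ _ (by positivity)
    have hpb : p ^ 2 ≤ b ^ 2 := by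
      rw [sq_le_sq, abs_of_nonneg hb0, abs_le]
      constructor
      · rw [hp, le_div_iff₀ (by positivity)]
        nlinarith
      · rw [hp, div_le_iff₀ (by positivity)]
        nlinarith
    refine ⟨!₂[0, 0], !₂[c, 0], !₂[p, √(b ^ 2 - p ^ 2)], dist2 _ _ _ hc0 ?_, dist2 _ _ _ ha0 ?_,
      dist2 _ _ _ hb0 ?_⟩
    · simp
    · have := Real.sq_sqrt (sub_nonneg.2 hpb)
      simp [this]
      nlinarith
    · have := Real.sq_sqrt (sub_nonneg.2 hpb)
      simp [this]

/-- `p` divides a geodesic segment from `x` to `y` in the ratio `t : 1 - t`. -/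
def IsGeoPoint (x y : X) (t : ℝ) (p : X) : Prop :=
  dist x p = t * dist x y ∧ dist p y = (1 - t) * dist x y

/-- The point that divides the geodesic segment from `x` to `y` in the ratio `t : 1 - t`. -/
noncomputable def geo (x y : X) (t : ℝ) : X := @Classical.epsilon X ⟨x⟩ (IsGeoPoint x y t)

/-- Geodesic convexity. -/
def GeoConvex (A : Set X) : Prop := ∀ x ∈ A, ∀ y ∈ A, ∀ t ∈ Icc (0 : ℝ) 1, geo x y t ∈ A

namespace IsCAT0

variable (hX : IsCAT0 X)
include hX

lemma isGeoPoint_geo (x y : X) {t : ℝ} (ht : t ∈ Icc (0 : ℝ) 1) :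
    IsGeoPoint x y t (geo x y t) := by
  obtain ⟨γ, h0, h1, h⟩ := hX.geodesic x y
  have hd : (0 : ℝ) ≤ dist x y := dist_nonneg
  have htd : t * dist x y ∈ Icc 0 (dist x y) := ⟨mul_nonneg ht.1 hd, mul_le_of_le_one_left hd ht.2⟩
  refine @Classical.epsilon_spec X (IsGeoPoint x y t) ⟨γ (t * dist x y), ?_, ?_⟩
  · have := h 0 (by simp) _ htd
    rw [h0] at this
    rw [this, zero_sub, abs_neg, abs_of_nonneg htd.1]
  · have := h _ htd (dist x y) (by simp)
    rw [h1] at this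
    rw [this, abs_sub_comm, abs_of_nonneg (by linarith [htd.2])]
    ring

/-- The basic comparison inequality for two geodesic segments that issue from the same point. -/
lemma dist_isGeoPoint_le {x y z p q : X} {t : ℝ} (ht : t ∈ Icc (0 : ℝ) 1) (hp : IsGeoPoint x y t p)
    (hq : IsGeoPoint x z t q) : dist p q ≤ t * dist y z := by
  obtain ⟨x', y', z', hxy, hyz, hxz⟩ := exists_comparison_triangle x y z
  have ht' : 0 ≤ 1 - t := by linarith [ht.2]
  have key := hX.comparison x y z p q (by rw [OnSegment, hp.1, hp.2]; ring)
    (by rw [OnSegment, hq.1, hq.2]; ring) x' y' z' (AffineMap.lineMap x' y' t)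
    (AffineMap.lineMap x' z' t) hxy hyz hxz
    (by rw [dist_left_lineMap, hxy, hp.1, Real.norm_of_nonneg ht.1])
    (by rw [dist_lineMap_right, hxy, hp.2, Real.norm_of_nonneg ht'])
    (by rw [dist_left_lineMap, hxz, hq.1, Real.norm_of_nonneg ht.1])
    (by rw [dist_lineMap_right, hxz, hq.2, Real.norm_of_nonneg ht'])
  refine key.trans_eq ?_
  rw [← hyz, dist_eq_norm, dist_eq_norm, AffineMap.lineMap_apply, AffineMap.lineMap_apply]
  have : (t • (y' -ᵥ x') +ᵥ x') - (t • (z' -ᵥ x') +ᵥ x') = t • (y' - z') := by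
    simp only [vsub_eq_sub, vadd_eq_add, smul_sub]; abel
  rw [this, norm_smul, Real.norm_of_nonneg ht.1]

lemma geo_unique {x y p : X} {t : ℝ} (ht : t ∈ Icc (0 : ℝ) 1) (hp : IsGeoPoint x y t p) :
    geo x y t = p := by
  have := hX.dist_isGeoPoint_le ht (hX.isGeoPoint_geo x y ht) hp
  rw [dist_self, mul_zero] at this
  exact dist_le_zero.1 this

lemma dist_left_geo (x y : X) {t : ℝ} (ht : t ∈ Icc (0 : ℝ) 1) :
    dist x (geo x y t) = t * dist x y := (hX.isGeoPoint_geo x y ht).1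

lemma dist_geo_right (x y : X) {t : ℝ} (ht : t ∈ Icc (0 : ℝ) 1) :
    dist (geo x y t) y = (1 - t) * dist x y := (hX.isGeoPoint_geo x y ht).2

lemma geo_zero (x y : X) : geo x y 0 = x := hX.geo_unique (by simp) (by simp [IsGeoPoint])

lemma geo_one (x y : X) : geo x y 1 = y := hX.geo_unique (by simp) (by simp [IsGeoPoint])

lemma geo_self (x : X) {t : ℝ} (ht : t ∈ Icc (0 : ℝ) 1) : geo x x t = x :=
  hX.geo_unique ht (by simp [IsGeoPoint])

lemma geo_symm (x y : X) {t : ℝ} (ht : t ∈ Icc (0 : ℝ) 1) : geo x y t = geo y x (1 - t) := by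
  have ht' : 1 - t ∈ Icc (0 : ℝ) 1 := ⟨by linarith [ht.2], by linarith [ht.1]⟩
  refine hX.geo_unique ht ⟨?_, ?_⟩
  · rw [dist_comm, hX.dist_geo_right y x ht', dist_comm x y]; ring
  · rw [dist_comm, hX.dist_left_geo y x ht', dist_comm x y]

lemma geo_geo (x y : X) {s t : ℝ} (hs : s ∈ Icc (0 : ℝ) 1) (ht : t ∈ Icc (0 : ℝ) 1) :
    geo x (geo x y s) t = geo x y (t * s) := by
  have hts : t * s ∈ Icc (0 : ℝ) 1 := ⟨mul_nonneg ht.1 hs.1, mul_le_one₀ ht.2 hs.1 hs.2⟩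
  symm
  have h1 := hX.dist_left_geo x y hs
  have h2 := hX.dist_geo_right x y hs
  have h3 := hX.dist_left_geo x (geo x y s) ht
  have h4 := hX.dist_geo_right x (geo x y s) ht
  have hd : (0 : ℝ) ≤ dist x y := dist_nonneg
  refine hX.geo_unique hts ⟨by rw [h3, h1]; ring, le_antisymm ?_ ?_⟩
  · calc _ ≤ _ := dist_triangle _ (geo x y s) _
      _ = _ := by rw [h4, h2, h1]; ring
  · have := dist_triangle x (geo x (geo x y s) t) y
    rw [h3, h1] at this
    linarith

lemma dist_geo_geo (x y : X) {s t : ℝ} (hs : s ∈ Icc (0 : ℝ) 1) (ht : t ∈ Icc (0 : ℝ) 1) :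
    dist (geo x y s) (geo x y t) = |s - t| * dist x y := by
  wlog hst : s ≤ t generalizing s t
  · rw [dist_comm, abs_sub_comm]; exact this ht hs (le_of_not_ge hst)
  rw [abs_sub_comm, abs_of_nonneg (sub_nonneg.2 hst)]
  rcases ht.1.eq_or_lt with h0 | h0
  · have : s = 0 := le_antisymm (by rw [h0]; exact hst) hs.1
    simp [this, ← h0]
  have hst' : s / t ∈ Icc (0 : ℝ) 1 := ⟨div_nonneg hs.1 ht.1, div_le_one_of_le₀ hst ht.1⟩
  have h := hX.dist_geo_right x (geo x y t) hst'
  rw [hX.geo_geo x y ht hst', div_mul_cancel₀ _ h0.ne', hX.dist_left_geo x y ht] at h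
  rw [h]; field_simp

/-- The metric of a CAT(0) space is convex. -/
lemma dist_geo_le (x y x' y' : X) {t : ℝ} (ht : t ∈ Icc (0 : ℝ) 1) :
    dist (geo x y t) (geo x' y' t) ≤ (1 - t) * dist x x' + t * dist y y' := by
  have ht' : 1 - t ∈ Icc (0 : ℝ) 1 := ⟨by linarith [ht.2], by linarith [ht.1]⟩
  -- Both geodesics are compared with the diagonal from `x` to `y'`.
  have h1 := hX.dist_isGeoPoint_le ht (hX.isGeoPoint_geo x y ht) (hX.isGeoPoint_geo x y' ht)
  have h2 := hX.dist_isGeoPoint_le ht' (hX.isGeoPoint_geo y' x ht') (hX.isGeoPoint_geo y' x' ht')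
  rw [← hX.geo_symm x y' ht, ← hX.geo_symm x' y' ht] at h2
  linarith [dist_triangle (geo x y t) (geo x y' t) (geo x' y' t)]

lemma continuousOn_geo : ContinuousOn (fun p : X × X × ℝ => geo p.1 p.2.1 p.2.2)
    {p | p.2.2 ∈ Icc (0 : ℝ) 1} := by
  rintro ⟨x, y, t⟩ ht
  rw [ContinuousWithinAt, tendsto_iff_dist_tendsto_zero]
  have hlim : Filter.Tendsto (fun p : X × X × ℝ => dist p.1 x + dist p.2.1 y + |p.2.2 - t| * dist x y)
      (𝓝[{p | p.2.2 ∈ Icc (0 : ℝ) 1}] (x, y, t)) (𝓝 0) := by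
    have : Continuous fun p : X × X × ℝ =>
      dist p.1 x + dist p.2.1 y + |p.2.2 - t| * dist x y := by fun_prop
    have h := this.tendsto (x, y, t)
    simp only [dist_self, sub_self, abs_zero, zero_mul, add_zero] at h
    exact h.mono_left nhdsWithin_le_nhds
  refine squeeze_zero' (.of_forall fun _ => dist_nonneg) ?_ hlim
  filter_upwards [self_mem_nhdsWithin] with p hp
  have h1 := hX.dist_geo_le p.1 p.2.1 x y hp
  have h2 := hX.dist_geo_geo x y hp ht
  have h3 := dist_triangle (geo p.1 p.2.1 p.2.2) (geo x y p.2.2) (geo x y t)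
  have h4 : (0 : ℝ) ≤ dist p.1 x := dist_nonneg
  have h5 : (0 : ℝ) ≤ dist p.2.1 y := dist_nonneg
  obtain ⟨h6, h7⟩ := hp
  nlinarith

lemma continuousOn_geo_param (x y : X) : ContinuousOn (geo x y) (Icc (0 : ℝ) 1) :=
  hX.continuousOn_geo.comp (f := fun t => (x, y, t)) (by fun_prop) fun _ ht => ht

lemma isPreconnected_of_geoConvex {A : Set X} (hA : GeoConvex A) : IsPreconnected A := by
  refine isPreconnected_of_forall_pair fun x hx y hy => ?_
  refine ⟨geo x y '' Icc (0 : ℝ) 1, ?_, ⟨0, by simp, hX.geo_zero x y⟩, ⟨1, by simp, hX.geo_one x y⟩,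
    isPreconnected_Icc.image _ (hX.continuousOn_geo_param x y)⟩
  rintro _ ⟨t, ht, rfl⟩
  exact hA x hx y hy t ht

lemma contractibleSpace_of_geoConvex {A : Set X} (hA : GeoConvex A) (hne : A.Nonempty) :
    ContractibleSpace A := by
  obtain ⟨o, ho⟩ := hne
  rw [contractible_iff_id_nullhomotopic]
  refine ⟨⟨o, ho⟩, ⟨⟨⟨fun p => ⟨geo p.2.1 o p.1, hA _ p.2.2 _ ho _ p.1.2⟩, ?_⟩, ?_, ?_⟩⟩⟩
  · refine Continuous.subtype_mk ?_ _
    exact hX.continuousOn_geo.comp_continuous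
      (f := fun p : unitInterval × A => ((p.2 : X), o, (p.1 : ℝ))) (by fun_prop) fun p => p.1.2
  · intro a
    exact Subtype.ext (hX.geo_zero _ _)
  · intro a
    exact Subtype.ext (hX.geo_one _ _)

lemma geoConvex_ball (x : X) (r : ℝ) : GeoConvex (Metric.ball x r) := by
  intro y hy z hz t ht
  have h := hX.dist_geo_le y z x x ht
  rw [hX.geo_self x ht] at h
  rw [Metric.mem_ball] at hy hz ⊢
  have ht1 := ht.1
  have ht2 := ht.2
  rcases ht1.eq_or_lt with h0 | h0
  · rw [← h0] at h ⊢; linarith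
  · nlinarith

lemma smul_geo {G : Type*} [Group G] [MulAction G X] [IsIsometricSMul G X] (g : G) (x y : X) {t : ℝ}
    (ht : t ∈ Icc (0 : ℝ) 1) : g • geo x y t = geo (g • x) (g • y) t := by
  symm
  refine hX.geo_unique ht ⟨?_, ?_⟩
  · rw [dist_smul, dist_smul, hX.dist_left_geo x y ht]
  · rw [dist_smul, dist_smul, hX.dist_geo_right x y ht]

/-- Geodesics between points of a cube are segments. -/
lemma coord_geo [Nonempty X] (S : CubeComplex X) {C : Set X} (hC : C ∈ S.cubes) {x y : X}
    (hx : x ∈ C) (hy : y ∈ C) {t : ℝ} (ht : t ∈ Icc (0 : ℝ) 1) :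
    geo x y t ∈ C ∧ ∀ i, coord C (geo x y t) i = (1 - t) * coord C x i + t * coord C y i := by
  have hx' := (S.coord_spec hC hx).1
  have hy' := (S.coord_spec hC hy).1
  obtain ⟨z, hz, hzc⟩ := S.exists_coord_eq hC
    (fun i => (1 - t) * coord C x i + t * coord C y i) (fun i => by
      have h1 := hx' i; have h2 := hy' i
      obtain ⟨h3, h4⟩ := ht
      simp only [mem_Icc] at h1 h2 ⊢
      constructor <;> nlinarith)
  have ht' : 0 ≤ 1 - t := by linarith [ht.2]
  have hgz : geo x y t = z := by
    refine hX.geo_unique ht ⟨?_, ?_⟩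
    · rw [← abs_of_nonneg (dist_nonneg (x := x)),
        ← abs_of_nonneg (mul_nonneg ht.1 (dist_nonneg (x := x))), ← sq_eq_sq_iff_abs_eq_abs, mul_pow,
        S.dist_sq_coord hC hx hz, S.dist_sq_coord hC hx hy, Finset.mul_sum]
      exact Finset.sum_congr rfl fun i _ => by rw [hzc]; ring
    · rw [← abs_of_nonneg (dist_nonneg (x := z)),
        ← abs_of_nonneg (mul_nonneg ht' (dist_nonneg (x := x))), ← sq_eq_sq_iff_abs_eq_abs, mul_pow,
        S.dist_sq_coord hC hz hy, S.dist_sq_coord hC hx hy, Finset.mul_sum]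
      exact Finset.sum_congr rfl fun i _ => by rw [hzc]; ring
  rw [hgz]
  exact ⟨hz, hzc⟩

end IsCAT0

lemma GeoConvex.inter {A B : Set X} (hA : GeoConvex A) (hB : GeoConvex B) : GeoConvex (A ∩ B) :=
  fun x hx y hy t ht => ⟨hA x hx.1 y hy.1 t ht, hB x hx.2 y hy.2 t ht⟩

lemma GeoConvex.sInter {𝒜 : Set (Set X)} (h : ∀ A ∈ 𝒜, GeoConvex A) : GeoConvex (⋂₀ 𝒜) :=
  fun x hx y hy t ht A hA => h A hA x (hx A hA) y (hy A hA) t ht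

end Geodesics

/-! ### The local structure of a cube complex -/

section Local

variable {X : Type u} [MetricSpace X] [Nonempty X] (S : CubeComplex X)

namespace CubeComplex

/-- All cubes and midcubes that meet the ball of radius `r` about `q` contain `q`. -/
structure IsGood (q : X) (r : ℝ) : Prop where
  pos : 0 < r
  le : r ≤ 1 / 8
  cube : ∀ C ∈ S.cubes, ∀ y ∈ C, dist q y < r → q ∈ C
  midcube : ∀ M ∈ S.midcubes, ∀ y ∈ M, dist q y < r → q ∈ M

/-- No local finiteness is needed: an interior coordinate of `q` in any cube is, up to reflection,
one of the finitely many coordinates of `q` in its smallest cube; the others are `0` or `1`. -/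
lemma exists_coord_gap (q : X) : ∃ ε : ℝ, 0 < ε ∧ ε ≤ 1 / 8 ∧ ∀ D ∈ S.cubes, q ∈ D → ∀ i,
    (|coord D q i - 1 / 2| = 0 ∨ ε ≤ |coord D q i - 1 / 2|) ∧
    (|coord D q i - 1 / 2| = 1 / 2 ∨ ε ≤ 1 / 2 - |coord D q i - 1 / 2|) := by
  have hq := S.mem_hull q
  have hH := S.hull_mem q
  set v : Fin (cubeDim (S.hull q)) → ℝ := fun k => |coord (S.hull q) q k - 1 / 2|
  have hv : ∀ k, v k ≤ 1 / 2 := fun k => by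
    have h1 := S.coord_nonneg hH hq k
    have h2 := S.coord_le_one hH hq k
    exact abs_le.2 ⟨by linarith, by linarith⟩
  have hex : ∀ᶠ ε in 𝓝[>] (0 : ℝ), ∀ k, (v k = 0 ∨ ε ≤ v k) ∧ (v k = 1 / 2 ∨ ε ≤ 1 / 2 - v k) := by
    rw [Filter.eventually_all]
    intro k
    refine Filter.Eventually.and ?_ ?_
    · rcases (abs_nonneg (coord (S.hull q) q k - 1 / 2)).eq_or_lt with h | h
      · exact .of_forall fun _ => Or.inl h.symm
      · filter_upwards [Ioo_mem_nhdsGT h] with ε hε using Or.inr hε.2.le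
    · rcases (hv k).eq_or_lt with h | h
      · exact .of_forall fun _ => Or.inl h
      · filter_upwards [Ioo_mem_nhdsGT (sub_pos.2 h)] with ε hε using Or.inr hε.2.le
  obtain ⟨ε, hε, hε'⟩ := (hex.and (Ioo_mem_nhdsGT (show (0 : ℝ) < 1 / 8 by norm_num))).exists
  refine ⟨ε, hε'.1, hε'.2.le, fun D hD hqD i => ?_⟩
  by_cases h0 : coord D q i = 0
  · rw [h0]; norm_num; linarith [hε'.2]
  by_cases h1 : coord D q i = 1
  · rw [h1]; norm_num; linarith [hε'.2]
  obtain ⟨a, b, hab, ha, hb, h⟩ := S.exists_edgeIn hD hH hqD hq h0 h1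
  obtain ⟨k, -, s, hs, hk⟩ := (hab.mono ha hb).exists_coord hH
  have : |coord D q i - 1 / 2| = v k := by
    rw [← h q hqD, hk q hq, abs_mul]
    rcases hs with rfl | rfl <;> simp [v]
  rw [this]
  exact hε k

/-- The metric is intrinsic, so a point near `q` is reached by a string shorter than the gap. By
induction along the string, every cube through one of its points contains `q`: a face that froze a
coordinate at a value other than that of `q` would be too far away. -/
lemma exists_isGood (q : X) : ∃ r, S.IsGood q r := by
  obtain ⟨ε, hε, hε', hgap⟩ := S.exists_coord_gap q
  have hcube : ∀ C ∈ S.cubes, ∀ y ∈ C, dist q y < ε → q ∈ C := by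
    intro C hC y hy hd
    obtain ⟨L, ⟨n, p, h0, hn, hp, rfl⟩, -, hL⟩ := (S.dist_eq q y).exists_between hd
    have key : ∀ i ≤ n, ∀ C ∈ S.cubes, p i ∈ C → q ∈ C := by
      intro i
      induction i with
      | zero => intro _ C _ h; rwa [h0] at h
      | succ i ih =>
        intro hi C hC hpC
        obtain ⟨D, hD, hpD, hpD'⟩ := hp i hi
        have hqD := ih (Nat.le_of_succ_le hi) D hD hpD
        have hdist : dist q (p (i + 1)) < ε := by
          rw [← h0]
          refine (dist_le_range_sum_dist p (i + 1)).trans_lt (lt_of_le_of_lt ?_ hL)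
          exact Finset.sum_le_sum_of_subset_of_nonneg (Finset.range_mono hi) fun _ _ _ => dist_nonneg
        obtain ⟨σ, hσ⟩ := S.exists_inter_eq_faceOf hD hC ⟨_, hpD', hpC⟩
        have hpσ : p (i + 1) ∈ faceOf D σ := hσ ▸ ⟨hpD', hpC⟩
        suffices q ∈ faceOf D σ by rw [← hσ] at this; exact this.2
        refine ⟨hqD, fun k b hk => ?_⟩
        have h1 := hpσ.2 k b hk
        have h2 := (S.abs_coord_sub_le hD hqD hpD' k).trans_lt hdist
        have h3 := (hgap D hD hqD k).2
        have h4 := S.coord_nonneg hD hqD k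
        have h5 := S.coord_le_one hD hqD k
        rw [h1] at h2
        have h6 := abs_lt.1 h2
        cases b with
        | false =>
          simp only [Bool.false_eq_true, if_false, sub_zero] at h6 ⊢
          rw [abs_of_nonpos (by linarith)] at h3
          rcases h3 with h3 | h3 <;> linarith
        | true =>
          simp only [if_true] at h6 ⊢
          rw [abs_of_nonneg (by linarith)] at h3
          rcases h3 with h3 | h3 <;> linarith
    exact key n le_rfl C hC (hn ▸ hy)
  refine ⟨ε, hε, hε', hcube, fun M hM y hy hd => ?_⟩
  obtain ⟨C, hC, i, rfl⟩ := S.exists_eq_mid hM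
  have hqC := hcube C hC y hy.1 hd
  refine ⟨hqC, ?_⟩
  have h2 := (S.abs_coord_sub_le hC hqC hy.1 i).trans_lt hd
  rw [hy.2] at h2
  rcases (hgap C hC hqC i).1 with h | h
  · linarith [abs_eq_zero.1 h]
  · linarith

/-! #### Displacements in the direction of an edge -/

variable {S} {C D : Set X} {a b : X}

lemma EdgeIn.exists_fibre (h : S.EdgeIn a b D) (hD : D ∈ S.cubes) {x : X} (hx : x ∈ D) {v : ℝ}
    (hv : |v| ≤ 1 / 2) : ∃ y ∈ D, hgt a b y = v ∧ dist x y = |hgt a b x - v| := by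
  obtain ⟨i, -, s, hs, hi⟩ := h.exists_coord hD
  have hv' := abs_le.1 hv
  have hsv : s * v + 1 / 2 ∈ Icc (0 : ℝ) 1 := by
    rcases hs with rfl | rfl <;> constructor <;> linarith
  refine ⟨move D x i (s * v + 1 / 2), S.move_mem hD hx i hsv, ?_, ?_⟩
  · rw [hi _ (S.move_mem hD hx i hsv), S.coord_move_self hD hx i hsv]
    rcases hs with rfl | rfl <;> ring
  · rw [S.dist_move hD hx i hsv, hi x hx]
    rcases hs with rfl | rfl
    · congr 1; ring
    · rw [abs_sub_comm]; congr 1; ring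

/-- The equation `hd` is a chart-free way to say that `x` and `y` differ only in the direction of
the edge: one coordinate accounts for the whole distance. It can thus be compared between cubes. -/
lemma EdgeIn.fibre_coord (hD : D ∈ S.cubes) {i} {s : ℝ} (hs : s = 1 ∨ s = -1)
    (hi : ∀ x ∈ D, hgt a b x = s * (coord D x i - 1 / 2)) {x y : X} (hx : x ∈ D) (hy : y ∈ D)
    (hd : dist x y = |hgt a b x - hgt a b y|) {k} (hk : k ≠ i) : coord D x k = coord D y k := by
  classical
  have h1 : dist x y ^ 2 = (coord D x i - coord D y i) ^ 2 := by
    rw [hd, sq_abs, hi x hx, hi y hy]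
    rcases hs with rfl | rfl <;> ring
  rw [S.dist_sq_coord hD hx hy, ← Finset.add_sum_erase _ _ (Finset.mem_univ i), add_eq_left,
    Finset.sum_eq_zero_iff_of_nonneg fun _ _ => sq_nonneg _] at h1
  have := h1 k (by simp [hk])
  linarith [pow_eq_zero_iff (two_ne_zero) |>.1 this]

/-- The face `C ∩ D` contains `a` and `b`, which have heights `-1/2` and `1/2`, so it does not
freeze the direction of the edge. -/
lemma EdgeIn.fibre_mem (h : S.EdgeIn a b D) (h' : S.EdgeIn a b C) (hD : D ∈ S.cubes)
    (hC : C ∈ S.cubes) {x y : X} (hx : x ∈ D) (hy : y ∈ D) (hx' : x ∈ C)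
    (hd : dist x y = |hgt a b x - hgt a b y|) : y ∈ C := by
  obtain ⟨i, -, s, hs, hi⟩ := h.exists_coord hD
  obtain ⟨σ, hσ⟩ := S.exists_inter_eq_faceOf hD hC ⟨x, hx, hx'⟩
  have mem : ∀ z ∈ D, z ∈ C → z ∈ faceOf D σ := fun z hz hz' => hσ ▸ ⟨hz, hz'⟩
  suffices y ∈ faceOf D σ by rw [← hσ] at this; exact this.2
  refine ⟨hy, fun k c hk => ?_⟩
  have hki : k ≠ i := by
    rintro rfl
    have h1 := (mem a h.left_mem h'.left_mem).2 k c hk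
    have h2 := (mem b h.right_mem h'.right_mem).2 k c hk
    have h3 := hi a h.left_mem
    have h4 := hi b h.right_mem
    have h5 : hgt a b a = -1 / 2 := by rw [hgt, h.dist_eq, dist_self]; norm_num
    have h6 : hgt a b b = 1 / 2 := by rw [hgt, dist_comm, h.dist_eq, dist_self]; norm_num
    rw [h1] at h3; rw [h2] at h4
    linarith
  rw [← fibre_coord hD hs hi hx hy hd hki]
  exact (mem x hx hx').2 k c hk

lemma EdgeIn.fibre_dist (h : S.EdgeIn a b D) (hD : D ∈ S.cubes) {x y x' y' : X} (hx : x ∈ D)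
    (hy : y ∈ D) (hx' : x' ∈ D) (hy' : y' ∈ D) (hdx : dist x x' = |hgt a b x - hgt a b x'|)
    (hdy : dist y y' = |hgt a b y - hgt a b y'|)
    (hxy : (hgt a b x' - hgt a b y') ^ 2 = (hgt a b x - hgt a b y) ^ 2) :
    dist x' y' = dist x y := by
  obtain ⟨i, -, s, hs, hi⟩ := h.exists_coord hD
  rw [← abs_of_nonneg (dist_nonneg (x := x)), ← abs_of_nonneg (dist_nonneg (x := x')),
    ← sq_eq_sq_iff_abs_eq_abs, S.dist_sq_coord hD hx' hy', S.dist_sq_coord hD hx hy]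
  refine Finset.sum_congr rfl fun k _ => ?_
  by_cases hk : k = i
  · subst hk
    rw [hi x hx, hi y hy, hi x' hx', hi y' hy'] at hxy
    rcases hs with rfl | rfl <;> nlinarith
  · rw [fibre_coord hD hs hi hx hx' hdx hk, fibre_coord hD hs hi hy hy' hdy hk]

lemma EdgeIn.abs_hgt_sub_le (h : S.EdgeIn a b D) (hD : D ∈ S.cubes) {x y : X} (hx : x ∈ D)
    (hy : y ∈ D) : |hgt a b x - hgt a b y| ≤ dist x y := by
  obtain ⟨i, -, s, hs, hi⟩ := h.exists_coord hD
  refine le_trans (le_of_eq ?_) (S.abs_coord_sub_le hD hx hy i)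
  rw [hi x hx, hi y hy]
  rcases hs with rfl | rfl
  · congr 1; ring
  · rw [abs_sub_comm]; congr 1; ring

/-! #### Local reflections -/

variable (S) in
/-- `x'` is the mirror image of `x` at level `c` with respect to the edge `a`, `b` near `q`. -/
def IsRefl (q a b : X) (c : ℝ) (x x' : X) : Prop :=
  ∃ D ∈ S.cubes, q ∈ D ∧ x ∈ D ∧ x' ∈ D ∧ dist x x' = |hgt a b x - hgt a b x'| ∧
    hgt a b x' = 2 * c - hgt a b x

variable {q : X} {M : Set X} {r c : ℝ}

lemma EdgeAt.refl_unique (h : S.EdgeAt q M a b) {x x' x'' : X} (h' : S.IsRefl q a b c x x')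
    (h'' : S.IsRefl q a b c x x'') : x' = x'' := by
  obtain ⟨D, hD, hq, hx, hx', hd, hc⟩ := h'
  obtain ⟨C, hC, hq', hy, hy', hd', hc'⟩ := h''
  have hyD := (h.edgeIn hC hq').fibre_mem (h.edgeIn hD hq) hC hD hy hy' hx hd'
  have := (h.edgeIn hD hq).fibre_dist hD hx hx hx' hyD hd hd' (by rw [hc, hc']; ring)
  rw [dist_self] at this
  exact dist_eq_zero.1 this

lemma EdgeAt.hgt_self (h : S.EdgeAt q M a b) (hq : q ∈ M) : hgt a b q = 0 :=
  (h.mem_iff q (S.mem_hull q)).1 hq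

lemma EdgeAt.abs_hgt_le (h : S.EdgeAt q M a b) (hq : q ∈ M) (hr : S.IsGood q r) {x : X}
    (hx : dist q x < r) : |hgt a b x| ≤ dist q x := by
  obtain ⟨D, hD, hxD⟩ := S.cover x
  have hqD := hr.cube D hD x hxD hx
  have := (h.edgeIn hD hqD).abs_hgt_sub_le hD hqD hxD
  rwa [h.hgt_self hq, zero_sub, abs_neg] at this

lemma EdgeAt.exists_refl (h : S.EdgeAt q M a b) (hq : q ∈ M) (hr : S.IsGood q r) (hc : |c| ≤ r)
    {x : X} (hx : dist q x < r) : ∃ x', S.IsRefl q a b c x x' := by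
  obtain ⟨D, hD, hxD⟩ := S.cover x
  have hqD := hr.cube D hD x hxD hx
  have h1 := abs_le.1 ((h.abs_hgt_le hq hr hx).trans hx.le)
  have h2 := abs_le.1 hc
  have h3 := hr.le
  obtain ⟨y, hy, hyv, hyd⟩ := (h.edgeIn hD hqD).exists_fibre hD hxD (v := 2 * c - hgt a b x)
    (abs_le.2 ⟨by linarith, by linarith⟩)
  exact ⟨y, D, hD, hqD, hxD, hy, by rw [hyv]; exact hyd, hyv⟩

/-- Inside a cube that contains the edge, reflection is isometric, so it carries a string from `x`
to `y` to a string of the same length. A nearly shortest string stays in the good ball, where all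
cubes contain the edge. -/
lemma EdgeAt.dist_refl_le (h : S.EdgeAt q M a b) (hq : q ∈ M) (hr : S.IsGood q r) (hc : |c| ≤ r)
    {x y x' y' : X} (hx : dist q x < r / 4) (hy : dist q y < r / 4) (hx' : S.IsRefl q a b c x x')
    (hy' : S.IsRefl q a b c y y') : dist x' y' ≤ dist x y := by
  have hr0 := hr.pos
  refine le_of_forall_pos_lt_add fun η hη => ?_
  obtain ⟨L, ⟨n, p, h0, hn, hp, rfl⟩, -, hL⟩ := (S.dist_eq x y).exists_between
    (lt_add_of_pos_right (dist x y) (lt_min hη (show 0 < r / 4 by linarith)))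
  -- The string has length less than `r/2 + r/4` and starts within `r/4` of `q`.
  have hpr : ∀ i ≤ n, dist q (p i) < r := by
    intro i hi
    have h1 : dist x (p i) < dist x y + min η (r / 4) := by
      rw [← h0]
      refine (dist_le_range_sum_dist p i).trans_lt (lt_of_le_of_lt ?_ (h0 ▸ hL))
      exact Finset.sum_le_sum_of_subset_of_nonneg (Finset.range_mono hi) fun _ _ _ => dist_nonneg
    have h2 := dist_triangle q x (p i)
    have h3 := dist_triangle_left x y q
    linarith [min_le_right η (r / 4)]
  have hex : ∀ i, ∃ z, i ≤ n → S.IsRefl q a b c (p i) z := fun i => by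
    by_cases hi : i ≤ n
    · obtain ⟨z, hz⟩ := h.exists_refl hq hr hc (hpr i hi)
      exact ⟨z, fun _ => hz⟩
    · exact ⟨x, fun h => absurd h hi⟩
  choose p' hp' using hex
  have hstep : ∀ i < n, dist (p' i) (p' (i + 1)) = dist (p i) (p (i + 1)) := by
    intro i hi
    obtain ⟨C, hC, hiC, hiC'⟩ := hp i hi
    have hqC := hr.cube C hC _ hiC (hpr i hi.le)
    have hE := h.edgeIn hC hqC
    obtain ⟨D, hD, hqD, hxD, hxD', hd, hcD⟩ := hp' i hi.le
    obtain ⟨D', hD', hqD', hyD, hyD', hd', hcD'⟩ := hp' (i + 1) hi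
    have h1 := (h.edgeIn hD hqD).fibre_mem hE hD hC hxD hxD' hiC hd
    have h2 := (h.edgeIn hD' hqD').fibre_mem hE hD' hC hyD hyD' hiC' hd'
    exact hE.fibre_dist hC hiC hiC' h1 h2 hd hd' (by rw [hcD, hcD']; ring)
  have e0 : p' 0 = x' := h.refl_unique (hp' 0 (Nat.zero_le _)) (h0 ▸ hx')
  have en : p' n = y' := h.refl_unique (hp' n le_rfl) (hn ▸ hy')
  calc dist x' y' ≤ ∑ i ∈ Finset.range n, dist (p' i) (p' (i + 1)) := by
        rw [← e0, ← en]; exact dist_le_range_sum_dist p' n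
    _ = ∑ i ∈ Finset.range n, dist (p i) (p (i + 1)) :=
        Finset.sum_congr rfl fun i hi => hstep i (Finset.mem_range.1 hi)
    _ < dist x y + η := hL.trans_le (by linarith [min_le_left η (r / 4)])

lemma half_mem_Icc : (1 / 2 : ℝ) ∈ Icc (0 : ℝ) 1 := by norm_num

/-- The distance from a point to its mirror image is twice its distance from the level `c`. If `x`
and `y` are projected to the level set, the midpoint `m` of the projections is fixed by the
reflection, so the midpoint `z` and its image `z'` are equally controlled by `m`, and convexity of
the metric bounds `dist z m`. -/
lemma EdgeAt.abs_hgt_midpoint_sub_le (hX : IsCAT0 X) (h : S.EdgeAt q M a b) (hq : q ∈ M)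
    (hr : S.IsGood q r) (hc : |c| ≤ r / 16) {x y : X} (hx : dist q x < r / 16)
    (hy : dist q y < r / 16) :
    |hgt a b (geo x y (1 / 2)) - c| ≤ (|hgt a b x - c| + |hgt a b y - c|) / 2 := by
  have hr0 := hr.pos
  have hr8 := hr.le
  have proj : ∀ x, dist q x < r / 16 → ∃ z, dist q z < r / 4 ∧ hgt a b z = c ∧
      dist x z = |hgt a b x - c| ∧ S.IsRefl q a b c z z := by
    intro x hx
    obtain ⟨D, hD, hxD⟩ := S.cover x
    have hqD := hr.cube D hD x hxD (by linarith)
    obtain ⟨z, hz, hzc, hd⟩ := (h.edgeIn hD hqD).exists_fibre hD hxD (v := c) (by linarith)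
    have h1 := (h.abs_hgt_le hq hr (x := x) (by linarith)).trans hx.le
    refine ⟨z, ?_, hzc, hd, D, hD, hqD, hz, hz, by simp, by rw [hzc]; ring⟩
    have h2 : |hgt a b x - c| ≤ r / 8 := by
      have := abs_sub (hgt a b x) c
      linarith
    linarith [dist_triangle q x z]
  obtain ⟨u, hu, huc, hud, hur⟩ := proj x hx
  obtain ⟨w, hw, hwc, hwd, hwr⟩ := proj y hy
  have hball : ∀ {s : ℝ} {x y : X}, dist q x < s → dist q y < s → dist q (geo x y (1 / 2)) < s := by
    intro s x y hx hy
    rw [← Metric.mem_ball'] at hx hy ⊢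
    exact hX.geoConvex_ball q s x hx y hy _ half_mem_Icc
  have hcr : |c| ≤ r := by linarith
  set m := geo u w (1 / 2) with hm
  set z := geo x y (1 / 2) with hz
  have hmr : dist q m < r / 4 := hball hu hw
  have hzr : dist q z < r / 4 := (hball hx hy).trans (by linarith)
  obtain ⟨m', hm'⟩ := h.exists_refl hq hr hcr (x := m) (by linarith)
  obtain ⟨z', hz'⟩ := h.exists_refl hq hr hcr (x := z) (by linarith)
  -- The reflection is 1-Lipschitz and fixes `u` and `w`, so `m'` is a midpoint of `u` and `w` as
  -- well.
  have hmm : m = m' := by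
    have h1 := h.dist_refl_le hq hr hcr hu hmr hur hm'
    have h2 := h.dist_refl_le hq hr hcr hmr hw hm' hwr
    rw [hX.dist_left_geo u w half_mem_Icc] at h1
    rw [hX.dist_geo_right u w half_mem_Icc] at h2
    have h3 := dist_triangle u m' w
    exact hX.geo_unique half_mem_Icc ⟨by linarith, by linarith⟩
  rw [← hmm] at hm'
  have h4 := h.dist_refl_le hq hr hcr hzr hmr hz' hm'
  obtain ⟨D, -, -, -, -, hd, hcz⟩ := hz'
  have h5 : dist z z' = 2 * |hgt a b z - c| := by
    rw [hd, hcz, show hgt a b z - (2 * c - hgt a b z) = 2 * (hgt a b z - c) by ring, abs_mul]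
    norm_num
  have h6 := hX.dist_geo_le x y u w half_mem_Icc
  rw [hud, hwd] at h6
  have h7 := dist_triangle_right z z' m
  linarith

/-- Height functions are affine along geodesics. -/
lemma EdgeAt.hgt_midpoint (hX : IsCAT0 X) (h : S.EdgeAt q M a b) (hq : q ∈ M)
    (hr : S.IsGood q r) {x y : X} (hx : dist q x < r / 16) (hy : dist q y < r / 16) :
    hgt a b (geo x y (1 / 2)) = (hgt a b x + hgt a b y) / 2 := by
  have hr0 := hr.pos
  have hz : dist q (geo x y (1 / 2)) < r / 16 := by
    rw [← Metric.mem_ball'] at hx hy ⊢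
    exact hX.geoConvex_ball q _ x hx y hy _ half_mem_Icc
  have b1 := abs_le.1 ((h.abs_hgt_le hq hr (x := x) (by linarith)).trans hx.le)
  have b2 := abs_le.1 ((h.abs_hgt_le hq hr (x := y) (by linarith)).trans hy.le)
  have b3 := abs_le.1 ((h.abs_hgt_le hq hr (x := geo x y (1 / 2)) (by linarith)).trans hz.le)
  -- All three heights lie between the levels `-r/16` and `r/16`. At each of these levels the
  -- absolute values open with one sign, and the two resulting inequalities are opposite.
  have h1 := h.abs_hgt_midpoint_sub_le hX hq hr (c := r / 16)
    (by rw [abs_of_pos (by linarith)]) hx hy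
  have h2 := h.abs_hgt_midpoint_sub_le hX hq hr (c := -(r / 16))
    (by rw [abs_neg, abs_of_pos (by linarith)]) hx hy
  rw [abs_of_nonpos (by linarith), abs_of_nonpos (by linarith), abs_of_nonpos (by linarith)] at h1
  rw [abs_of_nonneg (by linarith), abs_of_nonneg (by linarith), abs_of_nonneg (by linarith)] at h2
  linarith

end CubeComplex

end Local

/-! ### Walls are convex and do not cross themselves -/

section Tracks

variable {X : Type u} [MetricSpace X] [Nonempty X] (S : CubeComplex X)

/-- A continuous function on `[0,1]` that is locally midpoint convex and nonpositive at the ends is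
nonpositive. -/
lemma nonpos_of_locally_midpoint_convex {H : ℝ → ℝ} (hc : ContinuousOn H (Icc 0 1)) (h0 : H 0 ≤ 0)
    (h1 : H 1 ≤ 0)
    (hm : ∀ t ∈ Ioo (0 : ℝ) 1, ∀ᶠ s in 𝓝[>] (0 : ℝ), H t ≤ (H (t - s) + H (t + s)) / 2) {t : ℝ}
    (ht : t ∈ Icc (0 : ℝ) 1) : H t ≤ 0 := by
  by_contra! hpos
  obtain ⟨u, hu, hmax⟩ := isCompact_Icc.exists_isMaxOn ⟨t, ht⟩ hc
  have hu0 : 0 < H u := hpos.trans_le (hmax ht)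
  -- Maximum principle at the first maximum `w`: the value at `w - s` is strictly smaller, against
  -- midpoint convexity.
  set A := Icc (0 : ℝ) 1 ∩ H ⁻¹' {H u}
  have hA : IsCompact A :=
    isCompact_Icc.of_isClosed_subset (hc.preimage_isClosed_of_isClosed isClosed_Icc isClosed_singleton)
      inter_subset_left
  have hw := hA.sInf_mem ⟨u, hu, rfl⟩
  set w := sInf A
  have hHw : H w = H u := hw.2
  have hw0 : 0 < w := hw.1.1.lt_of_ne fun h => by rw [← h] at hHw; linarith
  have hw1 : w < 1 := hw.1.2.lt_of_ne fun h => by rw [h] at hHw; linarith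
  obtain ⟨s, hs, hs'⟩ := ((hm w ⟨hw0, hw1⟩).and (Ioo_mem_nhdsGT (lt_min hw0 (sub_pos.2 hw1)))).exists
  have hsw := hs'.2.trans_le (min_le_left _ _)
  have hsw' := hs'.2.trans_le (min_le_right _ _)
  have hs0 := hs'.1
  have m1 : w - s ∈ Icc (0 : ℝ) 1 := ⟨by linarith, by linarith⟩
  have m2 : w + s ∈ Icc (0 : ℝ) 1 := ⟨by linarith, by linarith⟩
  have l1 : H (w - s) ≤ H u := hmax m1
  have l2 : H (w + s) ≤ H u := hmax m2
  have l3 : H (w - s) ≠ H u := fun h => by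
    have := csInf_le hA.bddBelow (show w - s ∈ A from ⟨m1, h⟩)
    linarith
  have l4 := lt_of_le_of_ne l1 l3
  linarith

omit [Nonempty X] in
lemma eventually_dist_lt {γ : ℝ → X} {s : Set ℝ} (hγ : ContinuousOn γ s) {t : ℝ} (ht : t ∈ s)
    {p : X} {ε : ℝ} (h : dist p (γ t) < ε) : ∀ᶠ t' in 𝓝[s] t, dist p (γ t') < ε :=
  (tendsto_const_nhds.dist (hγ t ht).tendsto).eventually (gt_mem_nhds h)

omit [Nonempty X] in
lemma IsCAT0.geo_midpoint (hX : IsCAT0 X) (x y : X) {t s : ℝ} (h1 : t - s ∈ Icc (0 : ℝ) 1)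
    (h2 : t + s ∈ Icc (0 : ℝ) 1) (hs : 0 ≤ s) :
    geo x y t = geo (geo x y (t - s)) (geo x y (t + s)) (1 / 2) := by
  have ht : t ∈ Icc (0 : ℝ) 1 := ⟨by linarith [h1.1], by linarith [h2.2]⟩
  symm
  refine hX.geo_unique CubeComplex.half_mem_Icc ⟨?_, ?_⟩
  · rw [hX.dist_geo_geo x y h1 ht, hX.dist_geo_geo x y h1 h2, abs_of_nonpos (by linarith),
      abs_of_nonpos (by linarith)]
    ring
  · rw [hX.dist_geo_geo x y ht h2, hX.dist_geo_geo x y h1 h2, abs_of_nonpos (by linarith),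
      abs_of_nonpos (by linarith)]
    ring

namespace CubeComplex

/-- Every ball of radius `ε` is contained in a good ball. -/
def IsUniformScale (ε : ℝ) : Prop :=
  0 < ε ∧ ∀ p, ∃ q r, S.IsGood q r ∧ ∀ y, dist p y < ε → dist q y < r / 16

/-! #### Uniformity from a cocompact action -/

omit [Nonempty X] in
lemma smul_isMidcube {G : Type v} [Group G] [MulAction G X] [IsIsometricSMul G X] (g : G)
    {M C : Set X} (h : IsMidcube M C) : IsMidcube (g • M) (g • C) := by
  obtain ⟨n, f, hf, i, rfl⟩ := h
  refine ⟨n, fun t => g • f t, ⟨?_, fun s hs t ht => ?_⟩, i, ?_⟩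
  · rw [← hf.1, ← image_smul, image_image]
  · rw [dist_smul, hf.2 s hs t ht]
  · rw [← image_smul, image_image]

omit [Nonempty X] in
lemma smul_midcubes {G : Type v} [Group G] [MulAction G X] [IsIsometricSMul G X]
    (hcubes : ∀ (g : G), ∀ C ∈ S.cubes, g • C ∈ S.cubes) (g : G) {M : Set X}
    (h : M ∈ S.midcubes) : g • M ∈ S.midcubes := by
  obtain ⟨C, hC, hM⟩ := h
  exact ⟨g • C, hcubes g C hC, smul_isMidcube g hM⟩

/-- Goodness is invariant under the group, so a Lebesgue number for the balls of radius `r q / 16`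
on a compact set whose translates cover `X` serves everywhere. Height functions are affine at this
scale by `EdgeAt.hgt_midpoint`. -/
lemma exists_isUniformScale {G : Type v} [Group G] [MulAction G X] [IsIsometricSMul G X]
    (hcubes : ∀ (g : G), ∀ C ∈ S.cubes, g • C ∈ S.cubes)
    (hcocompact : ActsCocompactlyOn (⊤ : Subgroup G) (univ : Set X)) :
    ∃ ε, S.IsUniformScale ε := by
  obtain ⟨K, -, hK, hcov⟩ := hcocompact
  choose r hr using S.exists_isGood
  obtain ⟨δ, hδ, h⟩ := lebesgue_number_lemma_of_metric hK
    (c := fun q => Metric.ball q (r q / 16)) (fun q => Metric.isOpen_ball)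
    (fun q _ => mem_iUnion.2 ⟨q, Metric.mem_ball_self (by have := (hr q).pos; positivity)⟩)
  refine ⟨δ, hδ, fun p => ?_⟩
  obtain ⟨g, -, hg⟩ := mem_iUnion₂.1 (hcov (mem_univ p))
  obtain ⟨p₀, hp₀, rfl⟩ := hg
  obtain ⟨q, hq⟩ := h p₀ hp₀
  have hd : ∀ x y : X, dist x (g⁻¹ • y) = dist (g • x) y := fun x y => by
    rw [← dist_smul g, smul_inv_smul]
  refine ⟨g • q, r q, ⟨(hr q).pos, (hr q).le, fun C hC y hy hqy => ?_, fun M hM y hy hqy => ?_⟩,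
    fun y hy => ?_⟩
  · rw [← mem_inv_smul_set_iff]
    exact (hr q).cube _ (hcubes g⁻¹ C hC) (g⁻¹ • y) (smul_mem_smul_set hy) (by rwa [hd])
  · rw [← mem_inv_smul_set_iff]
    exact (hr q).midcube _ (S.smul_midcubes hcubes g⁻¹ hM) (g⁻¹ • y) (smul_mem_smul_set hy)
      (by rwa [hd])
  · have := hq (show g⁻¹ • y ∈ Metric.ball p₀ δ by rw [Metric.mem_ball', hd]; exact hy)
    rwa [Metric.mem_ball', hd] at this

/-! #### Tracks -/

/-- A choice of midcubes along a path, with locally constant germs. -/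
structure IsTrack (γ : ℝ → X) (M : ℝ → Set X) : Prop where
  midcube : ∀ t ∈ Icc (0 : ℝ) 1, M t ∈ S.midcubes
  mem : ∀ t ∈ Icc (0 : ℝ) 1, γ t ∈ M t
  germ : ∀ t ∈ Icc (0 : ℝ) 1, ∀ᶠ t' in 𝓝[Icc 0 1] t, M t' ∩ S.hull (γ t) = M t ∩ S.hull (γ t)

variable {S}

/-- Whether the two germs agree is locally constant along the path, since at nearby times they can
be compared at a common point by `germ_eq_of_germ_eq`. -/
lemma IsTrack.germ_unique {γ : ℝ → X} {M N : ℝ → Set X} (hM : S.IsTrack γ M) (hN : S.IsTrack γ N)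
    (h0 : M 0 ∩ S.hull (γ 0) = N 0 ∩ S.hull (γ 0)) {t : ℝ} (ht : t ∈ Icc (0 : ℝ) 1) :
    M t ∩ S.hull (γ t) = N t ∩ S.hull (γ t) := by
  have := isPreconnected_Icc.induction₂ (s := Icc (0 : ℝ) 1)
    (fun t t' => M t ∩ S.hull (γ t) = N t ∩ S.hull (γ t) ↔
      M t' ∩ S.hull (γ t') = N t' ∩ S.hull (γ t')) ?_ (fun _ _ _ _ _ _ h h' => h.trans h')
      (fun _ _ _ _ h => h.symm) (x := 0) (y := t) (by simp) ht
  · exact this.1 h0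
  intro t ht
  filter_upwards [hM.germ t ht, hN.germ t ht, self_mem_nhdsWithin] with t' h1 h2 ht'
  have m1 : γ t ∈ M t' := (h1.superset ⟨hM.mem t ht, S.mem_hull _⟩).1
  have m2 : γ t ∈ N t' := (h2.superset ⟨hN.mem t ht, S.mem_hull _⟩).1
  rw [← h1, ← h2]
  constructor
  · exact S.germ_eq_of_germ_eq (hM.midcube t' ht') (hN.midcube t' ht') m1 m2 (hM.mem t' ht') (hN.mem t' ht')
  · exact S.germ_eq_of_germ_eq (hM.midcube t' ht') (hN.midcube t' ht') (hM.mem t' ht') (hN.mem t' ht') m1 m2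

lemma EdgeAt.hgt_eq_zero {M : Set X} (hM : M ∈ S.midcubes) {q a b y : X} (h : S.EdgeAt q M a b)
    (hq : q ∈ M) (hy : y ∈ M) : hgt a b y = 0 := by
  obtain ⟨a', b', h'⟩ := S.exists_edgeAt hM hy
  obtain ⟨C, hC, i, rfl⟩ := S.exists_eq_mid hM
  rw [← abs_eq_zero, h.abs_hgt_eq (S.mid_mem hC i) hq hy h' hC hq.1 hy.1 hy.1, h'.hgt_self hy,
    abs_zero]

lemma EdgeAt.congr {M N : Set X} {q a b : X} (h : S.EdgeAt q M a b)
    (hMN : M ∩ S.hull q = N ∩ S.hull q) : S.EdgeAt q N a b := by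
  refine ⟨h.edge, fun y hy => ?_⟩
  rw [← h.mem_iff y hy]
  constructor
  · intro hyN; exact (hMN.superset ⟨hyN, hy⟩).1
  · intro hyM; exact (hMN.subset ⟨hyM, hy⟩).1

/-- A track along the geodesic from `o` to `x` can be pushed to nearby geodesics from `o` whose
endpoint is in the final midcube. -/
lemma IsTrack.push (hX : IsCAT0 X) {ε : ℝ} (hε : S.IsUniformScale ε) {o x x' : X} {M : ℝ → Set X}
    (hM : S.IsTrack (geo o x) M) {M' : Set X} (hM' : M' ∈ S.midcubes) (hx : x ∈ M') (hx' : x' ∈ M')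
    (hgerm : M 1 ∩ S.hull x = M' ∩ S.hull x) (hd : dist x x' < ε) :
    ∃ N, S.IsTrack (geo o x') N ∧ N 0 ∩ S.hull o = M 0 ∩ S.hull o ∧
      N 1 ∩ S.hull x' = M' ∩ S.hull x' := by
  set γ := geo o x with hγ
  set γ' := geo o x' with hγ'
  have i0 : (0 : ℝ) ∈ Icc (0 : ℝ) 1 := by simp
  have i1 : (1 : ℝ) ∈ Icc (0 : ℝ) 1 := by simp
  have γ0 : γ 0 = o := hX.geo_zero o x
  have γ1 : γ 1 = x := hX.geo_one o x
  have γ0' : γ' 0 = o := hX.geo_zero o x'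
  have γ1' : γ' 1 = x' := hX.geo_one o x'
  have hclose : ∀ t ∈ Icc (0 : ℝ) 1, dist (γ t) (γ' t) < ε := by
    intro t ht
    have := hX.dist_geo_le o x o x' ht
    rw [dist_self, mul_zero, zero_add] at this
    have h2 : t * dist x x' ≤ dist x x' := mul_le_of_le_one_left dist_nonneg ht.2
    exact (this.trans h2).trans_lt hd
  -- One good ball about `Q t` contains both `γ t` and `γ' t`, so heights over `M t` are measured
  -- with an edge at `Q t`.
  choose Q r hgood hball using fun t => hε.2 (γ t)
  have r16 : ∀ t, r t / 16 < r t := fun t => by linarith [(hgood t).pos]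
  have hQr : ∀ t y, dist (γ t) y < ε → dist (Q t) y < r t := fun t y h => (hball t y h).trans (r16 t)
  have hQ : ∀ t ∈ Icc (0 : ℝ) 1, Q t ∈ M t := fun t ht =>
    (hgood t).midcube _ (hM.midcube t ht) _ (hM.mem t ht) (hQr t _ (by rw [dist_self]; exact hε.1))
  have hex : ∀ t, ∃ a b, t ∈ Icc (0 : ℝ) 1 → S.EdgeAt (Q t) (M t) a b := fun t => by
    by_cases ht : t ∈ Icc (0 : ℝ) 1
    · obtain ⟨a, b, h⟩ := S.exists_edgeAt (hM.midcube t ht) (hQ t ht)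
      exact ⟨a, b, fun _ => h⟩
    · exact ⟨o, o, fun h => absurd h ht⟩
  choose a b hab using hex
  have hcγ := hX.continuousOn_geo_param o x
  have hcγ' := hX.continuousOn_geo_param o x'
  have near : ∀ t ∈ Icc (0 : ℝ) 1, ∀ᶠ t' in 𝓝[Icc 0 1] t, t' ∈ Icc (0 : ℝ) 1 ∧
      dist (γ t) (γ' t') < ε ∧ Q t ∈ M t' ∧ M t' ∩ S.hull (Q t) = M t ∩ S.hull (Q t) := by
    intro t ht
    have e1 : ∀ᶠ t' in 𝓝[Icc 0 1] t, dist (γ t) (γ' t') < ε :=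
      eventually_dist_lt hcγ' ht (hclose t ht)
    have e2 : ∀ᶠ t' in 𝓝[Icc 0 1] t, dist (γ t) (γ t') < ε :=
      eventually_dist_lt hcγ ht (by rw [dist_self]; exact hε.1)
    filter_upwards [e1, e2, hM.germ t ht, self_mem_nhdsWithin] with t' h1 h2 h3 ht'
    have hQt' : Q t ∈ M t' := (hgood t).midcube _ (hM.midcube t' ht') _ (hM.mem t' ht') (hQr t _ h2)
    have m1 : γ t ∈ M t' := (h3.superset ⟨hM.mem t ht, S.mem_hull _⟩).1
    exact ⟨ht', h1, hQt', S.germ_eq_of_germ_eq (hM.midcube t' ht') (hM.midcube t ht) m1 (hM.mem t ht) hQt'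
      (hQ t ht) h3⟩
  -- The unsigned height of `γ' t` over `M t`; the edges for different `t` need not be oriented
  -- coherently, so the sign is dropped. Near each time `H` is the absolute value of a single height
  -- function along `γ'`, hence continuous and midpoint convex. It vanishes at both ends, so it
  -- vanishes throughout.
  set H : ℝ → ℝ := fun t => |hgt (a t) (b t) (γ' t)| with hH
  have hloc : ∀ t ∈ Icc (0 : ℝ) 1, ∀ᶠ t' in 𝓝[Icc 0 1] t, H t' = |hgt (a t) (b t) (γ' t')| := by
    intro t ht
    filter_upwards [near t ht] with t' ⟨ht', h1, hQt', h3⟩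
    obtain ⟨D, hD, hDγ⟩ := S.cover (γ' t')
    exact (hab t' ht').abs_hgt_eq (hM.midcube t' ht') (hQ t' ht') hQt' ((hab t ht).congr h3.symm) hD
      ((hgood t').cube D hD _ hDγ (hQr t' _ (hclose t' ht')))
      ((hgood t).cube D hD _ hDγ (hQr t _ h1)) hDγ
  have hcont : ContinuousOn H (Icc 0 1) := by
    intro t ht
    refine ContinuousWithinAt.congr_of_eventuallyEq (f := fun t' => |hgt (a t) (b t) (γ' t')|) ?_
      (hloc t ht) rfl
    exact ((continuous_hgt (a t) (b t)).comp_continuousOn hcγ' t ht).abs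
  have hmid : ∀ t ∈ Ioo (0 : ℝ) 1, ∀ᶠ s in 𝓝[>] (0 : ℝ), H t ≤ (H (t - s) + H (t + s)) / 2 := by
    intro t ht
    have htI := Ioo_subset_Icc_self ht
    have hn : 𝓝[Icc 0 1] t = 𝓝 t := nhdsWithin_eq_nhds.2 (Icc_mem_nhds ht.1 ht.2)
    have hev := (near t htI).and (hloc t htI)
    rw [hn] at hev
    have l1 : Filter.Tendsto (fun s => t - s) (𝓝[>] (0 : ℝ)) (𝓝 t) := by
      have : Filter.Tendsto (fun s => t - s) (𝓝 (0 : ℝ)) (𝓝 (t - 0)) :=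
        (continuous_const.sub continuous_id).tendsto 0
      rw [sub_zero] at this
      exact this.mono_left nhdsWithin_le_nhds
    have l2 : Filter.Tendsto (fun s => t + s) (𝓝[>] (0 : ℝ)) (𝓝 t) := by
      have : Filter.Tendsto (fun s => t + s) (𝓝 (0 : ℝ)) (𝓝 (t + 0)) :=
        (continuous_const.add continuous_id).tendsto 0
      rw [add_zero] at this
      exact this.mono_left nhdsWithin_le_nhds
    filter_upwards [l1.eventually hev, l2.eventually hev, self_mem_nhdsWithin] with s h1 h2 hs
    obtain ⟨⟨i1, d1, -, -⟩, e1⟩ := h1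
    obtain ⟨⟨i2, d2, -, -⟩, e2⟩ := h2
    rw [e1, e2]
    have := (hab t htI).hgt_midpoint hX (hQ t htI) (hgood t) (hball t _ d1) (hball t _ d2)
    rw [← hX.geo_midpoint o x' i1 i2 (le_of_lt hs)] at this
    simp only [hH]
    rw [this, abs_div, abs_two]
    exact div_le_div_of_nonneg_right (abs_add_le _ _) two_pos.le
  have hQ1 : Q 1 ∈ M' := (hgood 1).midcube _ hM' x hx
    (hQr 1 _ (by rw [γ1, dist_self]; exact hε.1))
  have hgerm1 : M 1 ∩ S.hull (Q 1) = M' ∩ S.hull (Q 1) :=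
    S.germ_eq_of_germ_eq (hM.midcube 1 i1) hM' (γ1 ▸ hM.mem 1 i1) hx (hQ 1 i1) hQ1 hgerm
  have H0 : H 0 = 0 := by
    simp only [hH]
    rw [abs_eq_zero, γ0', ← γ0]
    exact (hab 0 i0).hgt_eq_zero (hM.midcube 0 i0) (hQ 0 i0) (hM.mem 0 i0)
  have H1 : H 1 = 0 := by
    simp only [hH]
    rw [abs_eq_zero, γ1']
    exact ((hab 1 i1).congr hgerm1).hgt_eq_zero hM' hQ1 hx'
  have Hzero : ∀ t ∈ Icc (0 : ℝ) 1, hgt (a t) (b t) (γ' t) = 0 := fun t ht => abs_eq_zero.1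
    (le_antisymm (nonpos_of_locally_midpoint_convex hcont H0.le H1.le hmid ht) (abs_nonneg _))
  -- As the height vanishes, `γ' t` lies on the extension of the germ of `M t` to any cube around
  -- `γ' t`.
  have hexN : ∀ t, ∃ N, t ∈ Icc (0 : ℝ) 1 → N ∈ S.midcubes ∧ γ' t ∈ N ∧
      N ∩ S.hull (Q t) = M t ∩ S.hull (Q t) := fun t => by
    by_cases ht : t ∈ Icc (0 : ℝ) 1
    · obtain ⟨D, hD, hDγ⟩ := S.cover (γ' t)
      obtain ⟨i, -, hi, hi'⟩ := (hab t ht).exists_mid hD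
        ((hgood t).cube D hD _ hDγ (hQr t _ (hclose t ht)))
      exact ⟨mid D i, fun _ => ⟨S.mid_mem hD i, (hi _ hDγ).2 (Hzero t ht), hi'.symm⟩⟩
    · exact ⟨∅, fun h => absurd h ht⟩
  choose N hN using hexN
  have hQN : ∀ t ∈ Icc (0 : ℝ) 1, Q t ∈ N t := fun t ht =>
    ((hN t ht).2.2.superset ⟨hQ t ht, S.mem_hull _⟩).1
  have oN : o ∈ N 0 := γ0' ▸ (hN 0 i0).2.1
  have oM : o ∈ M 0 := γ0 ▸ hM.mem 0 i0
  have xN : x' ∈ N 1 := γ1' ▸ (hN 1 i1).2.1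
  refine ⟨N, ⟨fun t ht => (hN t ht).1, fun t ht => (hN t ht).2.1, fun t ht => ?_⟩,
    S.germ_eq_of_germ_eq (hN 0 i0).1 (hM.midcube 0 i0) (hQN 0 i0) (hQ 0 i0) oN oM (hN 0 i0).2.2,
    S.germ_eq_of_germ_eq (hN 1 i1).1 hM' (hQN 1 i1) hQ1 xN hx' ((hN 1 i1).2.2.trans hgerm1)⟩
  obtain ⟨ρ, hρ⟩ := S.exists_isGood (γ' t)
  have e1 : ∀ᶠ t' in 𝓝[Icc 0 1] t, dist (γ' t) (γ' t') < ρ :=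
    eventually_dist_lt hcγ' ht (by rw [dist_self]; exact hρ.pos)
  filter_upwards [near t ht, e1] with t' ⟨ht', h1, hQt', h3⟩ h4
  obtain ⟨n1, n2, n3⟩ := hN t' ht'
  have m1 : γ' t ∈ N t' := hρ.midcube _ n1 _ n2 h4
  have m2 : Q t ∈ N t' := (hgood t).midcube _ n1 _ n2 (hQr t _ h1)
  have g1 : N t' ∩ S.hull (Q t) = M t' ∩ S.hull (Q t) :=
    S.germ_eq_of_germ_eq n1 (hM.midcube t' ht') (hQN t' ht') (hQ t' ht') m2 hQt' n3
  exact S.germ_eq_of_germ_eq n1 (hN t ht).1 m2 (hQN t ht) m1 (hN t ht).2.1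
    (g1.trans (h3.trans (hN t ht).2.2.symm))

/-! #### Midcubes -/

lemma mid_geo_mem (hX : IsCAT0 X) {M : Set X} (hM : M ∈ S.midcubes) : GeoConvex M := by
  obtain ⟨C, hC, i, rfl⟩ := S.exists_eq_mid hM
  intro x hx y hy t ht
  obtain ⟨h1, h2⟩ := hX.coord_geo S hC hx.1 hy.1 ht
  exact ⟨h1, by rw [h2, hx.2, hy.2]; ring⟩

lemma inter_hull_mem_midcubes {M : Set X} (hM : M ∈ S.midcubes) {x : X} (hx : x ∈ M) :
    M ∩ S.hull x ∈ S.midcubes := by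
  obtain ⟨a, b, h⟩ := S.exists_edgeAt hM hx
  obtain ⟨i, -, -, hi⟩ := h.exists_mid (S.hull_mem x) (S.mem_hull x)
  rw [hi, inter_eq_left.2 fun y hy => hy.1]
  exact S.mid_mem (S.hull_mem x) i

lemma germ_eq_of_subset {M N : Set X} (hM : M ∈ S.midcubes) (hN : N ∈ S.midcubes) (h : M ⊆ N)
    {x : X} (hx : x ∈ M) : M ∩ S.hull x = N ∩ S.hull x := by
  obtain ⟨a, b, h1⟩ := S.exists_edgeAt hM hx
  obtain ⟨i, -, -, hi⟩ := h1.exists_mid (S.hull_mem x) (S.mem_hull x)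
  obtain ⟨a', b', h2⟩ := S.exists_edgeAt hN (h hx)
  obtain ⟨k, -, -, hk⟩ := h2.exists_mid (S.hull_mem x) (S.mem_hull x)
  have hxi : x ∈ mid (S.hull x) i := (hi.subset ⟨hx, S.mem_hull x⟩).1
  rw [hi, hk]
  rw [S.mid_index_unique (S.hull_mem x) (S.hull_mem x) (S.mem_hull x) hxi fun y hy hyi =>
    (hk.subset ⟨h (hi.superset ⟨hyi, hy.2⟩).1, hy.2⟩).1]

/-- The common germ is itself a midcube, contained in both. -/
lemma sameComponent_of_germ_eq {M N : Set X} (hM : M ∈ S.midcubes) (hN : N ∈ S.midcubes) {x : X}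
    (hx : x ∈ M) (h : M ∩ S.hull x = N ∩ S.hull x) : S.SameComponent M N := by
  have h1 := S.inter_hull_mem_midcubes hM hx
  refine .trans _ _ _ (.symm _ _ (.rel _ _ ⟨h1, hM, inter_subset_left⟩))
    (.rel _ _ ⟨h1, hN, ?_⟩)
  rw [h]; exact inter_subset_left

/-- There is a track along the geodesic from `o` to `x` that starts in `M` and ends in `N`. -/
def IsTracked (S : CubeComplex X) (o : X) (M : Set X) (x : X) (N : Set X) : Prop :=
  ∃ T, S.IsTrack (geo o x) T ∧ T 0 ∩ S.hull o = M ∩ S.hull o ∧ T 1 ∩ S.hull x = N ∩ S.hull x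

lemma isTracked_self (hX : IsCAT0 X) {M : Set X} (hM : M ∈ S.midcubes) {o : X} (ho : o ∈ M) :
    S.IsTracked o M o M := by
  refine ⟨fun _ => M, ⟨fun _ _ => hM, fun t ht => ?_, fun _ _ => .of_forall fun _ => rfl⟩, rfl, rfl⟩
  rw [hX.geo_self o ht]; exact ho

/-- The endpoint is moved along a geodesic of the convex midcube `N`; displacements shorter than `ε`
are handled by `IsTrack.push`. -/
lemma IsTracked.move (hX : IsCAT0 X) {ε : ℝ} (hε : S.IsUniformScale ε) {o : X} {M N : Set X}
    (hN : N ∈ S.midcubes) {x y : X} (hx : x ∈ N) (hy : y ∈ N) (h : S.IsTracked o M x N) :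
    S.IsTracked o M y N := by
  have i0 : (0 : ℝ) ∈ Icc (0 : ℝ) 1 := by simp
  have i1 : (1 : ℝ) ∈ Icc (0 : ℝ) 1 := by simp
  have step : ∀ x ∈ N, ∀ y ∈ N, dist x y < ε → S.IsTracked o M x N → S.IsTracked o M y N := by
    rintro x hx y hy hd ⟨T, h1, h2, h3⟩
    obtain ⟨T', h1', h2', h3'⟩ := h1.push hX hε hN hx hy h3 hd
    exact ⟨T', h1', h2'.trans h2, h3'⟩
  have key := isPreconnected_Icc.induction₂ (s := Icc (0 : ℝ) 1)
    (fun t t' => S.IsTracked o M (geo x y t) N ↔ S.IsTracked o M (geo x y t') N) ?_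
    (fun _ _ _ _ _ _ h h' => h.trans h') (fun _ _ _ _ h => h.symm) i0 i1
  · rw [hX.geo_zero, hX.geo_one] at key
    exact key.1 h
  intro t ht
  have hc := hX.continuousOn_geo_param x y
  have e1 : ∀ᶠ t' in 𝓝[Icc 0 1] t, dist (geo x y t) (geo x y t') < ε :=
    eventually_dist_lt hc ht (by rw [dist_self]; exact hε.1)
  filter_upwards [e1, self_mem_nhdsWithin] with t' hd ht'
  have m := S.mid_geo_mem hX hN x hx y hy t ht
  have m' := S.mid_geo_mem hX hN x hx y hy t' ht'
  exact ⟨step _ m _ m' hd, step _ m' _ m (by rwa [dist_comm])⟩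

/-- Induction on the generated equivalence relation. The claim is made for all points of the midcube
so that it passes both ways along an inclusion: to a face by restriction, and from a face by moving
the endpoint. -/
lemma isTracked_of_sameComponent (hX : IsCAT0 X) {ε : ℝ} (hε : S.IsUniformScale ε) {M N : Set X}
    (hM : M ∈ S.midcubes) (h : S.SameComponent M N) {o x : X} (ho : o ∈ M)
    (hx : x ∈ N) : S.IsTracked o M x N := by
  have key : ∀ A B, S.SameComponent A B → ((A ∈ S.midcubes ∧ ∀ x ∈ A, S.IsTracked o M x A) ↔
      (B ∈ S.midcubes ∧ ∀ x ∈ B, S.IsTracked o M x B)) := by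
    intro A B hAB
    induction hAB with
    | rel A B h =>
      obtain ⟨hA, hB, hsub⟩ := h
      constructor
      · rintro ⟨-, h⟩
        refine ⟨hB, fun x hx => ?_⟩
        obtain ⟨C, hC, i, rfl⟩ := S.exists_eq_mid hA
        obtain ⟨y, hy⟩ := S.mid_nonempty hC i
        refine IsTracked.move hX hε hB (hsub hy) hx ?_
        obtain ⟨T, h1, h2, h3⟩ := h y hy
        exact ⟨T, h1, h2, h3.trans (S.germ_eq_of_subset hA hB hsub hy)⟩
      · rintro ⟨-, h⟩
        refine ⟨hA, fun x hx => ?_⟩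
        obtain ⟨T, h1, h2, h3⟩ := h x (hsub hx)
        exact ⟨T, h1, h2, h3.trans (S.germ_eq_of_subset hA hB hsub hx).symm⟩
    | refl A => exact Iff.rfl
    | symm A B _ ih => exact ih.symm
    | trans A B C _ _ ih ih' => exact ih.trans ih'
  exact ((key M N h).1 ⟨hM, fun y hy => (isTracked_self hX hM ho).move hX hε hM ho hy⟩).2 x hx

/-- Two midcubes of the same wall that share a point have the same germ there. -/
lemma germ_eq_of_sameComponent (hX : IsCAT0 X) {ε : ℝ} (hε : S.IsUniformScale ε) {M N : Set X}
    (hM : M ∈ S.midcubes) (h : S.SameComponent M N) {x : X} (hx : x ∈ M)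
    (hx' : x ∈ N) : M ∩ S.hull x = N ∩ S.hull x := by
  -- The geodesic from `x` to itself is constant. Along it runs the track `T`, from the germ of `M`
  -- to that of `N`, and also the constant track `M`; by uniqueness they end with the same germ.
  obtain ⟨T, h1, h2, h3⟩ := isTracked_of_sameComponent hX hε hM h hx hx'
  obtain ⟨T', h1', h2', h3'⟩ := isTracked_self hX hM hx
  have := h1.germ_unique h1' (by rw [hX.geo_zero, h2, h2']) (t := 1) (by simp)
  rw [hX.geo_one, h3, h3'] at this
  exact this.symm

lemma IsTrack.sameComponent {γ : ℝ → X} {T : ℝ → Set X} (hT : S.IsTrack γ T) {t : ℝ}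
    (ht : t ∈ Icc (0 : ℝ) 1) : S.SameComponent (T 0) (T t) := by
  refine isPreconnected_Icc.induction₂ (s := Icc (0 : ℝ) 1)
    (fun t t' => S.SameComponent (T t) (T t')) ?_ (fun _ _ _ _ _ _ h h' => .trans _ _ _ h h')
    (fun _ _ _ _ h => .symm _ _ h) (x := 0) (y := t) (by simp) ht
  intro t ht
  filter_upwards [hT.germ t ht, self_mem_nhdsWithin] with t' h ht'
  exact S.sameComponent_of_germ_eq (hT.midcube t ht) (hT.midcube t' ht') (hT.mem t ht) h.symm

/-- Two points of a wall are joined by a tracked geodesic, and all midcubes of a track belong to one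
component. -/
lemma IsWall.geoConvex (hX : IsCAT0 X) {ε : ℝ} (hε : S.IsUniformScale ε) {W : Set X}
    (hW : S.IsWall W) : GeoConvex W := by
  obtain ⟨M₀, hM₀, rfl⟩ := hW
  rintro x ⟨M, ⟨hM, hM'⟩, hx⟩ y ⟨N, ⟨hN, hN'⟩, hy⟩ t ht
  obtain ⟨T, h1, h2, h3⟩ := isTracked_of_sameComponent hX hε hM
    (.trans _ _ _ (.symm _ _ hM') hN') hx hy
  have i0 : (0 : ℝ) ∈ Icc (0 : ℝ) 1 := by simp
  refine ⟨T t, ⟨h1.midcube t ht, .trans _ _ _ hM' (.trans _ _ _ ?_ (h1.sameComponent ht))⟩, h1.mem t ht⟩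
  exact S.sameComponent_of_germ_eq hM (h1.midcube 0 i0) hx h2.symm

end CubeComplex

end Tracks

/-! ### Walls and their sides -/

section Sides

variable {X : Type u} [MetricSpace X] [Nonempty X] {S : CubeComplex X}

omit [Nonempty X] in
lemma IsCAT0.geo_sub (hX : IsCAT0 X) (x y : X) {u v t : ℝ} (hu : u ∈ Icc (0 : ℝ) 1)
    (hv : v ∈ Icc (0 : ℝ) 1) (ht : t ∈ Icc (0 : ℝ) 1) :
    geo (geo x y u) (geo x y v) t = geo x y ((1 - t) * u + t * v) := by
  have hw : (1 - t) * u + t * v ∈ Icc (0 : ℝ) 1 := by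
    obtain ⟨h1, h2⟩ := hu; obtain ⟨h3, h4⟩ := hv; obtain ⟨h5, h6⟩ := ht
    constructor <;> nlinarith
  refine hX.geo_unique ht ⟨?_, ?_⟩
  · rw [hX.dist_geo_geo x y hu hw, hX.dist_geo_geo x y hu hv,
      show u - ((1 - t) * u + t * v) = t * (u - v) by ring, abs_mul, abs_of_nonneg ht.1, mul_assoc]
  · rw [hX.dist_geo_geo x y hw hv, hX.dist_geo_geo x y hu hv,
      show (1 - t) * u + t * v - v = (1 - t) * (u - v) by ring, abs_mul,
      abs_of_nonneg (sub_nonneg.2 ht.2), mul_assoc]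

namespace CubeComplex

/-- At a point of a midcube of `C` that lies on no other midcube of `C`, there is only one germ of
midcubes. -/
lemma germ_eq_of_coord_ne {C : Set X} (hC : C ∈ S.cubes) {i} {x : X} (hx : x ∈ mid C i)
    (hne : ∀ k ≠ i, coord C x k ≠ 1 / 2) {N : Set X} (hN : N ∈ S.midcubes) (hxN : x ∈ N) :
    N ∩ S.hull x = mid C i ∩ S.hull x := by
  obtain ⟨a, b, h⟩ := S.exists_edgeAt hN hxN
  obtain ⟨k, -, -, hk⟩ := h.exists_mid hC hx.1
  have hxk : x ∈ mid C k := (hk.subset ⟨hxN, S.mem_hull x⟩).1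
  by_cases hki : k = i
  · rw [hk, hki]
  · exact absurd hxk.2 (hne k hki)

/-- Such a point lies on no other midcube of `C`, so it carries a single germ of midcubes and
identifies the wall through it. -/
lemma exists_mem_mid_coord_ne {C : Set X} (hC : C ∈ S.cubes) (i) :
    ∃ x ∈ mid C i, ∀ k ≠ i, coord C x k = 0 := by
  classical
  obtain ⟨x, hx, hc⟩ := S.exists_coord_eq hC (fun k => if k = i then 1 / 2 else 0) fun k => by
    split_ifs <;> norm_num
  exact ⟨x, ⟨hx, by simp [hc]⟩, fun k hk => by simp [hc, hk]⟩

variable {W : Set X}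

omit [Nonempty X] in
lemma IsWall.exists_midcube (hW : S.IsWall W) {x : X} (hx : x ∈ W) :
    ∃ M ∈ S.midcubes, x ∈ M ∧ M ⊆ W := by
  obtain ⟨M₀, hM₀, rfl⟩ := hW
  obtain ⟨M, hM, hx⟩ := hx
  exact ⟨M, hM.1, hx, fun y hy => ⟨M, hM, hy⟩⟩

/-- A midcube inside `W` is a priori only covered by midcubes of the component. At a point where its
germ is the only one, a covering midcube must share that germ. -/
lemma IsWall.sameComponent (hW : S.IsWall W) {M N : Set X} (hM : M ∈ S.midcubes)
    (hN : N ∈ S.midcubes) (hMW : M ⊆ W) (hNW : N ⊆ W) : S.SameComponent M N := by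
  obtain ⟨M₀, hM₀, rfl⟩ := hW
  have key : ∀ M ∈ S.midcubes, M ⊆ ⋃₀ {N ∈ S.midcubes | S.SameComponent M₀ N} →
      S.SameComponent M₀ M := by
    intro M hM hMW
    obtain ⟨C, hC, i, rfl⟩ := S.exists_eq_mid hM
    obtain ⟨x, hx, hne⟩ := exists_mem_mid_coord_ne hC i
    obtain ⟨N, hN, hxN⟩ := hMW hx
    refine .trans _ _ _ hN.2 (sameComponent_of_germ_eq hN.1 hM hxN
      (germ_eq_of_coord_ne hC hx (fun k hk => ?_) hN.1 hxN))
    rw [hne k hk]; norm_num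
  exact .trans _ _ _ (.symm _ _ (key M hM hMW)) (key N hN hNW)

lemma IsWall.subset_of_sameComponent (hW : S.IsWall W) {M N : Set X} (hM : M ∈ S.midcubes)
    (hN : N ∈ S.midcubes) (hMW : M ⊆ W) (h : S.SameComponent M N) : N ⊆ W := by
  have hW' := hW
  obtain ⟨M₀, hM₀, rfl⟩ := hW
  exact fun y hy => ⟨N, ⟨hN, .trans _ _ _ (hW'.sameComponent hM₀ hM
    (fun y hy => ⟨M₀, ⟨hM₀, .refl _⟩, hy⟩) hMW) h⟩, hy⟩

lemma IsWall.nonempty (hW : S.IsWall W) : W.Nonempty := by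
  obtain ⟨M, hM, rfl⟩ := hW
  obtain ⟨C, hC, i, rfl⟩ := S.exists_eq_mid hM
  obtain ⟨x, hx⟩ := S.mid_nonempty hC i
  exact ⟨x, mid C i, ⟨hM, .refl _⟩, hx⟩

omit [Nonempty X] in
lemma exists_wall {M : Set X} (hM : M ∈ S.midcubes) : ∃ W, S.IsWall W ∧ M ⊆ W :=
  ⟨_, ⟨M, hM, rfl⟩, fun _ hx => ⟨M, ⟨hM, .refl _⟩, hx⟩⟩

lemma IsWall.eq_of_subset {W' : Set X} (hW : S.IsWall W) (hW' : S.IsWall W') {M : Set X}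
    (hM : M ∈ S.midcubes) (h : M ⊆ W) (h' : M ⊆ W') : W = W' := by
  have key : ∀ {W W' : Set X}, S.IsWall W → S.IsWall W' → M ⊆ W → M ⊆ W' → W ⊆ W' := by
    intro W W' hW hW' h h' x hx
    obtain ⟨N, hN, hxN, hNW⟩ := hW.exists_midcube hx
    exact hW'.subset_of_sameComponent hM hN h' (hW.sameComponent hM hN h hNW) hxN
  exact (key hW hW' h h').antisymm (key hW' hW h' h)

omit [Nonempty X] in
lemma IsGood.mem_wall {q : X} {r : ℝ} (hr : S.IsGood q r) (hW : S.IsWall W) {y : X} (hy : y ∈ W)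
    (hd : dist q y < r) : q ∈ W := by
  obtain ⟨M, hM, hyM, hMW⟩ := hW.exists_midcube hy
  exact hMW (hr.midcube M hM y hyM hd)

lemma IsWall.isClosed (hW : S.IsWall W) : IsClosed W := by
  rw [← isOpen_compl_iff, Metric.isOpen_iff]
  intro q hq
  obtain ⟨r, hr⟩ := S.exists_isGood q
  exact ⟨r, hr.pos, fun y hy hyW => hq (hr.mem_wall hW hyW (Metric.mem_ball'.1 hy))⟩

variable (hX : IsCAT0 X) {ε : ℝ} (hε : S.IsUniformScale ε) (hW : S.IsWall W)
include hX hε hW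

/-- A wall meets a cube in at most one midcube. -/
lemma IsWall.inter_cube {D : Set X} (hD : D ∈ S.cubes) (h : (D ∩ W).Nonempty) :
    ∃ i, D ∩ W = mid D i := by
  have ext : ∀ x ∈ D, x ∈ W → ∃ i, x ∈ mid D i ∧ mid D i ⊆ W := by
    intro x hxD hxW
    obtain ⟨M, hM, hxM, hMW⟩ := hW.exists_midcube hxW
    obtain ⟨a, b, h⟩ := S.exists_edgeAt hM hxM
    obtain ⟨i, -, -, hi⟩ := h.exists_mid hD hxD
    exact ⟨i, (hi.subset ⟨hxM, S.mem_hull x⟩).1, hW.subset_of_sameComponent hM (S.mid_mem hD i) hMW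
      (sameComponent_of_germ_eq hM (S.mid_mem hD i) hxM hi)⟩
  obtain ⟨x, hxD, hxW⟩ := h
  obtain ⟨i, hxi, hi⟩ := ext x hxD hxW
  refine ⟨i, Subset.antisymm ?_ fun y hy => ⟨hy.1, hi hy⟩⟩
  rintro y ⟨hyD, hyW⟩
  obtain ⟨k, hyk, hk⟩ := ext y hyD hyW
  -- Two midcubes of `D` meet at its centre; if both are in `W`, they have the same germ there,
  -- hence the same index.
  obtain ⟨z, hz, hzc⟩ := S.exists_coord_eq hD (fun _ => 1 / 2) fun _ => by norm_num
  have g := germ_eq_of_sameComponent hX hε (S.mid_mem hD i)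
    (hW.sameComponent (S.mid_mem hD i) (S.mid_mem hD k) hi hk) (x := z) ⟨hz, hzc i⟩ ⟨hz, hzc k⟩
  rwa [S.mid_index_unique hD (S.hull_mem z) (S.mem_hull z) ⟨hz, hzc i⟩ fun y hy hyi =>
    (g.subset ⟨hyi, hy.2⟩).1]

/-- Near each of its points, a wall is the zero set of a height function. -/
lemma IsWall.exists_local {q : X} (hq : q ∈ W) : ∃ (r : ℝ) (a b : X) (M : Set X), S.IsGood q r ∧
    q ∈ M ∧ S.EdgeAt q M a b ∧ ∀ y, dist q y < r → (y ∈ W ↔ hgt a b y = 0) := by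
  obtain ⟨r, hr⟩ := S.exists_isGood q
  obtain ⟨M, hM, hqM, hMW⟩ := hW.exists_midcube hq
  obtain ⟨a, b, h⟩ := S.exists_edgeAt hM hqM
  refine ⟨r, a, b, M, hr, hqM, h, fun y hy => ?_⟩
  obtain ⟨D, hD, hyD⟩ := S.cover y
  have hqD := hr.cube D hD y hyD hy
  obtain ⟨i, -, hi, hi'⟩ := h.exists_mid hD hqD
  obtain ⟨k, hk⟩ := hW.inter_cube hX hε hD ⟨q, hqD, hq⟩
  have hqi : q ∈ mid D i := (hi'.subset ⟨hqM, S.mem_hull q⟩).1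
  obtain rfl : i = k := S.mid_index_unique hD (S.hull_mem q) (S.mem_hull q) hqi fun z hz hzi =>
    hk.subset ⟨hz.1, hMW (hi'.superset ⟨hzi, hz.2⟩).1⟩
  rw [← hi y hyD, ← hk]
  exact ⟨fun h => ⟨hyD, h⟩, fun h => h.2⟩

omit hX hε hW in
lemma EdgeAt.swap {q a b : X} {M : Set X} (h : S.EdgeAt q M a b) : S.EdgeAt q M b a := by
  refine ⟨⟨h.edge.right, h.edge.left, by rw [dist_comm, h.edge.dist_eq], h.edge.right_mem,
    h.edge.left_mem⟩, fun y hy => ?_⟩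
  rw [h.mem_iff y hy, hgt, hgt]
  constructor <;> intro <;> linarith

omit [Nonempty X] hX hε hW in
lemma hgt_swap (a b x : X) : hgt b a x = -hgt a b x := by rw [hgt, hgt]; ring

omit hε hW in
-- Affinity is known at midpoints only. The maximum principle, applied to the smaller end height
-- minus the height, extends positivity to the whole segment.
lemma EdgeAt.hgt_geo_pos {q a b : X} {M : Set X} {r : ℝ} (h : S.EdgeAt q M a b) (hq : q ∈ M)
    (hr : S.IsGood q r) {x y : X} (hx : dist q x < r / 16) (hy : dist q y < r / 16)
    (hx' : 0 < hgt a b x) (hy' : 0 < hgt a b y) {t : ℝ} (ht : t ∈ Icc (0 : ℝ) 1) :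
    0 < hgt a b (geo x y t) := by
  have hball : ∀ t ∈ Icc (0 : ℝ) 1, dist q (geo x y t) < r / 16 := by
    intro t ht
    rw [← Metric.mem_ball'] at hx hy ⊢
    exact hX.geoConvex_ball q _ x hx y hy t ht
  have key := nonpos_of_locally_midpoint_convex
    (H := fun t => min (hgt a b x) (hgt a b y) - hgt a b (geo x y t))
    (continuousOn_const.sub ((continuous_hgt a b).comp_continuousOn (hX.continuousOn_geo_param x y)))
    (by rw [hX.geo_zero]; linarith [min_le_left (hgt a b x) (hgt a b y)])
    (by rw [hX.geo_one]; linarith [min_le_right (hgt a b x) (hgt a b y)]) ?_ ht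
  · linarith [lt_min hx' hy']
  intro t ht
  filter_upwards [Ioo_mem_nhdsGT (lt_min ht.1 (sub_pos.2 ht.2))] with s hs
  have hsw := hs.2.trans_le (min_le_left _ _)
  have hsw' := hs.2.trans_le (min_le_right _ _)
  have hs0 := hs.1
  obtain ⟨ht0, ht1⟩ := ht
  have m1 : t - s ∈ Icc (0 : ℝ) 1 := ⟨by linarith, by linarith⟩
  have m2 : t + s ∈ Icc (0 : ℝ) 1 := ⟨by linarith, by linarith⟩
  have := h.hgt_midpoint hX hq hr (hball _ m1) (hball _ m2)
  rw [← hX.geo_midpoint x y m1 m2 hs0.le] at this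
  linarith

end CubeComplex

end Sides

/-! ### The two sides of a wall and their convexity -/

section SameSide

variable {X : Type u} [MetricSpace X] {W : Set X}

/-- `x` and `y` are not separated by `W`. -/
def SameSide (W : Set X) (x y : X) : Prop := ∀ t ∈ Icc (0 : ℝ) 1, geo x y t ∉ W

namespace SameSide

variable (hX : IsCAT0 X) {x y z : X}
include hX

lemma left (h : SameSide W x y) : x ∉ W := by
  have := h 0 (by simp)
  rwa [hX.geo_zero] at this

lemma right (h : SameSide W x y) : y ∉ W := by
  have := h 1 (by simp)
  rwa [hX.geo_one] at this

lemma refl (hx : x ∉ W) : SameSide W x x := fun t ht => by rwa [hX.geo_self x ht]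

lemma symm (h : SameSide W x y) : SameSide W y x := fun t ht => by
  rw [hX.geo_symm y x ht]
  exact h _ ⟨by linarith [ht.2], by linarith [ht.1]⟩

lemma geo_left (h : SameSide W x y) {t : ℝ} (ht : t ∈ Icc (0 : ℝ) 1) : SameSide W x (geo x y t) :=
  fun s hs => by
    rw [hX.geo_geo x y ht hs]
    exact h _ ⟨mul_nonneg hs.1 ht.1, mul_le_one₀ hs.2 ht.1 ht.2⟩

/-- Not being separated from `x` by a closed set is an open condition. -/
lemma eventually (hW : IsClosed W) (h : SameSide W x y) : ∀ᶠ z in 𝓝 y, SameSide W x z := by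
  have hK : IsCompact (geo x y '' Icc (0 : ℝ) 1) :=
    isCompact_Icc.image_of_continuousOn (hX.continuousOn_geo_param x y)
  obtain ⟨δ, hδ, hsub⟩ := hK.exists_thickening_subset_open hW.isOpen_compl
    (by rintro _ ⟨t, ht, rfl⟩; exact h t ht)
  filter_upwards [Metric.ball_mem_nhds y hδ] with z hz t ht
  refine hsub (Metric.mem_thickening_iff.2 ⟨geo x y t, ⟨t, ht, rfl⟩, ?_⟩)
  have := hX.dist_geo_le x z x y ht
  rw [dist_self, mul_zero, zero_add] at this
  exact (this.trans (mul_le_of_le_one_left dist_nonneg ht.2)).trans_lt hz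

end SameSide

/-- The first point at which a geodesic hits a closed set. -/
lemma IsCAT0.exists_first_hit (hX : IsCAT0 X) (hW : IsClosed W) {x y : X} (hx : x ∉ W)
    (h : ∃ t ∈ Icc (0 : ℝ) 1, geo x y t ∈ W) : ∃ t ∈ Icc (0 : ℝ) 1, 0 < t ∧ geo x y t ∈ W ∧
      ∀ s ∈ Ico 0 t, SameSide W x (geo x y s) := by
  set A := Icc (0 : ℝ) 1 ∩ geo x y ⁻¹' W
  have hA : IsCompact A := isCompact_Icc.of_isClosed_subset
    ((hX.continuousOn_geo_param x y).preimage_isClosed_of_isClosed isClosed_Icc hW) inter_subset_left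
  obtain ⟨t, ht, htW⟩ := h
  have hw := hA.sInf_mem ⟨t, ht, htW⟩
  have hpos : 0 < sInf A := hw.1.1.lt_of_ne fun h => hx (by
    have := hw.2
    rwa [← h, mem_preimage, hX.geo_zero] at this)
  refine ⟨sInf A, hw.1, hpos, hw.2, fun s hs u hu huW => ?_⟩
  have hsI : s ∈ Icc (0 : ℝ) 1 := ⟨hs.1, hs.2.le.trans hw.1.2⟩
  rw [hX.geo_geo x y hsI hu] at huW
  have := csInf_le hA.bddBelow
    (show u * s ∈ A from ⟨⟨mul_nonneg hu.1 hs.1, mul_le_one₀ hu.2 hs.1 hsI.2⟩, huW⟩)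
  have h2 : u * s ≤ s := mul_le_of_le_one_left hs.1 hu.2
  linarith [hs.2]

end SameSide

namespace CubeComplex

variable {X : Type u} [MetricSpace X] [Nonempty X] {S : CubeComplex X} {W : Set X}
variable (hX : IsCAT0 X) {ε : ℝ} (hε : S.IsUniformScale ε) (hW : S.IsWall W)

section LocalSides

variable {q a b : X} {M : Set X} {r : ℝ} (h : S.EdgeAt q M a b) (hq : q ∈ M) (hr : S.IsGood q r)
  (hloc : ∀ y, dist q y < r → (y ∈ W ↔ hgt a b y = 0))
include hX h hq hr hloc

lemma sameSide_of_hgt_pos {x y : X} (hx : dist q x < r / 16) (hy : dist q y < r / 16)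
    (hx' : 0 < hgt a b x) (hy' : 0 < hgt a b y) : SameSide W x y := by
  intro t ht hmem
  have hd : dist q (geo x y t) < r / 16 := by
    rw [← Metric.mem_ball'] at hx hy ⊢
    exact hX.geoConvex_ball q _ x hx y hy t ht
  have := (hloc _ (hd.trans (by linarith [hr.pos]))).1 hmem
  exact (h.hgt_geo_pos hX hq hr hx hy hx' hy' ht).ne' this

lemma sameSide_of_mul_hgt_pos {x y : X} (hx : dist q x < r / 16) (hy : dist q y < r / 16)
    (hxy : 0 < hgt a b x * hgt a b y) : SameSide W x y := by
  rcases mul_pos_iff.1 hxy with h' | h'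
  · exact sameSide_of_hgt_pos hX h hq hr hloc hx hy h'.1 h'.2
  · refine sameSide_of_hgt_pos hX h.swap hq hr (fun y hy => ?_) hx hy ?_ ?_
    · rw [hgt_swap, neg_eq_zero]; exact hloc y hy
    · rw [hgt_swap]; linarith
    · rw [hgt_swap]; linarith

omit [Nonempty X] h hq hr in
lemma not_sameSide_of_hgt_neg_pos {x y : X} (hx : dist q x < r) (hy : dist q y < r)
    (hx' : hgt a b x < 0) (hy' : 0 < hgt a b y) : ¬ SameSide W x y := by
  intro hs
  have hc : ContinuousOn (fun t => hgt a b (geo x y t)) (Icc 0 1) :=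
    (continuous_hgt a b).comp_continuousOn (hX.continuousOn_geo_param x y)
  obtain ⟨t, ht, ht0⟩ := intermediate_value_Icc zero_le_one hc
    (show (0 : ℝ) ∈ Icc _ _ by simp only [hX.geo_zero, hX.geo_one]; exact ⟨hx'.le, hy'.le⟩)
  refine hs t ht ((hloc _ ?_).2 ht0)
  rw [← Metric.mem_ball'] at hx hy ⊢
  exact hX.geoConvex_ball q _ x hx y hy t ht

end LocalSides

include hX hε hW

/-- If a geodesic with endpoints off the wall meets the wall, it crosses it transversally. -/
lemma IsWall.exists_crossing {x y : X} (hx : x ∉ W) (hy : y ∉ W) (hxy : ¬ SameSide W x y) :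
    ∃ (q : X) (r : ℝ) (a b : X) (u v : ℝ), u ∈ Icc (0 : ℝ) 1 ∧ v ∈ Icc (0 : ℝ) 1 ∧
      (∀ z, dist q z < r → (z ∈ W ↔ hgt a b z = 0)) ∧ dist q (geo x y u) < r ∧
      dist q (geo x y v) < r ∧ hgt a b (geo x y u) < 0 ∧ 0 < hgt a b (geo x y v) := by
  simp only [SameSide, not_forall, not_not] at hxy
  obtain ⟨s, hs, hsW⟩ := hxy
  obtain ⟨t, ht, ht0, htW, hbefore⟩ := hX.exists_first_hit hW.isClosed hx ⟨s, hs, hsW⟩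
  have ht1 : t < 1 := ht.2.lt_of_ne fun h => hy (by rwa [h, hX.geo_one] at htW)
  obtain ⟨r, a, b, M, hr, hqM, hE, hloc⟩ := hW.exists_local hX hε htW
  have hn : 𝓝[Icc 0 1] t = 𝓝 t := nhdsWithin_eq_nhds.2 (Icc_mem_nhds ht0 ht1)
  have hr0 := hr.pos
  have hev := eventually_dist_lt (hX.continuousOn_geo_param x y) ht (p := geo x y t) (ε := r / 16)
    (by rw [dist_self]; linarith)
  rw [hn, Metric.eventually_nhds_iff] at hev
  obtain ⟨δ, hδ, hball⟩ := hev
  set σ := min (δ / 2) (min t (1 - t)) with hσ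
  have hσ0 : 0 < σ := lt_min (by linarith) (lt_min ht0 (by linarith))
  have hσδ : σ < δ := (min_le_left _ _).trans_lt (by linarith)
  have hσt : σ ≤ t := (min_le_right _ _).trans (min_le_left _ _)
  have hσt' : σ ≤ 1 - t := (min_le_right _ _).trans (min_le_right _ _)
  have m1 : t - σ ∈ Icc (0 : ℝ) 1 := ⟨by linarith, by linarith⟩
  have m2 : t + σ ∈ Icc (0 : ℝ) 1 := ⟨by linarith, by linarith⟩
  have d1 : dist (geo x y t) (geo x y (t - σ)) < r / 16 :=
    hball (by rw [Real.dist_eq, sub_sub_cancel_left, abs_neg, abs_of_pos hσ0]; exact hσδ)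
  have d2 : dist (geo x y t) (geo x y (t + σ)) < r / 16 :=
    hball (by rw [Real.dist_eq, add_sub_cancel_left, abs_of_pos hσ0]; exact hσδ)
  -- The height is zero at the hit and nonzero just before it, so by affinity it has the opposite
  -- sign just after it.
  have hmid := hE.hgt_midpoint hX hqM hr d1 d2
  rw [← hX.geo_midpoint x y m1 m2 hσ0.le, hE.hgt_self hqM] at hmid
  have hne : hgt a b (geo x y (t - σ)) ≠ 0 := fun h =>
    (hbefore (t - σ) ⟨m1.1, by linarith⟩).right hX ((hloc _ (d1.trans (by linarith))).2 h)
  rcases lt_or_gt_of_ne hne with h | h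
  · exact ⟨_, r, a, b, t - σ, t + σ, m1, m2, hloc, d1.trans (by linarith), d2.trans (by linarith), h,
      by linarith⟩
  · exact ⟨_, r, a, b, t + σ, t - σ, m2, m1, hloc, d2.trans (by linarith), d1.trans (by linarith),
      by linarith, h⟩

/-- Being separated from `x` by a wall is an open condition. -/
lemma IsWall.eventually_not_sameSide {x y : X} (hx : x ∉ W) (hy : y ∉ W) (hxy : ¬ SameSide W x y) :
    ∀ᶠ z in 𝓝 y, ¬ SameSide W x z := by
  obtain ⟨q, r, a, b, u, v, hu, hv, hloc, d1, d2, h1, h2⟩ := hW.exists_crossing hX hε hx hy hxy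
  have hcont : ∀ u ∈ Icc (0 : ℝ) 1, Continuous fun z => geo x z u := fun u hu =>
    hX.continuousOn_geo.comp_continuous (f := fun z => (x, z, u)) (by fun_prop) fun _ => hu
  have e1 := (continuous_const.dist (hcont u hu)).tendsto y |>.eventually (gt_mem_nhds d1)
  have e2 := (continuous_const.dist (hcont v hv)).tendsto y |>.eventually (gt_mem_nhds d2)
  have e3 := ((continuous_hgt a b).comp (hcont u hu)).tendsto y |>.eventually (gt_mem_nhds h1)
  have e4 := ((continuous_hgt a b).comp (hcont v hv)).tendsto y |>.eventually (lt_mem_nhds h2)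
  filter_upwards [e1, e2, e3, e4] with z h1 h2 h3 h4 hs
  refine not_sameSide_of_hgt_neg_pos hX hloc h1 h2 h3 h4 fun t ht => ?_
  rw [hX.geo_sub x z hu hv ht]
  refine hs _ ?_
  obtain ⟨h1, h2⟩ := hu; obtain ⟨h3, h4⟩ := hv; obtain ⟨h5, h6⟩ := ht
  constructor <;> nlinarith

/-- Off `W`, being separated from `x` and not being separated from `x` are both open conditions, so
neither can change along the geodesic from `y` to `z`. -/
lemma IsWall.sameSide_trans {x y z : X} (h : SameSide W x y) (h' : SameSide W y z) :
    SameSide W x z := by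
  have key := isPreconnected_Icc.induction₂ (s := Icc (0 : ℝ) 1)
    (fun t t' => SameSide W x (geo y z t) ↔ SameSide W x (geo y z t')) ?_
    (fun _ _ _ _ _ _ h h' => h.trans h') (fun _ _ _ _ h => h.symm) (x := 0) (y := 1)
    (by simp) (by simp)
  · rw [hX.geo_zero, hX.geo_one] at key
    exact key.1 h
  intro t ht
  have hc := (hX.continuousOn_geo_param y z t ht).tendsto
  by_cases hs : SameSide W x (geo y z t)
  · filter_upwards [hc.eventually (hs.eventually hX hW.isClosed)] with t' ht'
    exact ⟨fun _ => ht', fun _ => hs⟩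
  · filter_upwards [hc.eventually (hW.eventually_not_sameSide hX hε (h.left hX) (h' t ht) hs)]
      with t' ht'
    exact ⟨fun h => absurd h hs, fun h => absurd h ht'⟩

omit hε in
lemma IsWall.isOpen_sameSide (x : X) : IsOpen {y | SameSide W x y} :=
  isOpen_iff_mem_nhds.2 fun _ hy => SameSide.eventually hX hW.isClosed hy

lemma IsWall.isOpen_not_sameSide {x : X} (hx : x ∉ W) : IsOpen {y | y ∉ W ∧ ¬ SameSide W x y} :=
  isOpen_iff_mem_nhds.2 fun _ hy =>
    Filter.Eventually.and (hW.isClosed.isOpen_compl.mem_nhds hy.1) (hW.eventually_not_sameSide hX hε hx hy.1 hy.2)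

/-- Which sides accumulate at a point of a wall does not depend on the point. -/
lemma IsWall.mem_closure_sameSide_iff {q q' x : X} (hq : q ∈ W) (hq' : q' ∈ W) :
    q ∈ closure {y | SameSide W x y} ↔ q' ∈ closure {y | SameSide W x y} := by
  refine (hX.isPreconnected_of_geoConvex (hW.geoConvex hX hε)).induction₂
    (fun q q' => q ∈ closure {y | SameSide W x y} ↔ q' ∈ closure {y | SameSide W x y}) ?_
    (fun _ _ _ _ _ _ h h' => h.trans h') (fun _ _ _ _ h => h.symm) hq hq'
  intro q hq
  obtain ⟨r, a, b, M, hr, hqM, hE, hloc⟩ := hW.exists_local hX hε hq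
  have hr0 := hr.pos
  have hr8 := hr.le
  have hB : Metric.ball q (r / 16) ∈ 𝓝 q := Metric.ball_mem_nhds q (by linarith)
  -- If the side of `x` enters the ball at some `y`, it accumulates at every nearby wall point `p`:
  -- displace `p` slightly along the edge direction, towards heights with the sign of `hgt a b y`.
  have key : ∀ p ∈ W, dist q p < r / 16 → (p ∈ closure {y | SameSide W x y} ↔
      ∃ y, dist q y < r / 16 ∧ SameSide W x y) := by
    intro p hp hd
    constructor
    · intro hcl
      obtain ⟨y, hy, hy'⟩ := mem_closure_iff.1 hcl _ Metric.isOpen_ball (Metric.mem_ball'.2 hd)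
      exact ⟨y, Metric.mem_ball'.1 hy, hy'⟩
    · rintro ⟨y, hy, hxy⟩
      have hyne : hgt a b y ≠ 0 := fun h => hxy.right hX ((hloc y (by linarith)).2 h)
      rw [Metric.mem_closure_iff]
      intro δ hδ
      obtain ⟨D, hD, hpD⟩ := S.cover p
      have hqD := hr.cube D hD p hpD (by linarith)
      set η := min (δ / 2) ((r / 16 - dist q p) / 2) with hη
      have hη0 : 0 < η := lt_min (by linarith) (by linarith)
      have hη1 : η < δ := (min_le_left _ _).trans_lt (by linarith)
      have hη2 : η < r / 16 - dist q p := (min_le_right _ _).trans_lt (by linarith)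
      have hη3 : η ≤ 1 / 2 := by linarith [dist_nonneg (x := q) (y := p)]
      have hp0 : hgt a b p = 0 := (hloc p (by linarith)).1 hp
      have hex : ∃ v, |v| = η ∧ 0 < hgt a b y * v := by
        rcases lt_or_gt_of_ne hyne with h | h
        · exact ⟨-η, by rw [abs_neg, abs_of_pos hη0], by nlinarith⟩
        · exact ⟨η, abs_of_pos hη0, by positivity⟩
      obtain ⟨v, hv, hyv⟩ := hex
      obtain ⟨z, hz, hzv, hzd⟩ := (hE.edgeIn hD hqD).exists_fibre hD hpD (v := v) (hv.trans_le hη3)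
      rw [hp0, zero_sub, abs_neg, hv] at hzd
      refine ⟨z, hW.sameSide_trans hX hε hxy (sameSide_of_mul_hgt_pos hX hE hqM hr hloc hy ?_ ?_),
        by linarith⟩
      · linarith [dist_triangle q p z]
      · rwa [hzv]
  filter_upwards [nhdsWithin_le_nhds hB, self_mem_nhdsWithin] with p hp hpW
  rw [key q hq (by rw [dist_self]; linarith), key p hpW (Metric.mem_ball'.1 hp)]

lemma IsWall.mem_closure_sameSide {q x : X} (hq : q ∈ W) (hx : x ∉ W) :
    q ∈ closure {y | SameSide W x y} := by
  obtain ⟨t, ht, ht0, htW, hbefore⟩ := hX.exists_first_hit hW.isClosed (y := q) hx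
    ⟨1, by simp, by rwa [hX.geo_one]⟩
  rw [hW.mem_closure_sameSide_iff hX hε hq htW, Metric.mem_closure_iff]
  intro δ hδ
  have hev := eventually_dist_lt (hX.continuousOn_geo_param x q) ht (p := geo x q t) (ε := δ)
    (by rwa [dist_self])
  rw [eventually_nhdsWithin_iff, Metric.eventually_nhds_iff] at hev
  obtain ⟨η, hη, hball⟩ := hev
  have hm : 0 < min (η / 2) t := lt_min (by linarith) ht0
  have hm1 := min_le_left (η / 2) t
  have hm2 := min_le_right (η / 2) t
  have hs : t - min (η / 2) t ∈ Ico 0 t := ⟨by linarith, by linarith⟩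
  refine ⟨geo x q (t - min (η / 2) t), hbefore _ hs, hball ?_ ⟨hs.1, hs.2.le.trans ht.2⟩⟩
  rw [Real.dist_eq, sub_sub_cancel_left, abs_neg, abs_of_pos hm]
  linarith

/-- A wall has at most two sides. -/
lemma IsWall.sameSide_or {x y z : X} (hx : x ∉ W) (hy : y ∉ W) (hz : z ∉ W)
    (hxy : ¬ SameSide W x y) : SameSide W x z ∨ SameSide W y z := by
  obtain ⟨q, hq⟩ := hW.nonempty
  obtain ⟨r, a, b, M, hr, hqM, hE, hloc⟩ := hW.exists_local hX hε hq
  have hr0 := hr.pos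
  -- Every side accumulates at `q`, so each of the three points has a representative near `q` with
  -- nonzero height. There are only two signs, and equal signs mean equal sides.
  have rep : ∀ x ∉ W, ∃ x', dist q x' < r / 16 ∧ SameSide W x x' ∧ hgt a b x' ≠ 0 := by
    intro x hx
    obtain ⟨x', h1, h2⟩ := mem_closure_iff.1 (hW.mem_closure_sameSide hX hε hq hx) _
      Metric.isOpen_ball (Metric.mem_ball_self (show 0 < r / 16 by linarith))
    have h1 := Metric.mem_ball'.1 h1
    exact ⟨x', h1, h2, fun h => SameSide.right hX h2 ((hloc x' (by linarith)).2 h)⟩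
  obtain ⟨x', dx, sx, nx⟩ := rep x hx
  obtain ⟨y', dy, sy, ny⟩ := rep y hy
  obtain ⟨z', dz, sz, nz⟩ := rep z hz
  have tr := @IsWall.sameSide_trans X _ _ S W hX ε hε hW
  have glue : ∀ {x x' y y'}, SameSide W x x' → SameSide W y y' → dist q x' < r / 16 →
      dist q y' < r / 16 → 0 < hgt a b x' * hgt a b y' → SameSide W x y := by
    intro x x' y y' h1 h2 d1 d2 h
    exact tr (tr h1 (sameSide_of_mul_hgt_pos hX hE hqM hr hloc d1 d2 h)) (h2.symm hX)
  by_cases h1 : 0 < hgt a b x' * hgt a b z'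
  · exact Or.inl (glue sx sz dx dz h1)
  by_cases h2 : 0 < hgt a b y' * hgt a b z'
  · exact Or.inr (glue sy sz dy dz h2)
  refine absurd (glue sx sy dx dy ?_) hxy
  have h1' := lt_of_le_of_ne (not_lt.1 h1) (mul_ne_zero nx nz)
  have h2' := lt_of_le_of_ne (not_lt.1 h2) (mul_ne_zero ny nz)
  have h3 := mul_pos_of_neg_of_neg h1' h2'
  have h4 : 0 < hgt a b z' ^ 2 := by positivity
  by_contra hcon
  nlinarith

lemma IsWall.geoConvex_sameSide (x : X) : GeoConvex {y | SameSide W x y} := by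
  intro y hy z hz t ht
  have h := hW.sameSide_trans hX hε (SameSide.symm hX hy) hz
  exact hW.sameSide_trans hX hε hy (h.geo_left hX ht)

lemma IsWall.connectedComponentIn_compl {x : X} (hx : x ∉ W) :
    connectedComponentIn Wᶜ x = {y | SameSide W x y} := by
  refine Subset.antisymm ?_ ?_
  · refine isPreconnected_connectedComponentIn.subset_left_of_subset_union
      (hW.isOpen_sameSide hX x) (hW.isOpen_not_sameSide hX hε hx) ?_ ?_
      ⟨x, mem_connectedComponentIn hx, SameSide.refl hX hx⟩
    · rw [disjoint_left]
      exact fun y hy hy' => hy'.2 hy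
    · intro y hy
      have hyW : y ∉ W := connectedComponentIn_subset _ _ hy
      by_cases h : SameSide W x y
      · exact Or.inl h
      · exact Or.inr ⟨hyW, h⟩
  · exact (hX.isPreconnected_of_geoConvex (hW.geoConvex_sameSide hX hε x)).subset_connectedComponentIn
      (SameSide.refl hX hx) fun y hy => SameSide.right hX hy

lemma IsWall.closure_sameSide {x : X} (hx : x ∉ W) :
    closure {y | SameSide W x y} = W ∪ {y | SameSide W x y} := by
  refine Subset.antisymm (closure_minimal subset_union_right ?_)
    (union_subset (fun q hq => hW.mem_closure_sameSide hX hε hq hx) subset_closure)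
  have : (W ∪ {y | SameSide W x y}) = {y | y ∉ W ∧ ¬ SameSide W x y}ᶜ := by
    ext y; simp only [mem_union, mem_ofPred_eq, mem_compl_iff]; tauto
  rw [this]
  exact (hW.isOpen_not_sameSide hX hε hx).isClosed_compl

/-- If the geodesic left the closed side at some point off `W`, both of its parts on either side of
this point would meet `W`, and convexity of `W` would put the point on `W`. -/
lemma IsWall.geoConvex_union (x : X) : GeoConvex (W ∪ {y | SameSide W x y}) := by
  have hconv := hW.geoConvex hX hε
  have tr := @IsWall.sameSide_trans X _ _ S W hX ε hε hW
  intro y hy z hz t ht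
  by_contra hcon
  rw [mem_union, not_or] at hcon
  obtain ⟨h1, h2⟩ := hcon
  -- each of the two subsegments from `geo y z t` meets the wall
  have hit : ∀ w ∈ W ∪ {y | SameSide W x y}, ∃ s ∈ Icc (0 : ℝ) 1, geo w (geo y z t) s ∈ W := by
    intro w hw
    rcases hw with hw | hw
    · exact ⟨0, by simp, by rwa [hX.geo_zero]⟩
    · by_contra! hno
      exact h2 (tr hw hno)
  obtain ⟨s, hs, hsW⟩ := hit y hy
  obtain ⟨s', hs', hsW'⟩ := hit z hz
  have i0 : (0 : ℝ) ∈ Icc (0 : ℝ) 1 := by simp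
  have i1 : (1 : ℝ) ∈ Icc (0 : ℝ) 1 := by simp
  have e1 := hX.geo_sub y z i0 ht hs
  have e2 := hX.geo_sub y z i1 ht hs'
  rw [hX.geo_zero] at e1
  rw [hX.geo_one] at e2
  rw [e1] at hsW
  rw [e2] at hsW'
  obtain ⟨s0, s1⟩ := hs
  obtain ⟨s0', s1'⟩ := hs'
  obtain ⟨t0, t1⟩ := ht
  set u := (1 - s) * 0 + s * t with hu
  set v := (1 - s') * 1 + s' * t with hv
  have hut : u ≤ t := by nlinarith
  have htv : t ≤ v := by nlinarith
  have hu0 : u ∈ Icc (0 : ℝ) 1 := ⟨by rw [hu]; nlinarith, by linarith⟩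
  have hv0 : v ∈ Icc (0 : ℝ) 1 := ⟨by linarith, by rw [hv]; nlinarith⟩
  rcases hut.eq_or_lt with h | h
  · exact h1 (h ▸ hsW)
  have hτ : (t - u) / (v - u) ∈ Icc (0 : ℝ) 1 :=
    ⟨div_nonneg (by linarith) (by linarith), div_le_one_of_le₀ (by linarith) (by linarith)⟩
  have := hconv _ hsW _ hsW' _ hτ
  rw [hX.geo_sub y z hu0 hv0 hτ] at this
  have e : (1 - (t - u) / (v - u)) * u + (t - u) / (v - u) * v = t := by
    have : v - u ≠ 0 := by linarith
    field_simp
    ring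
  rw [e] at this
  exact h1 this

omit hε hW in
/-- Points of a cube that misses the wall are on the same side. -/
lemma sameSide_of_cube {D : Set X} (hD : D ∈ S.cubes) (h : ¬ (D ∩ W).Nonempty) {x y : X}
    (hx : x ∈ D) (hy : y ∈ D) : SameSide W x y :=
  fun _ ht hW => h ⟨_, (hX.coord_geo S hD hx hy ht).1, hW⟩

omit hε hW in
/-- Points of a cube with the same position relative to `1/2` in the direction of the wall are on
the same side. -/
lemma sameSide_of_coord {D : Set X} (hD : D ∈ S.cubes) {i} (h : D ∩ W = mid D i) {x y : X}
    (hx : x ∈ D) (hy : y ∈ D) (hxy : 0 < (coord D x i - 1 / 2) * (coord D y i - 1 / 2)) :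
    SameSide W x y := by
  intro t ht hmem
  obtain ⟨h1, h2⟩ := hX.coord_geo S hD hx hy ht
  have h3 := (h.subset ⟨h1, hmem⟩).2
  rw [h2] at h3
  obtain ⟨t0, t1⟩ := ht
  have h4 : (1 - t) * (coord D x i - 1 / 2) + t * (coord D y i - 1 / 2) = 0 := by linarith
  rcases mul_pos_iff.1 hxy with ⟨h5, h6⟩ | ⟨h5, h6⟩ <;> rcases t0.eq_or_lt with h | h
  · rw [← h] at h4; linarith
  · nlinarith [mul_pos h h6]
  · rw [← h] at h4; linarith
  · nlinarith [mul_neg_of_pos_of_neg h h6]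

omit hε hW in
lemma not_sameSide_of_coord {D : Set X} (hD : D ∈ S.cubes) {i} (h : D ∩ W = mid D i) {x y : X}
    (hx : x ∈ D) (hy : y ∈ D) (hxy : (coord D x i - 1 / 2) * (coord D y i - 1 / 2) < 0) :
    ¬ SameSide W x y := by
  intro hs
  set α := coord D x i - 1 / 2 with hα
  set β := coord D y i - 1 / 2 with hβ
  have hne : α - β ≠ 0 := fun h => by
    have : α = β := by linarith
    rw [this] at hxy
    nlinarith [mul_self_nonneg β]
  have ht : α / (α - β) ∈ Icc (0 : ℝ) 1 := by
    rcases mul_neg_iff.1 hxy with ⟨h5, h6⟩ | ⟨h5, h6⟩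
    · exact ⟨div_nonneg h5.le (by linarith), div_le_one_of_le₀ (by linarith) (by linarith)⟩
    · rw [← neg_div_neg_eq]
      exact ⟨div_nonneg (by linarith) (by linarith), div_le_one_of_le₀ (by linarith) (by linarith)⟩
  obtain ⟨h1, h2⟩ := hX.coord_geo S hD hx hy ht
  refine hs _ ht (h.superset ⟨h1, ?_⟩).2
  rw [h2]
  have e1 : coord D x i = α + 1 / 2 := by linarith
  have e2 : coord D y i = β + 1 / 2 := by linarith
  rw [e1, e2]
  field_simp
  ring

end CubeComplex

namespace CubeComplex

variable {X : Type u} [MetricSpace X] [Nonempty X] {S : CubeComplex X}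

/-! ### Edges and the walls dual to them -/

lemma IsEdge.subsingleton {e : Set X} (he : S.IsEdge e) : Subsingleton (Fin (cubeDim e)) := by
  obtain ⟨f, hf⟩ := he.2
  rw [(S.isChart he.1).dim_eq hf]
  infer_instance

lemma vertex_notMem_wall {W : Set X} (hW : S.IsWall W) {x : X} (hx : S.IsVertex x) : x ∉ W := by
  intro hxW
  obtain ⟨M, hM, hxM, -⟩ := hW.exists_midcube hxW
  obtain ⟨C, hC, i, rfl⟩ := S.exists_eq_mid hM
  have h2 := hxM.2
  rcases S.coord_vertex hC hxM.1 hx i with h | h <;> rw [h] at h2 <;> norm_num at h2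

/-- The edge of `D` at the vertex `x` in the direction of the coordinate `i`. -/
lemma exists_joins {D : Set X} (hD : D ∈ S.cubes) {x : X} (hx : x ∈ D) (hv : S.IsVertex x) (i) :
    ∃ e y, S.Joins e x y ∧ y ∈ D ∧ coord D y i = 1 - coord D x i ∧
      (∀ k ≠ i, coord D y k = coord D x k) ∧ ∀ W : S.Wall, mid D i ⊆ W.1 → S.Dual e W := by
  classical
  set σ : Fin (cubeDim D) → Option Bool := fun k =>
    if k = i then none else some (decide (coord D x k = 1)) with hσ
  have hmem : ∀ z, z ∈ faceOf D σ ↔ z ∈ D ∧ ∀ k ≠ i, coord D z k = coord D x k := by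
    intro z
    refine and_congr_right fun hz => ?_
    constructor
    · intro h k hk
      rw [h k (decide (coord D x k = 1)) (by simp [hσ, hk])]
      rcases S.coord_vertex hD hx hv k with h | h <;> simp [h]
    · intro h k b hb
      simp only [hσ] at hb
      split_ifs at hb with hk
      obtain rfl := Option.some_injective _ hb
      rw [h k hk]
      rcases S.coord_vertex hD hx hv k with h | h <;> simp [h]
  have hmove : ∀ v ∈ Icc (0 : ℝ) 1, move D x i v ∈ faceOf D σ := fun v hv =>
    (hmem _).2 ⟨S.move_mem hD hx i hv, fun k hk => S.coord_move_of_ne hD hx hv hk⟩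
  have hE : S.IsEdge (faceOf D σ) := by
    refine ⟨S.faceOf_mem hD σ, fun t => move D x i (t 0), ?_, fun s hs t ht => ?_⟩
    · refine Subset.antisymm ?_ fun z hz => ?_
      · rintro _ ⟨t, ht, rfl⟩
        exact hmove _ (ht 0)
      · have hz' := (hmem z).1 hz
        have hI : coord D z i ∈ Icc (0 : ℝ) 1 := ⟨S.coord_nonneg hD hz'.1 i, S.coord_le_one hD hz'.1 i⟩
        refine ⟨WithLp.toLp 2 fun _ => coord D z i, fun _ => hI, ?_⟩
        refine S.coord_ext hD (S.move_mem hD hx i hI) hz'.1 fun k => ?_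
        by_cases hk : k = i
        · subst hk; exact S.coord_move_self hD hx _ hI
        · rw [hz'.2 k hk]; exact S.coord_move_of_ne hD hx hI hk
    · have h1 := S.move_mem hD hx i (hs 0)
      have h2 := S.move_mem hD hx i (ht 0)
      rw [← abs_of_nonneg (dist_nonneg (x := move D x i (s 0))),
        ← abs_of_nonneg (dist_nonneg (x := s)), ← sq_eq_sq_iff_abs_eq_abs,
        S.dist_sq_coord hD h1 h2, euclidean_dist_sq, Finset.sum_eq_single i, Fin.sum_univ_one,
        S.coord_move_self hD hx i (hs 0), S.coord_move_self hD hx i (ht 0)]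
      · intro k _ hk
        rw [S.coord_move_of_ne hD hx (hs 0) hk, S.coord_move_of_ne hD hx (ht 0) hk]; simp
      · simp
  have hI : 1 - coord D x i ∈ Icc (0 : ℝ) 1 :=
    ⟨by linarith [S.coord_le_one hD hx i], by linarith [S.coord_nonneg hD hx i]⟩
  have hy := S.move_mem hD hx i hI
  have hyi := S.coord_move_self hD hx i hI
  refine ⟨faceOf D σ, move D x i (1 - coord D x i), ⟨hE, hv, ?_, ?_, (hmem x).2 ⟨hx, fun _ _ => rfl⟩,
    hmove _ hI⟩, hy, hyi, fun k hk => S.coord_move_of_ne hD hx hI hk, fun W hW => ⟨hE, ?_⟩⟩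
  · refine S.isVertex_of_coord hD hy fun k => ?_
    by_cases hk : k = i
    · subst hk
      rw [hyi]
      rcases S.coord_vertex hD hx hv k with h | h <;> simp [h]
    · rw [S.coord_move_of_ne hD hx hI hk]
      exact S.coord_vertex hD hx hv k
  · intro hxy
    rw [← hxy] at hyi
    rcases S.coord_vertex hD hx hv i with h | h <;> rw [h] at hyi <;> norm_num at hyi
  · have h12 : (1 / 2 : ℝ) ∈ Icc (0 : ℝ) 1 := by norm_num
    exact ⟨move D x i (1 / 2), hmove _ h12,
      hW ⟨S.move_mem hD hx i h12, S.coord_move_self hD hx i h12⟩⟩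

variable (hX : IsCAT0 X) {ε : ℝ} (hε : S.IsUniformScale ε)
include hX hε

lemma Dual.wall_eq {e : Set X} {W W' : S.Wall} (h : S.Dual e W) (h' : S.Dual e W') : W = W' := by
  have := h.1.subsingleton
  obtain ⟨i, hi⟩ := IsWall.inter_cube hX hε W.2 h.1.1 h.2
  obtain ⟨k, hk⟩ := IsWall.inter_cube hX hε W'.2 h.1.1 h'.2
  obtain rfl := Subsingleton.elim i k
  exact Subtype.ext (IsWall.eq_of_subset W.2 W'.2 (S.mid_mem h.1.1 i) (fun z hz => (hi.superset hz).2)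
    fun z hz => (hk.superset hz).2)

lemma Joins.not_sameSide {e : Set X} {x y : X} (h : S.Joins e x y) {W : S.Wall} (hW : S.Dual e W) :
    ¬ SameSide W.1 x y := by
  obtain ⟨he, hx, hy, hne, hxe, hye⟩ := h
  have := he.subsingleton
  obtain ⟨i, hi⟩ := IsWall.inter_cube hX hε W.2 he.1 hW.2
  refine not_sameSide_of_coord hX he.1 hi hxe hye ?_
  have hne' : coord e x i ≠ coord e y i := fun h => hne (S.coord_ext he.1 hxe hye fun k => by
    rw [Subsingleton.elim k i, h])
  rcases S.coord_vertex he.1 hxe hx i with h | h <;> rcases S.coord_vertex he.1 hye hy i with h' | h'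
  · exact absurd (h.trans h'.symm) hne'
  · rw [h, h']; norm_num
  · rw [h, h']; norm_num
  · exact absurd (h.trans h'.symm) hne'

lemma IsMidpoint.mem_wall {e : Set X} {x : X} (h : S.IsMidpoint e x) {W : S.Wall} (hW : S.Dual e W) :
    x ∈ W.1 := by
  have := h.1.subsingleton
  obtain ⟨k, hk⟩ := (S.isMidcube_iff h.1.1).1 h.2
  obtain ⟨i, hi⟩ := IsWall.inter_cube hX hε W.2 h.1.1 hW.2
  obtain rfl := Subsingleton.elim i k
  exact (hi.superset (hk.subset rfl)).2

omit hX hε in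
lemma IsMidpoint.mem_edge {e : Set X} {x : X} (h : S.IsMidpoint e x) : x ∈ e := by
  obtain ⟨k, hk⟩ := (S.isMidcube_iff h.1.1).1 h.2
  have : x ∈ mid e k := hk.subset rfl
  exact this.1

omit hX hε in
lemma IsMidpoint.dual {e : Set X} {x : X} (h : S.IsMidpoint e x) {W : S.Wall} (hW : x ∈ W.1) :
    S.Dual e W := ⟨h.1, x, h.mem_edge, hW⟩

/-! ### Intersections of half-spaces -/

lemma IsHalfSpace.exists_eq {B : Set X} (hB : S.IsHalfSpace B) :
    ∃ W : S.Wall, ∃ x ∉ W.1, B = W.1 ∪ {y | SameSide W.1 x y} := by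
  obtain ⟨W, x, hx, rfl⟩ := hB
  exact ⟨W, x, hx, by rw [IsWall.connectedComponentIn_compl hX hε W.2 hx,
    IsWall.closure_sameSide hX hε W.2 hx]⟩

variable {Z : Set X} (hZ : ∃ A : Set (Set X), (∀ B ∈ A, S.IsHalfSpace B) ∧ Z = ⋂₀ A)
include hZ

lemma geoConvex_of_halfSpaces : GeoConvex Z := by
  obtain ⟨A, hA, rfl⟩ := hZ
  refine GeoConvex.sInter fun B hB => ?_
  obtain ⟨W, x, hx, rfl⟩ := (hA B hB).exists_eq hX hε
  exact IsWall.geoConvex_union hX hε W.2 x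

omit hX hε [Nonempty X] in
lemma isClosed_of_halfSpaces : IsClosed Z := by
  obtain ⟨A, hA, rfl⟩ := hZ
  refine isClosed_sInter fun B hB => ?_
  obtain ⟨W, x, hx, rfl⟩ := hA B hB
  exact isClosed_closure

/-- A point that no wall separates from `Z` belongs to `Z`. -/
lemma mem_of_forall_wall {y : X} (h : ∀ W : S.Wall, y ∈ W.1 ∨ ∃ z ∈ Z, SameSide W.1 z y) :
    y ∈ Z := by
  obtain ⟨A, hA, rfl⟩ := hZ
  intro B hB
  obtain ⟨W, x, hx, hBW⟩ := (hA B hB).exists_eq hX hε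
  rw [hBW]
  rcases h W with h | ⟨z, hz, hzy⟩
  · exact Or.inl h
  · have := hz B hB
    rw [hBW] at this
    rcases this with h' | h'
    · exact absurd h' (hzy.left hX)
    · exact Or.inr (IsWall.sameSide_trans hX hε W.2 h' hzy)

/-- `Z` lies on one side of each of its boundary walls. -/
lemma sameSide_of_isBoundaryWall {W : S.Wall} (hW : IsBoundaryWall Z W) {z z' : X} (hz : z ∈ Z)
    (hz' : z' ∈ Z) (h : z ∉ W.1) (h' : z' ∉ W.1) : SameSide W.1 z z' := by
  obtain ⟨e, he, x, y, hxy, hx, hy⟩ := hW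
  by_contra hcon
  -- With points of `Z` on both sides of `W`, no wall separates `y` from `Z`: a wall other than the
  -- one dual to `e` has `x` and `y` on the same side.
  refine hy (mem_of_forall_wall hX hε hZ fun W' => Or.inr ?_)
  by_cases hW' : (e ∩ W'.1).Nonempty
  · obtain rfl := he.wall_eq hX hε (⟨he.1, hW'⟩ : S.Dual e W')
    rcases IsWall.sameSide_or hX hε W.2 h h' (vertex_notMem_wall W.2 hxy.2.2.1) hcon with h | h
    · exact ⟨z, hz, h⟩
    · exact ⟨z', hz', h⟩
  · exact ⟨x, hx, sameSide_of_cube hX he.1.1 hW' hxy.2.2.2.2.1 hxy.2.2.2.2.2⟩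

/-- A cube that meets `Z` has a vertex in `Z`, unless `Z` contains no vertices at all. -/
lemma exists_vertex_mem {v : X} (hv : S.IsVertex v) (hvZ : v ∈ Z) {D : Set X} (hD : D ∈ S.cubes)
    {p : X} (hp : p ∈ D) (hpZ : p ∈ Z) : ∃ x ∈ D, S.IsVertex x ∧ x ∈ Z := by
  classical
  choose w hw hw' using fun i => S.exists_wall (S.mid_mem hD i)
  have v0 : (0 : ℝ) ∈ Icc (0 : ℝ) 1 := by simp
  have v1 : (1 : ℝ) ∈ Icc (0 : ℝ) 1 := by simp
  -- Round `p` to the nearest corner; in a coordinate equal to `1/2`, take the side of `v`. Every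
  -- wall then has the corner on the side of `p` or of `v`.
  set β : Fin (cubeDim D) → ℝ := fun i =>
    if coord D p i < 1 / 2 then 0 else if 1 / 2 < coord D p i then 1 else
      if SameSide (w i) v (move D p i 0) then 0 else 1 with hβ
  have hβ' : ∀ i, β i = 0 ∨ β i = 1 := fun i => by simp only [hβ]; split_ifs <;> simp
  obtain ⟨x, hx, hxc⟩ := S.exists_coord_eq hD β fun i => by rcases hβ' i with h | h <;> simp [h]
  refine ⟨x, hx, S.isVertex_of_coord hD hx fun i => by rw [hxc]; exact hβ' i,
    mem_of_forall_wall hX hε hZ fun W => Or.inr ?_⟩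
  by_cases hDW : (D ∩ W.1).Nonempty
  swap
  · exact ⟨p, hpZ, sameSide_of_cube hX hD hDW hp hx⟩
  obtain ⟨i, hi⟩ := IsWall.inter_cube hX hε W.2 hD hDW
  have hWi : w i = W.1 := IsWall.eq_of_subset (hw i) W.2 (S.mid_mem hD i) (hw' i)
    fun z hz => (hi.superset hz).2
  rcases lt_trichotomy (coord D p i) (1 / 2) with hlt | heq | hgt
  · refine ⟨p, hpZ, sameSide_of_coord hX hD hi hp hx ?_⟩
    rw [hxc, show β i = 0 by simp only [hβ, if_pos hlt]]
    linarith
  · have hl := S.move_mem hD hp i v0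
    have hu := S.move_mem hD hp i v1
    have hlc := S.coord_move_self hD hp i v0
    have huc := S.coord_move_self hD hp i v1
    have hvW := vertex_notMem_wall W.2 hv
    by_cases hs : SameSide W.1 v (move D p i 0)
    · refine ⟨v, hvZ, IsWall.sameSide_trans hX hε W.2 hs (sameSide_of_coord hX hD hi hl hx ?_)⟩
      rw [hxc, hlc, show β i = 0 by simp [hβ, heq, hWi, hs]]
      norm_num
    · have hlu : ¬ SameSide W.1 (move D p i 0) (move D p i 1) :=
        not_sameSide_of_coord hX hD hi hl hu (by rw [hlc, huc]; norm_num)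
      have hlW : move D p i 0 ∉ W.1 := fun h => by
        have := (hi.subset ⟨hl, h⟩).2
        rw [hlc] at this; norm_num at this
      have huW : move D p i 1 ∉ W.1 := fun h => by
        have := (hi.subset ⟨hu, h⟩).2
        rw [huc] at this; norm_num at this
      rcases IsWall.sameSide_or hX hε W.2 hlW huW hvW hlu with h | h
      · exact absurd (h.symm hX) hs
      · refine ⟨v, hvZ, IsWall.sameSide_trans hX hε W.2 (h.symm hX)
          (sameSide_of_coord hX hD hi hu hx ?_)⟩
        rw [hxc, huc, show β i = 1 by simp [hβ, heq, hWi, hs]]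
        norm_num
  · refine ⟨p, hpZ, sameSide_of_coord hX hD hi hp hx ?_⟩
    rw [hxc, show β i = 1 by simp only [hβ, if_neg hgt.not_gt, if_pos hgt]]
    nlinarith

/-- Crossing a boundary wall at a vertex in `Z` leads out of `Z`. -/
lemma notMem_of_isBoundaryWall {W : S.Wall} (hW : IsBoundaryWall Z W) {e : Set X} {x y : X}
    (hxy : S.Joins e x y) (he : S.Dual e W) (hx : x ∈ Z) : y ∉ Z := fun hy =>
  hxy.not_sameSide hX hε he (sameSide_of_isBoundaryWall hX hε hZ hW hx hy
    (vertex_notMem_wall W.2 hxy.2.1) (vertex_notMem_wall W.2 hxy.2.2.1))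

omit hX hε hZ [Nonempty X] in
lemma _root_.PortalCovers.mem_portalInterior_iff {W : S.Wall} {p : X} :
    p ∈ portalInterior Z W ↔ p ∈ W.1 ∧ ∃ δ > 0, ∀ y ∈ W.1, dist p y < δ → y ∈ Z := by
  constructor
  · rintro ⟨⟨p, hp⟩, hint, rfl⟩
    refine ⟨hp, ?_⟩
    obtain ⟨δ, hδ, hsub⟩ := Metric.mem_nhds_iff.1 (mem_interior_iff_mem_nhds.1 hint)
    refine ⟨δ, hδ, fun y hy hd => ?_⟩
    have h : (⟨y, hy⟩ : W.1) ∈ Metric.ball (⟨p, hp⟩ : W.1) δ := by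
      rw [Metric.mem_ball']; exact hd
    exact (hsub h).1
  · rintro ⟨hp, δ, hδ, h⟩
    refine ⟨⟨p, hp⟩, mem_interior_iff_mem_nhds.2 (Metric.mem_nhds_iff.2 ⟨δ, hδ, ?_⟩), rfl⟩
    rintro ⟨y, hy⟩ hd
    rw [Metric.mem_ball'] at hd
    exact ⟨h y hy hd, hy⟩

/-- The interior of a portal is the portal minus the other boundary walls. -/
lemma portalInterior_eq {W : S.Wall} (hW : IsBoundaryWall Z W) : portalInterior Z W =
    portal Z W \ ⋃ W' ∈ {W' : S.Wall | IsBoundaryWall Z W' ∧ W' ≠ W}, W'.1 := by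
  obtain ⟨v, hv, hvZ⟩ : ∃ v, S.IsVertex v ∧ v ∈ Z := by
    obtain ⟨e, -, x, y, hxy, hx, -⟩ := hW
    exact ⟨x, hxy.2.1, hx⟩
  ext p
  simp only [mem_portalInterior_iff, mem_sdiff, mem_iUnion, mem_ofPred_eq, exists_prop, not_exists,
    not_and]
  constructor
  · rintro ⟨hpW, δ, hδ, h⟩
    have hpZ : p ∈ Z := h p hpW (by rwa [dist_self])
    refine ⟨⟨hpZ, hpW⟩, fun W' ⟨hbd, hne⟩ hpW' => ?_⟩
    obtain ⟨D, hD, hpD⟩ := S.cover p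
    obtain ⟨i, hi⟩ := IsWall.inter_cube hX hε W.2 hD ⟨p, hpD, hpW⟩
    obtain ⟨k, hk⟩ := IsWall.inter_cube hX hε W'.2 hD ⟨p, hpD, hpW'⟩
    have hik : i ≠ k := by
      rintro rfl
      exact hne (Subtype.ext (IsWall.eq_of_subset W'.2 W.2 (S.mid_mem hD i)
        (fun z hz => (hk.superset hz).2) fun z hz => (hi.superset hz).2))
    have hpi : coord D p i = 1 / 2 := (hi.subset ⟨hpD, hpW⟩).2
    have hpk : coord D p k = 1 / 2 := (hk.subset ⟨hpD, hpW'⟩).2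
    -- Displacing `p` by `η` in both directions across `W'` stays in `W`, and by interiority in `Z`,
    -- although `Z` is on one side of `W'`.
    set η := min (δ / 2) (1 / 2) with hη
    have hη0 : 0 < η := lt_min (by linarith) (by norm_num)
    have hη1 : η < δ := (min_le_left _ _).trans_lt (by linarith)
    have hη2 : η ≤ 1 / 2 := min_le_right _ _
    have I1 : 1 / 2 + η ∈ Icc (0 : ℝ) 1 := ⟨by linarith, by linarith⟩
    have I2 : 1 / 2 - η ∈ Icc (0 : ℝ) 1 := ⟨by linarith, by linarith⟩
    have mem : ∀ s, s ∈ Icc (0 : ℝ) 1 → |1 / 2 - s| < δ → move D p k s ∈ Z := fun s hs hd => by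
      refine h _ (hi.superset ⟨S.move_mem hD hpD k hs, ?_⟩).2 ?_
      · rw [S.coord_move_of_ne hD hpD hs hik, hpi]
      · rwa [S.dist_move hD hpD k hs, hpk]
    have out : ∀ s, s ∈ Icc (0 : ℝ) 1 → s ≠ 1 / 2 → move D p k s ∉ W'.1 := fun s hs hne hmem => by
      have := (hk.subset ⟨S.move_mem hD hpD k hs, hmem⟩).2
      rw [S.coord_move_self hD hpD k hs] at this
      exact hne this
    refine not_sameSide_of_coord hX hD hk (S.move_mem hD hpD k I1) (S.move_mem hD hpD k I2) ?_
      (sameSide_of_isBoundaryWall hX hε hZ hbd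
      (mem _ I1 (by rw [sub_add_cancel_left, abs_neg, abs_of_pos hη0]; exact hη1))
      (mem _ I2 (by rw [sub_sub_cancel, abs_of_pos hη0]; exact hη1))
      (out _ I1 (by linarith)) (out _ I2 (by linarith)))
    rw [S.coord_move_self hD hpD k I1, S.coord_move_self hD hpD k I2]
    nlinarith
  · rintro ⟨⟨hpZ, hpW⟩, hout⟩
    obtain ⟨r, hr⟩ := S.exists_isGood p
    refine ⟨hpW, r, hr.pos, fun y hy hd => mem_of_forall_wall hX hε hZ fun W' => ?_⟩
    by_cases hWW : W' = W
    · subst hWW; exact Or.inl hy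
    by_cases hyW' : y ∈ W'.1
    · exact Or.inl hyW'
    refine Or.inr ?_
    by_cases hpW' : p ∈ W'.1
    -- An edge dual to `W'` at a vertex of `Z` near `p` either crosses out of `Z`, so that `W'` is
    -- an excluded boundary wall, or shows that `Z` has points on both sides of `W'`.
    · by_contra! hcon
      obtain ⟨D, hD, hpD⟩ := S.cover p
      obtain ⟨x, hx, hxv, hxZ⟩ := exists_vertex_mem hX hε hZ hv hvZ hD hpD hpZ
      obtain ⟨k, hk⟩ := IsWall.inter_cube hX hε W'.2 hD ⟨p, hpD, hpW'⟩
      obtain ⟨e, x', hxx', -, -, -, hdual⟩ := exists_joins hD hx hxv k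
      have hdual' := hdual W' fun z hz => (hk.superset hz).2
      by_cases hx'Z : x' ∈ Z
      · have hn := hxx'.not_sameSide hX hε hdual'
        rcases IsWall.sameSide_or hX hε W'.2 (vertex_notMem_wall W'.2 hxv)
          (vertex_notMem_wall W'.2 hxx'.2.2.1) hyW' hn with h | h
        · exact hcon x hxZ h
        · exact hcon x' hx'Z h
      · exact hout W' ⟨⟨e, hdual', x, x', hxx', hxZ, hx'Z⟩, hWW⟩ hpW'
    · refine ⟨p, hpZ, fun t ht hmem => hpW' (hr.mem_wall W'.2 hmem ?_)⟩
      rw [hX.dist_left_geo p y ht]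
      exact (mul_le_of_le_one_left dist_nonneg ht.2).trans_lt hd

end CubeComplex

/-! ### Coverings onto components of subsets of a quotient -/

section Covering

variable {X : Type u} [MetricSpace X] {G : Type v} [Group G] [MulAction G X] {K : Subgroup G}

lemma quotMap_eq_iff {x y : X} : quotMap K x = quotMap K y ↔ ∃ k ∈ K, k • y = x := by
  refine Quotient.eq.trans ?_
  constructor
  · rintro ⟨k, hk⟩
    exact ⟨k, k.2, hk⟩
  · rintro ⟨k, hk, h⟩
    exact ⟨⟨k, hk⟩, h⟩

lemma quotMap_smul {k : G} (hk : k ∈ K) (x : X) : quotMap K (k • x) = quotMap K x :=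
  quotMap_eq_iff.2 ⟨k, hk, rfl⟩

lemma continuous_quotMap : Continuous (quotMap K : X → QuotSpace K X) := continuous_quotient_mk'

lemma isOpenMap_quotMap [IsIsometricSMul G X] : IsOpenMap (quotMap K : X → QuotSpace K X) := by
  have : ContinuousConstSMul K X := ⟨fun k => (isometry_smul X (k : G)).continuous⟩
  exact isOpenMap_quotient_mk'_mul

variable [IsIsometricSMul G X] {A : Set (QuotSpace K X)} {P : Set X} {o : X}

/-- A connected set `P` that is open in the preimage of `A`, and whose translates are locally
closed-open there, maps onto a component of `A`. -/
lemma image_eq_connectedComponentIn (ho : o ∈ P) (hconn : IsPreconnected P)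
    (hPA : ∀ p ∈ P, quotMap K p ∈ A)
    (hopen : ∀ p ∈ P, ∃ δ > 0, ∀ y, quotMap K y ∈ A → dist p y < δ → y ∈ P)
    (hclosed : ∀ y, quotMap K y ∈ A → ∃ δ > 0, ∀ k ∈ K, ∀ z ∈ P, dist y (k • z) < δ →
      ∃ z' ∈ P, k • z' = y) :
    quotMap K '' P = connectedComponentIn A (quotMap K o) := by
  choose! δ hδ hδ' using hopen
  choose! η hη hη' using hclosed
  refine Subset.antisymm ?_ ?_
  · exact (hconn.image _ continuous_quotMap.continuousOn).subset_connectedComponentIn ⟨o, ho, rfl⟩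
      (by rintro _ ⟨p, hp, rfl⟩; exact hPA p hp)
  -- Two open sets that separate the image of `P` from the rest of `A`; a connected subset of `A`
  -- that meets the image lies in it.
  set O := quotMap K '' ⋃ p ∈ P, Metric.ball p (δ p)
  set O' := quotMap K '' ⋃ y ∈ {y | quotMap K y ∈ A ∧ quotMap K y ∉ quotMap K '' P},
    Metric.ball y (η y)
  have hO : IsOpen O := isOpenMap_quotMap _ (isOpen_biUnion fun _ _ => Metric.isOpen_ball)
  have hO' : IsOpen O' := isOpenMap_quotMap _ (isOpen_biUnion fun _ _ => Metric.isOpen_ball)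
  have hOA : ∀ z ∈ O, z ∈ A → z ∈ quotMap K '' P := by
    rintro _ ⟨y, hy, rfl⟩ hA
    obtain ⟨p, hp, hyp⟩ := mem_iUnion₂.1 hy
    exact ⟨y, hδ' p hp y hA (Metric.mem_ball'.1 hyp), rfl⟩
  have hOA' : ∀ z ∈ O', z ∉ quotMap K '' P := by
    rintro _ ⟨z, hz, rfl⟩ ⟨p, hp, hpz⟩
    obtain ⟨y, ⟨hyA, hyP⟩, hzy⟩ := mem_iUnion₂.1 hz
    obtain ⟨k, hk, rfl⟩ := quotMap_eq_iff.1 hpz.symm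
    obtain ⟨z', hz', rfl⟩ := hη' y hyA k hk p hp (Metric.mem_ball'.1 hzy)
    exact hyP ⟨z', hz', (quotMap_smul hk z').symm⟩
  have hT := connectedComponentIn_subset A (quotMap K o)
  have hcover : connectedComponentIn A (quotMap K o) ⊆ O ∪ O' := by
    intro z hz
    have hzA := hT hz
    by_cases hzP : z ∈ quotMap K '' P
    · obtain ⟨p, hp, rfl⟩ := hzP
      exact Or.inl ⟨p, mem_iUnion₂.2 ⟨p, hp, Metric.mem_ball_self (hδ p hp)⟩, rfl⟩
    · obtain ⟨y, rfl⟩ := Quotient.exists_rep z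
      exact Or.inr ⟨y, mem_iUnion₂.2 ⟨y, ⟨hzA, hzP⟩, Metric.mem_ball_self (hη y hzA)⟩, rfl⟩
  rcases isPreconnected_iff_subset_of_disjoint.1 isPreconnected_connectedComponentIn O O' hO hO'
    hcover (eq_empty_of_forall_notMem fun z ⟨hz, hzO, hzO'⟩ => hOA' z hzO' (hOA z hzO (hT hz)))
    with h | h
  · exact fun z hz => hOA z (h hz) (hT hz)
  · exact absurd ⟨o, ho, rfl⟩ (hOA' _ (h (mem_connectedComponentIn (hPA o ho))))

/-- Under the hypotheses of `image_eq_connectedComponentIn`, if the group acts freely and properly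
and a group element that maps some point of `P` into `P` preserves `P`, then the quotient map
restricts to a covering of the component, and the elements preserving `P` are its deck
transformations. -/
lemma exists_covering (ho : o ∈ P) (hconn : IsPreconnected P)
    (hPA : ∀ p ∈ P, quotMap K p ∈ A)
    (hopen : ∀ p ∈ P, ∃ δ > 0, ∀ y, quotMap K y ∈ A → dist p y < δ → y ∈ P)
    (hclosed : ∀ y, quotMap K y ∈ A → ∃ δ > 0, ∀ k ∈ K, ∀ z ∈ P, dist y (k • z) < δ →
      ∃ z' ∈ P, k • z' = y)
    (hpres : ∀ k ∈ K, ∀ p ∈ P, k • p ∈ P → ∀ q ∈ P, k • q ∈ P)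
    (hdisj : ∀ x : X, ∃ δ > 0, ∀ k ∈ K, ∀ y, dist x y < δ → dist x (k • y) < δ → k = 1) :
    ∃ f : P → connectedComponentIn A (quotMap K o),
      (∀ p, (f p : QuotSpace K X) = quotMap K (p : X)) ∧ IsCoveringMap f ∧ Function.Surjective f ∧
      ∃ KP : Subgroup G, (KP : Set G) = {g | g ∈ K ∧ g • o ∈ P} ∧
        ∃ Φ : KP ≃* deckGroup f, ∀ (g : KP) (p : P),
          (((Φ g : P ≃ₜ P) p : P) : X) = (g : G) • (p : X) := by
  have himage := image_eq_connectedComponentIn ho hconn hPA hopen hclosed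
  set f : P → connectedComponentIn A (quotMap K o) := fun p =>
    ⟨quotMap K (p : X), himage.subset ⟨p, p.2, rfl⟩⟩ with hf
  have hcont : Continuous f := (continuous_quotMap.comp continuous_subtype_val).subtype_mk _
  have hsurj : Function.Surjective f := by
    rintro ⟨z, hz⟩
    obtain ⟨p, hp, rfl⟩ := himage.superset hz
    exact ⟨⟨p, hp⟩, rfl⟩
  have hopenMap : IsOpenMap f := by
    rw [isOpenMap_iff_nhds_le]
    intro p s hs
    obtain ⟨δ, hδ, hδ'⟩ := hopen p p.2
    obtain ⟨η, hη, hη'⟩ := Metric.mem_nhds_iff.1 (Filter.mem_map.1 hs)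
    have hO : IsOpen (quotMap K '' Metric.ball (p : X) (min δ η)) :=
      isOpenMap_quotMap _ Metric.isOpen_ball
    refine Filter.mem_of_superset ((hO.preimage continuous_subtype_val).mem_nhds
      ⟨p, Metric.mem_ball_self (lt_min hδ hη), rfl⟩) ?_
    rintro ⟨z, hz⟩ ⟨y, hy, hyz⟩
    have hyz : quotMap K y = z := hyz
    subst hyz
    rw [Metric.mem_ball'] at hy
    have hyP := hδ' y (connectedComponentIn_subset _ _ hz) (hy.trans_le (min_le_left _ _))
    have hball : (⟨y, hyP⟩ : P) ∈ Metric.ball p η := by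
      rw [Metric.mem_ball']; exact hy.trans_le (min_le_right _ _)
    exact hη' hball
  let KP : Subgroup G :=
    { carrier := {g | g ∈ K ∧ g • o ∈ P}
      mul_mem' := fun {g h} hg hh => ⟨K.mul_mem hg.1 hh.1, by
        rw [mul_smul]; exact hpres g hg.1 o ho hg.2 _ hh.2⟩
      one_mem' := ⟨K.one_mem, by rwa [one_smul]⟩
      inv_mem' := fun {g} hg => ⟨K.inv_mem hg.1,
        hpres g⁻¹ (K.inv_mem hg.1) (g • o) hg.2 (by rwa [inv_smul_smul]) o ho⟩ }
  have hKP : ∀ (g : KP) (p : P), (g : G) • (p : X) ∈ P := fun g p =>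
    hpres g g.2.1 o ho g.2.2 p p.2
  let _ : MulAction KP P :=
    { smul := fun g p => ⟨(g : G) • (p : X), hKP g p⟩
      one_smul := fun p => Subtype.ext (one_smul G (p : X))
      mul_smul := fun g h p => Subtype.ext (mul_smul (g : G) (h : G) (p : X)) }
  have coe_smul : ∀ (g : KP) (p : P), ((g • p : P) : X) = (g : G) • (p : X) := fun _ _ => rfl
  have : ContinuousConstSMul KP P :=
    ⟨fun g => ((continuous_const_smul (g : G)).comp continuous_subtype_val).subtype_mk _⟩
  have horbit : ∀ {p q : P}, f p = f q ↔ p ∈ MulAction.orbit KP q := by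
    intro p q
    constructor
    · intro h
      obtain ⟨k, hk, hkq⟩ := quotMap_eq_iff.1 (congrArg Subtype.val h)
      exact ⟨⟨k, hk, hpres k hk q q.2 (hkq ▸ p.2) o ho⟩, Subtype.ext hkq⟩
    · rintro ⟨g, rfl⟩
      exact Subtype.ext (quotMap_smul g.2.1 (q : X))
  have hqc : IsQuotientCoveringMap f KP :=
    { hopenMap.isQuotientMap hcont hsurj with
      continuous_const_smul := continuous_const_smul
      apply_eq_iff_mem_orbit := horbit
      disjoint := fun p => by
        obtain ⟨δ, hδ, h⟩ := hdisj p
        refine ⟨Metric.ball p δ, Metric.ball_mem_nhds p hδ, ?_⟩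
        rintro g ⟨_, ⟨q, hq, rfl⟩, hq'⟩
        exact Subtype.ext (h g g.2.1 q (Metric.mem_ball'.1 hq) (Metric.mem_ball'.1 hq')) }
  have hcov := hqc.isCoveringMap
  have : PreconnectedSpace P := Subtype.preconnectedSpace hconn
  let Ψ : KP →* deckGroup f :=
    { toFun := fun g => ⟨Homeomorph.smul g, fun p => hqc.map_smul g⟩
      map_one' := Subtype.ext (Homeomorph.ext fun p => one_smul KP p)
      map_mul' := fun g h => Subtype.ext (Homeomorph.ext fun p => mul_smul g h p) }
  have hΨ : Function.Bijective Ψ := by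
    constructor
    · intro g h hgh
      have := hqc.isCancelSMul
      have h2 : g • (⟨o, ho⟩ : P) = h • (⟨o, ho⟩ : P) :=
        congrArg (fun T : deckGroup f => (T : P ≃ₜ P) ⟨o, ho⟩) hgh
      exact IsCancelSMul.right_cancel _ _ _ h2
    -- Some `g` agrees with `T` at `o`; two lifts of `f` on the connected space `P` that agree at
    -- one point are equal.
    · rintro ⟨T, hT⟩
      obtain ⟨g, hg⟩ := horbit.1 (hT ⟨o, ho⟩)
      refine ⟨g, Subtype.ext (Homeomorph.ext fun p => ?_)⟩
      exact congrFun (hcov.eq_of_comp_eq (g₁ := fun p : P => g • p) (g₂ := T)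
        (continuous_const_smul g) T.continuous
        (funext fun p => (hqc.map_smul g).trans (hT p).symm) ⟨o, ho⟩ hg) p
  exact ⟨f, fun _ => rfl, hcov, hsurj, KP, rfl, MulEquiv.ofBijective Ψ hΨ, fun _ _ => rfl⟩

end Covering

open CubeComplex

/-! ### The action on the walls -/

section WallAction

variable {X : Type u} [MetricSpace X] {S : CubeComplex X} {G : Type v} [Group G] [MulAction G X]
  [IsIsometricSMul G X] {K : Subgroup G}

/-- A torsion-free subgroup of a properly acting group acts as a group of deck transformations. -/
lemma exists_pos_forall_eq_one (hproper : ActsProperly G X)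
    (htf : ∀ g ∈ K, IsOfFinOrder g → g = 1) (x : X) :
    ∃ δ > 0, ∀ k ∈ K, ∀ y, dist x y < δ → dist x (k • y) < δ → k = 1 := by
  obtain ⟨r, hr, hfin⟩ := hproper x
  -- Each of the finitely many relevant elements fixes `x` or moves it by more than `2 * δ`. An
  -- element as in the claim thus fixes `x`, all its powers lie in the finite set, and
  -- torsion-freeness makes it trivial.
  have hev : ∀ᶠ δ : ℝ in 𝓝[>] 0, (∀ g ∈ {g : G | ((g • Metric.ball x r) ∩ Metric.ball x r).Nonempty},
      g • x = x ∨ 2 * δ < dist x (g • x)) ∧ δ < r := by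
    refine ((Filter.eventually_all_finite hfin).2 fun g _ => ?_).and ?_
    · by_cases hg : g • x = x
      · exact Filter.Eventually.of_forall fun _ => Or.inl hg
      · filter_upwards [Ioo_mem_nhdsGT (half_pos (dist_pos.2 (Ne.symm hg)))] with δ hδ
        exact Or.inr (by linarith [hδ.2])
    · filter_upwards [Ioo_mem_nhdsGT hr] with δ hδ using hδ.2
  obtain ⟨δ, ⟨h, hδr⟩, hδ⟩ := (hev.and self_mem_nhdsWithin).exists
  refine ⟨δ, hδ, fun k hk y h1 h2 => htf k hk ?_⟩
  have hkx : k • x = x := by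
    refine (h k ⟨k • y, smul_mem_smul_set (Metric.mem_ball'.2 (h1.trans hδr)),
      Metric.mem_ball'.2 (h2.trans hδr)⟩).resolve_right fun h3 => ?_
    have := dist_triangle x (k • y) (k • x)
    rw [dist_smul, dist_comm y x] at this
    linarith
  rw [← finite_powers]
  refine hfin.subset ?_
  rintro _ ⟨n, rfl⟩
  have hn : (k ^ n) • x = x := by
    induction n with
    | zero => simp
    | succ n ih => rw [pow_succ, mul_smul, hkx, ih]
  exact ⟨x, ⟨x, Metric.mem_ball_self hr, hn⟩, Metric.mem_ball_self hr⟩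

lemma CubeComplex.SameComponent.smul (hcubes : ∀ (g : G), ∀ C ∈ S.cubes, g • C ∈ S.cubes) (g : G)
    {M N : Set X} (h : S.SameComponent M N) : S.SameComponent (g • M) (g • N) := by
  induction h with
  | rel M N h => exact .rel _ _ ⟨S.smul_midcubes hcubes g h.1, S.smul_midcubes hcubes g h.2.1,
      smul_set_mono h.2.2⟩
  | refl M => exact .refl _
  | symm M N _ ih => exact .symm _ _ ih
  | trans M N L _ _ ih ih' => exact .trans _ _ _ ih ih'

lemma CubeComplex.IsWall.smul (hcubes : ∀ (g : G), ∀ C ∈ S.cubes, g • C ∈ S.cubes) (g : G)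
    {W : Set X} (h : S.IsWall W) : S.IsWall (g • W) := by
  obtain ⟨M, hM, rfl⟩ := h
  refine ⟨g • M, S.smul_midcubes hcubes g hM, ?_⟩
  ext x
  rw [mem_smul_set_iff_inv_smul_mem]
  constructor
  · rintro ⟨N, ⟨hN, hMN⟩, hx⟩
    exact ⟨g • N, ⟨S.smul_midcubes hcubes g hN, hMN.smul hcubes g⟩,
      mem_smul_set_iff_inv_smul_mem.2 hx⟩
  · rintro ⟨N, ⟨hN, hMN⟩, hx⟩
    refine ⟨g⁻¹ • N, ⟨S.smul_midcubes hcubes g⁻¹ hN, ?_⟩, smul_mem_smul_set hx⟩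
    have := hMN.smul hcubes g⁻¹
    rwa [inv_smul_smul] at this

omit [IsIsometricSMul G X] in
/-- The translates of a wall by the kernel of a quotient that makes walls finite are disjoint or
equal. -/
lemma MakesWallsFinite.smul_wall_eq {Q : Type w} [Group Q] {R : ℝ} {φ : G →* Q}
    (hφ : MakesWallsFinite S R φ) (hR : 0 ≤ R) {k : G} (hk : k ∈ φ.ker) (W : S.Wall)
    (h : (W.1 ∩ k • W.1).Nonempty) : k • W.1 = W.1 := by
  obtain ⟨n, V, H, hrep, hstab, -, -, -, hsep⟩ := hφ.exists_subgroups
  obtain ⟨i, ⟨g, hg⟩, -⟩ := hrep W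
  -- The conjugate of `k` maps to `1`, which lies in the image of `H i`. Its translate of the
  -- representative wall meets that wall, so separation at distance `2 * R` forces it into `H i`,
  -- hence into the stabiliser.
  have hk' : φ (g⁻¹ * k * g) = 1 := by
    rw [map_mul, map_mul, MonoidHom.mem_ker.1 hk, mul_one, ← map_mul, inv_mul_cancel, map_one]
  have hkg : k • W.1 = g • (g⁻¹ * k * g) • (V i).1 := by
    rw [hg]; simp only [smul_smul]; congr 1; group
  have hdist : setDist ((g⁻¹ * k * g) • (V i).1) (V i).1 ≤ 2 * R := by
    obtain ⟨p, hp, hp'⟩ := h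
    rw [hg, mem_smul_set_iff_inv_smul_mem] at hp
    rw [hkg, mem_smul_set_iff_inv_smul_mem] at hp'
    have hle : setDist ((g⁻¹ * k * g) • (V i).1) (V i).1 ≤ 0 := csInf_le
      ⟨0, by rintro _ ⟨a, -, b, -, rfl⟩; exact dist_nonneg⟩
      ⟨g⁻¹ • p, hp', g⁻¹ • p, hp, (dist_self _).symm⟩
    linarith
  have hmem : g⁻¹ * k * g ∈ H i := by
    by_contra hcon
    exact hsep i _ hcon hdist ⟨1, one_mem _, by rw [hk', map_one]⟩
  rw [hkg, MulAction.mem_stabilizer_iff.1 (hstab i hmem), ← hg]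

omit [IsIsometricSMul G X] in
lemma bar_eq_of_smul {k : G} (hk : k ∈ K) {W W' : S.Wall} (h : W'.1 = k • W.1) :
    bar S K W' = bar S K W := by
  refine Subtype.ext (Subset.antisymm ?_ ?_)
  · rintro _ ⟨x, hx, rfl⟩
    rw [h] at hx
    obtain ⟨y, hy, rfl⟩ := hx
    exact ⟨y, hy, (quotMap_smul hk y).symm⟩
  · rintro _ ⟨x, hx, rfl⟩
    exact ⟨k • x, by rw [h]; exact smul_mem_smul_set hx, quotMap_smul hk x⟩

omit [IsIsometricSMul G X] in
lemma exists_of_quotMap_mem_bar {W : S.Wall} {y : X} (h : quotMap K y ∈ (bar S K W).1) :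
    ∃ k ∈ K, y ∈ k • W.1 := by
  obtain ⟨x, hx, hxy⟩ := h
  obtain ⟨k, hk, rfl⟩ := quotMap_eq_iff.1 hxy.symm
  exact ⟨k, hk, smul_mem_smul_set hx⟩

variable [Nonempty X] (hX : IsCAT0 X) {ε : ℝ} (hε : S.IsUniformScale ε)
  (hcubes : ∀ (g : G), ∀ C ∈ S.cubes, g • C ∈ S.cubes)
include hX hε

omit [IsIsometricSMul G X] [MulAction G X] [Group G] in
-- The walls of the quotient are given as bare subsets. A point on a single wall allows a wall to be
-- recovered from its image, up to `K`.
lemma exists_mem_wall_forall_eq (W : S.Wall) :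
    ∃ x ∈ W.1, ∀ W' : S.Wall, x ∈ W'.1 → W' = W := by
  obtain ⟨p, hp⟩ := W.2.nonempty
  obtain ⟨M, hM, -, hMW⟩ := W.2.exists_midcube hp
  obtain ⟨C, hC, i, rfl⟩ := S.exists_eq_mid hM
  obtain ⟨x, hx, hne⟩ := exists_mem_mid_coord_ne hC i
  refine ⟨x, hMW hx, fun W' hW' => ?_⟩
  obtain ⟨k, hk⟩ := IsWall.inter_cube hX hε W'.2 hC ⟨x, hx.1, hW'⟩
  have hxk : coord C x k = 1 / 2 := (hk.subset ⟨hx.1, hW'⟩).2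
  obtain rfl : k = i := by
    by_contra hki
    rw [hne k hki] at hxk
    norm_num at hxk
  exact Subtype.ext (IsWall.eq_of_subset W'.2 W.2 hM (fun z hz => (hk.superset hz).2) hMW)

include hcubes

lemma exists_eq_smul_of_bar_eq {W W' : S.Wall} (h : bar S K W' = bar S K W) :
    ∃ k ∈ K, W'.1 = k • W.1 := by
  obtain ⟨x, hx, hx'⟩ := exists_mem_wall_forall_eq hX hε W'
  obtain ⟨k, hk, hxk⟩ := exists_of_quotMap_mem_bar (h ▸ ⟨x, hx, rfl⟩ : quotMap K x ∈ (bar S K W).1)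
  exact ⟨k, hk, (congrArg Subtype.val (hx' ⟨k • W.1, W.2.smul hcubes k⟩ hxk)).symm⟩

variable (hK : ∀ k ∈ K, ∀ W : S.Wall, (W.1 ∩ k • W.1).Nonempty → k • W.1 = W.1)
include hK

lemma bar_ne {W W' : S.Wall} {p : X} (hp : p ∈ W.1) (hp' : p ∈ W'.1) (hne : W' ≠ W) :
    bar S K W' ≠ bar S K W := by
  intro h
  obtain ⟨k, hk, hkW⟩ := exists_eq_smul_of_bar_eq hX hε hcubes h
  exact hne (Subtype.ext (hkW.trans (hK k hk W ⟨p, hp, hkW ▸ hp'⟩)))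

/-- Distinct walls of `X` that meet have adjacent images. -/
lemma adj_bar {R : ℝ} (hR : 0 ≤ R) {W W' : S.Wall} {p : X} (hp : p ∈ W.1) (hp' : p ∈ W'.1)
    (hne : W' ≠ W) : (wallGraph S K R).Adj (bar S K W) (bar S K W') := by
  refine (SimpleGraph.fromRel_adj _ _ _).2 ⟨(bar_ne hX hε hcubes hK hp hp' hne).symm, Or.inl ?_⟩
  have hpos : ∀ a b : QuotSpace K X, 0 ≤ quotDist K a b := fun a b =>
    Real.sInf_nonneg (by rintro _ ⟨_, _, -, -, rfl⟩; exact dist_nonneg)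
  have h1 : quotSetDist K (bar S K W).1 (bar S K W').1 ≤ quotDist K (quotMap K p) (quotMap K p) :=
    csInf_le ⟨0, by rintro _ ⟨a, -, b, -, rfl⟩; exact hpos a b⟩
      ⟨quotMap K p, ⟨p, hp, rfl⟩, quotMap K p, ⟨p, hp', rfl⟩, rfl⟩
  have h2 : quotDist K (quotMap K p) (quotMap K p) ≤ 0 :=
    csInf_le ⟨0, by rintro _ ⟨a, b, -, -, rfl⟩; exact dist_nonneg⟩
      ⟨p, p, rfl, rfl, (dist_self p).symm⟩
  exact h1.trans (h2.trans hR)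

variable {R : ℝ} {k : ℕ} {c : Colouring S K R k} {j : ℕ} {W : S.Wall}

/-- A wall of the quotient through the image of `p` lifts to a wall through `p`, after translation
by `K`, and a lift through `p` other than `W` has an image other than that of `W`. -/
lemma quotMap_mem_splitAlong_iff {p : X} (hp : p ∈ W.1) :
    quotMap K p ∈ splitAlong (bar S K W) c j ↔
      ∀ W' : S.Wall, p ∈ W'.1 → W' ≠ W → j < c.colour (bar S K W') := by
  simp only [splitAlong, mem_sdiff, mem_iUnion, mem_ofPred_eq, exists_prop, not_exists, not_and]
  constructor
  · rintro ⟨-, h⟩ W' hp' hne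
    by_contra! hle
    exact h (bar S K W') ⟨bar_ne hX hε hcubes hK hp hp' hne, hle⟩ ⟨p, hp', rfl⟩
  · refine fun h => ⟨⟨p, hp, rfl⟩, ?_⟩
    rintro ⟨_, W₁, rfl⟩ ⟨hne, hle⟩ hmem
    obtain ⟨g, hg, hpg⟩ := exists_of_quotMap_mem_bar (W := W₁) hmem
    have hbar : bar S K ⟨g • W₁.1, W₁.2.smul hcubes g⟩ = bar S K W₁ := bar_eq_of_smul hg rfl
    have hlt := h ⟨g • W₁.1, W₁.2.smul hcubes g⟩ hpg
      (by rintro rfl; exact hne hbar.symm)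
    rw [hbar] at hlt
    exact absurd hle hlt.not_ge

end WallAction

/-! ### Classes of colourings -/

namespace Colouring

variable {X : Type u} [MetricSpace X] {S : CubeComplex X} {G : Type v} [Group G] [MulAction G X]
  {K : Subgroup G} {R : ℝ} {k : ℕ} {c c' : Colouring S K R k} {V V' : QWall S K}

lemma mem_cls_self : c ∈ c.cls V := fun _ _ => rfl

lemma colour_eq_of_mem_cls (h : c' ∈ c.cls V) : c'.colour V = c.colour V :=
  h V (by rw [SimpleGraph.edist_self]; exact zero_le)

lemma cls_eq_of_mem (h : c' ∈ c.cls V) : c'.cls V = c.cls V := by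
  have hV := colour_eq_of_mem_cls h
  ext d
  simp only [cls, hV, mem_ofPred_eq]
  exact forall_congr' fun U => forall_congr' fun hU => by rw [h U hU]

/-- Colours start at 1, so the ball of radius `c(V)` contains all neighbours of `V`. -/
lemma colour_eq_of_adj (h : c' ∈ c.cls V) (hadj : (wallGraph S K R).Adj V V') :
    c'.colour V' = c.colour V' := by
  refine h V' ?_
  rw [SimpleGraph.edist_eq_one_iff_adj.2 hadj]
  exact_mod_cast c.one_le V

/-- Equivalence with respect to a wall is inherited by the adjacent walls of smaller colour. -/
lemma cls_eq_of_adj (h : c.cls V' = c'.cls V') (hadj : (wallGraph S K R).Adj V V')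
    (hlt : c.colour V < c.colour V') : c.cls V = c'.cls V := by
  have hmem : c' ∈ c.cls V' := h ▸ mem_cls_self
  refine (cls_eq_of_mem fun U hU => hmem U ?_).symm
  -- Since `c(V) + 1 ≤ c(V')`, the ball of radius `c(V)` about `V` lies in the ball of radius
  -- `c(V')` about `V'`.
  calc (wallGraph S K R).edist V' U
      ≤ (wallGraph S K R).edist V' V + (wallGraph S K R).edist V U :=
        SimpleGraph.edist_triangle
    _ ≤ 1 + c.colour V := by
        gcongr
        exact (SimpleGraph.edist_eq_one_iff_adj.2 hadj.symm).le
    _ ≤ c.colour V' := by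
        rw [add_comm]
        exact_mod_cast hlt

end Colouring

/-! ### Colourings along a portal -/

section Portal

variable {X : Type u} [MetricSpace X] [Nonempty X] {S : CubeComplex X} {G : Type v} [Group G]
  [MulAction G X] [IsIsometricSMul G X] {K : Subgroup G} (hX : IsCAT0 X) {ε : ℝ}
  (hε : S.IsUniformScale ε)

include hX hε

/-- The midpoint of an edge that crosses out of `Z` belongs to `Z`. -/
lemma mem_portal_of_dualToPortal {Z : Set X}
    (hZ : ∃ A : Set (Set X), (∀ B ∈ A, S.IsHalfSpace B) ∧ Z = ⋂₀ A) {W : S.Wall} {e : Set X}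
    (he : DualToPortal Z W e) {x₀ : X} (hx₀ : S.IsMidpoint e x₀) : x₀ ∈ portal Z W := by
  obtain ⟨hdual, x, y, hxy, hx, -⟩ := he
  have hx₀W := hx₀.mem_wall hX hε hdual
  refine ⟨mem_of_forall_wall hX hε hZ fun W' => ?_, hx₀W⟩
  by_cases hW' : (e ∩ W'.1).Nonempty
  · obtain rfl := hdual.wall_eq hX hε (⟨hdual.1, hW'⟩ : S.Dual e W')
    exact Or.inl hx₀W
  · exact Or.inr ⟨x, hx, sameSide_of_cube hX hdual.1.1 hW' hxy.2.2.2.2.1 hx₀.mem_edge⟩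

variable (hcubes : ∀ (g : G), ∀ C ∈ S.cubes, g • C ∈ S.cubes)
  (hK : ∀ k ∈ K, ∀ W : S.Wall, (W.1 ∩ k • W.1).Nonempty → k • W.1 = W.1)
  {R : ℝ} (hR : 0 ≤ R) {k : ℕ} {j : ℕ} {Z : Set X} {H : Subgroup G} {c : X → Colouring S K R k}
  (hZ : IsColouredPiece j Z H c) {W : S.Wall} (hW : IsBoundaryWall Z W)

include hcubes hK hR

/-- Colourings that are equivalent with respect to a wall split it in the same way. -/
lemma splitAlong_eq {c c' : Colouring S K R k} (h : c' ∈ c.cls (bar S K W)) :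
    splitAlong (bar S K W) c' j = splitAlong (bar S K W) c j := by
  have key : ∀ p ∈ W.1, (quotMap K p ∈ splitAlong (bar S K W) c' j ↔
      quotMap K p ∈ splitAlong (bar S K W) c j) := fun p hp => by
    rw [quotMap_mem_splitAlong_iff hX hε hcubes hK hp, quotMap_mem_splitAlong_iff hX hε hcubes hK hp]
    refine forall_congr' fun W' => forall_congr' fun hp' => forall_congr' fun hne => ?_
    rw [Colouring.colour_eq_of_adj h (adj_bar hX hε hcubes hK hR hp hp' hne)]
  ext q
  constructor
  · intro hq
    obtain ⟨p, hp, rfl⟩ := hq.1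
    exact (key p hp).1 hq
  · intro hq
    obtain ⟨p, hp, rfl⟩ := hq.1
    exact (key p hp).2 hq

include hZ hW

/-- The colourings at the vertices in `Z` of a cube that meets a boundary wall are equivalent with
respect to that wall. -/
lemma cls_eq_of_mem_cube {D : Set X} (hD : D ∈ S.cubes) (hDW : (D ∩ W.1).Nonempty) {x x' : X}
    (hx : x ∈ D) (hx' : x' ∈ D) (hxv : S.IsVertex x) (hxv' : S.IsVertex x') (hxZ : x ∈ Z)
    (hxZ' : x' ∈ Z) : (c x).cls (bar S K W) = (c x').cls (bar S K W) := by
  classical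
  obtain ⟨i, hi⟩ := IsWall.inter_cube hX hε W.2 hD hDW
  -- Induction on the number of coordinates in which `x` and `x'` differ; each step crosses one edge
  -- of `D` inside `Z`, never one dual to `W`.
  induction hn : (Finset.univ.filter fun l => coord D x l ≠ coord D x' l).card using
    Nat.strong_induction_on generalizing x with
  | _ n ih =>
  by_cases hall : ∀ l, coord D x l = coord D x' l
  · rw [S.coord_ext hD hx hx' hall]
  push Not at hall
  obtain ⟨l, hl⟩ := hall
  have hxW := vertex_notMem_wall W.2 hxv
  have hli : l ≠ i := by
    rintro rfl
    refine not_sameSide_of_coord hX hD hi hx hx' ?_ (sameSide_of_isBoundaryWall hX hε hZ.halfSpaces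
      hW hxZ hxZ' hxW (vertex_notMem_wall W.2 hxv'))
    rcases S.coord_vertex hD hx hxv l with h | h <;>
      rcases S.coord_vertex hD hx' hxv' l with h' | h' <;>
      first | exact absurd (h.trans h'.symm) hl | norm_num [h, h']
  obtain ⟨e, y, hxy, hy, hyl, hyne, hdual⟩ := exists_joins hD hx hxv l
  have hyx' : coord D y l = coord D x' l := by
    rw [hyl]
    rcases S.coord_vertex hD hx hxv l with h | h <;>
      rcases S.coord_vertex hD hx' hxv' l with h' | h' <;>
      first | exact absurd (h.trans h'.symm) hl | norm_num [h, h']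
  have hyv := hxy.2.2.1
  have hpos : ∀ m, 0 < (coord D y m - 1 / 2) * (coord D y m - 1 / 2) := fun m => by
    rcases S.coord_vertex hD hy hyv m with h | h <;> rw [h] <;> norm_num
  -- Each coordinate of `y` is that of `x` or of `x'`, so no wall separates `y` from both.
  have hyZ : y ∈ Z := mem_of_forall_wall hX hε hZ.halfSpaces fun W' => Or.inr <| by
    by_cases hDW' : (D ∩ W'.1).Nonempty
    · obtain ⟨m, hm⟩ := IsWall.inter_cube hX hε W'.2 hD hDW'
      by_cases hml : m = l
      · refine ⟨x', hxZ', sameSide_of_coord hX hD hm hx' hy ?_⟩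
        rw [hml, ← hyx']; exact hpos l
      · refine ⟨x, hxZ, sameSide_of_coord hX hD hm hx hy ?_⟩
        rw [← hyne m hml]; exact hpos m
    · exact ⟨x, hxZ, sameSide_of_cube hX hD hDW' hx hy⟩
  obtain ⟨V, hV, hVl⟩ := S.exists_wall (S.mid_mem hD l)
  obtain ⟨p, hp, hpc⟩ := S.exists_coord_eq hD (fun _ => 1 / 2) fun _ => by norm_num
  have hne : (⟨V, hV⟩ : S.Wall) ≠ W := by
    rintro rfl
    obtain ⟨z, hz, hzc⟩ := exists_mem_mid_coord_ne hD l
    have h2 := (hi.subset ⟨hz.1, hVl hz⟩).2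
    rw [hzc i hli.symm] at h2
    norm_num at h2
  have hadj := adj_bar hX hε hcubes hK hR (hi.superset ⟨hp, hpc i⟩).2
    (show p ∈ (⟨V, hV⟩ : S.Wall).1 from hVl ⟨hp, hpc l⟩) hne
  have hdV := hdual ⟨V, hV⟩ hVl
  -- The edge to `y` stays in `Z`, so its wall has colour above `j`; the edge at `x` dual to `W`
  -- leaves `Z`, so `W` has colour at most `j`.
  have hcolV := (hZ.mem_iff e x y hxy hxZ _ hdV).1 hyZ
  obtain ⟨e', y', hxy', -, -, -, hdual'⟩ := exists_joins hD hx hxv i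
  have hdW := hdual' W fun z hz => (hi.superset hz).2
  have hcolW := mt (hZ.mem_iff e' x y' hxy' hxZ _ hdW).2
    (notMem_of_isBoundaryWall hX hε hZ.halfSpaces hW hxy' hdW hxZ)
  rw [Colouring.cls_eq_of_adj (hZ.adjacent e x y hxy hxZ hyZ _ hdV) hadj
    ((not_lt.1 hcolW).trans_lt hcolV)]
  refine ih _ ?_ hy hyv hyZ rfl
  rw [← hn]
  refine Finset.card_lt_card (Finset.ssubset_iff_of_subset ?_ |>.2 ⟨l, by simpa using hl, by simp [hyx']⟩)
  intro m hm
  simp only [Finset.mem_filter, Finset.mem_univ, true_and] at hm ⊢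
  by_cases hml : m = l
  · rwa [hml]
  · rwa [← hyne m hml]

/-- The colourings at the vertices in `Z` of the cubes along a portal are equivalent with respect to
the wall of the portal. -/
lemma cls_eq_of_portal {p p' : X} (hp : p ∈ portal Z W) (hp' : p' ∈ portal Z W) {D D' : Set X}
    (hD : D ∈ S.cubes) (hD' : D' ∈ S.cubes) (hpD : p ∈ D) (hpD' : p' ∈ D') {x x' : X} (hx : x ∈ D)
    (hx' : x' ∈ D') (hxv : S.IsVertex x) (hxv' : S.IsVertex x') (hxZ : x ∈ Z) (hxZ' : x' ∈ Z) :
    (c x).cls (bar S K W) = (c x').cls (bar S K W) := by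
  have hconv : GeoConvex (portal Z W) :=
    (geoConvex_of_halfSpaces hX hε hZ.halfSpaces).inter (W.2.geoConvex hX hε)
  refine (hX.isPreconnected_of_geoConvex hconv).induction₂ (fun p p' => ∀ D ∈ S.cubes, p ∈ D →
    ∀ D' ∈ S.cubes, p' ∈ D' → ∀ x ∈ D, S.IsVertex x → x ∈ Z → ∀ x' ∈ D', S.IsVertex x' → x' ∈ Z →
    (c x).cls (bar S K W) = (c x').cls (bar S K W)) ?_ ?_ ?_ hp hp' D hD hpD D' hD' hpD' x hx hxv hxZ
    x' hx' hxv' hxZ'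
  · intro q hq
    obtain ⟨r, hr⟩ := S.exists_isGood q
    filter_upwards [nhdsWithin_le_nhds (Metric.ball_mem_nhds q hr.pos)] with q' hq' D hD hqD D' hD'
      hqD' x hx hxv hxZ x' hx' hxv' hxZ'
    have hqD'' := hr.cube D' hD' q' hqD' (Metric.mem_ball'.1 hq')
    -- Cubes near `q` share the smallest cube around `q`, and a vertex of it in `Z` links the two
    -- colourings.
    obtain ⟨v, hv, hvv, hvZ⟩ := exists_vertex_mem hX hε hZ.halfSpaces hxv hxZ (S.hull_mem q)
      (S.mem_hull q) hq.1
    exact (cls_eq_of_mem_cube hX hε hcubes hK hR hZ hW hD ⟨q, hqD, hq.2⟩ hx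
      (S.hull_subset hD hqD hv) hxv hvv hxZ hvZ).trans
      (cls_eq_of_mem_cube hX hε hcubes hK hR hZ hW hD' ⟨q, hqD'', hq.2⟩
      (S.hull_subset hD' hqD'' hv) hx' hvv hxv' hvZ hxZ')
  · intro q q' q'' hq hq' hq'' h h' D hD hqD D' hD' hqD' x hx hxv hxZ x' hx' hxv' hxZ'
    obtain ⟨v, hv, hvv, hvZ⟩ := exists_vertex_mem hX hε hZ.halfSpaces hxv hxZ (S.hull_mem q')
      (S.mem_hull q') hq'.1
    exact (h D hD hqD _ (S.hull_mem q') (S.mem_hull q') x hx hxv hxZ v hv hvv hvZ).trans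
      (h' _ (S.hull_mem q') (S.mem_hull q') D' hD' hqD' v hv hvv hvZ x' hx' hxv' hxZ')
  · intro q q' hq hq' h D hD hqD D' hD' hqD' x hx hxv hxZ x' hx' hxv' hxZ'
    exact (h D' hD' hqD' D hD hqD x' hx' hxv' hxZ' x hx hxv hxZ).symm

variable {cE : Set X → Colouring S K R k} (hcE : IsEdgeColouring Z c cE) {e : Set X}
  (he : DualToPortal Z W e) {x₀ : X} (hx₀ : S.IsMidpoint e x₀)
include hcE he hx₀

lemma cls_eq_of_dualToPortal {p : X} (hp : p ∈ portal Z W) {D : Set X} (hD : D ∈ S.cubes)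
    (hpD : p ∈ D) {x : X} (hx : x ∈ D) (hxv : S.IsVertex x) (hxZ : x ∈ Z) :
    (c x).cls (bar S K W) = (cE e).cls (bar S K W) := by
  obtain ⟨hdual, y, y', hy, hyZ, -⟩ := id he
  rw [hcE e W y hdual hy.2.1 hyZ hy.2.2.2.2.1]
  exact cls_eq_of_portal hX hε hcubes hK hR hZ hW hp
    (mem_portal_of_dualToPortal hX hε hZ.halfSpaces he hx₀) hD hdual.1.1 hpD hx₀.mem_edge hx
    hy.2.2.2.2.1 hxv hy.2.1 hxZ hyZ

/-- A wall `W' ≠ W` through `p` is adjacent to `W`, so its `c_e`-colour is its colour at any vertex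
of `Z` in a cube around `p`. By `mem_iff`, the edge dual to `W'` at this vertex leaves `Z` exactly
if that colour is at most `j`. -/
lemma mem_portalInterior_iff_quotMap_mem {p : X} (hp : p ∈ portal Z W) :
    p ∈ portalInterior Z W ↔ quotMap K p ∈ splitAlong (bar S K W) (cE e) j := by
  rw [quotMap_mem_splitAlong_iff hX hε hcubes hK hp.2, portalInterior_eq hX hε hZ.halfSpaces hW]
  simp only [mem_sdiff, hp, true_and, mem_iUnion, mem_ofPred_eq, exists_prop, not_exists, not_and]
  refine forall_congr' fun W' => ?_
  suffices h : p ∈ W'.1 → W' ≠ W → (IsBoundaryWall Z W' ↔ ¬ j < (cE e).colour (bar S K W')) by tauto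
  intro hp' hne
  obtain ⟨v, hv, hvZ⟩ : ∃ v, S.IsVertex v ∧ v ∈ Z := by
    obtain ⟨e, -, x, y, hxy, hx, -⟩ := hW
    exact ⟨x, hxy.2.1, hx⟩
  obtain ⟨D, hD, hpD⟩ := S.cover p
  obtain ⟨x, hx, hxv, hxZ⟩ := exists_vertex_mem hX hε hZ.halfSpaces hv hvZ hD hpD hp.1
  obtain ⟨l, hl⟩ := IsWall.inter_cube hX hε W'.2 hD ⟨p, hpD, hp'⟩
  obtain ⟨e', y, hxy, -, -, -, hdual⟩ := exists_joins hD hx hxv l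
  have hdual := hdual W' fun z hz => (hl.superset hz).2
  have hmem : c x ∈ (cE e).cls (bar S K W) :=
    cls_eq_of_dualToPortal hX hε hcubes hK hR hZ hW hcE he hx₀ hp hD hpD hx hxv hxZ ▸
      Colouring.mem_cls_self
  rw [← Colouring.colour_eq_of_adj hmem (adj_bar hX hε hcubes hK hR hp.2 hp' hne),
    ← hZ.mem_iff e' x y hxy hxZ W' hdual]
  exact ⟨fun h => notMem_of_isBoundaryWall hX hε hZ.halfSpaces h hxy hdual hxZ,
    fun h => ⟨e', hdual, x, y, hxy, hxZ, h⟩⟩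

/-- Only one wall passes through the midpoint of an edge, so none of the removed walls does. -/
lemma mem_portalInterior_of_isWallVertex {x : X} (hx : x ∈ portal Z W) (hv : S.IsWallVertex W x) :
    x ∈ portalInterior Z W := by
  rw [mem_portalInterior_iff_quotMap_mem hX hε hcubes hK hR hZ hW hcE he hx₀ hx,
    quotMap_mem_splitAlong_iff hX hε hcubes hK hx.2]
  intro W' hx' hne
  obtain ⟨e', he', hm⟩ := hv
  exact absurd ((hm.dual hx').wall_eq hX hε he') hne

omit [IsIsometricSMul G X] hcubes hK hR hcE he hx₀ in
lemma portalInterior_subset_portal : portalInterior Z W ⊆ portal Z W := by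
  rw [portalInterior_eq hX hε hZ.halfSpaces hW]
  exact sdiff_subset

omit [IsIsometricSMul G X] hcubes hK hR hcE he hx₀ in
lemma geoConvex_portalInterior : GeoConvex (portalInterior Z W) := by
  intro p hp q hq t ht
  rw [portalInterior_eq hX hε hZ.halfSpaces hW] at hp hq ⊢
  refine ⟨((geoConvex_of_halfSpaces hX hε hZ.halfSpaces).inter (W.2.geoConvex hX hε)) p hp.1 q hq.1
    t ht, ?_⟩
  intro hmem
  obtain ⟨W', hW', hmem⟩ := mem_iUnion₂.1 hmem
  exact sameSide_of_isBoundaryWall hX hε hZ.halfSpaces hW'.1 hp.1.1 hq.1.1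
    (fun h => hp.2 (mem_iUnion₂.2 ⟨W', hW', h⟩)) (fun h => hq.2 (mem_iUnion₂.2 ⟨W', hW', h⟩)) t ht hmem

/-- A geodesic of `W` that starts in the interior of the portal and avoids the removed walls stays
in the interior of the portal. -/
lemma mem_portalInterior_of_geo {p q : X} (hp : p ∈ portalInterior Z W)
    (h : ∀ t ∈ Icc (0 : ℝ) 1, geo p q t ∈ W.1 ∧
      quotMap K (geo p q t) ∈ splitAlong (bar S K W) (cE e) j) : q ∈ portalInterior Z W := by
  have hmem : ∀ t ∈ Icc (0 : ℝ) 1, (geo p q t ∈ portalInterior Z W ↔ geo p q t ∈ Z) := fun t ht =>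
    ⟨fun hi => (portalInterior_subset_portal hX hε hZ hW hi).1, fun hi =>
      (mem_portalInterior_iff_quotMap_mem hX hε hcubes hK hR hZ hW hcE he hx₀ ⟨hi, (h t ht).1⟩).2
        (h t ht).2⟩
  -- Membership in `Z` is a closed condition on the geodesic, and an open one because its points in
  -- `Z` are interior points of the portal.
  have key := isPreconnected_Icc.induction₂ (s := Icc (0 : ℝ) 1)
    (fun t t' => geo p q t ∈ Z ↔ geo p q t' ∈ Z) ?_
    (fun _ _ _ _ _ _ h h' => h.trans h') (fun _ _ _ _ h => h.symm) (x := 0) (y := 1)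
    (by simp) (by simp)
  · rw [← hmem 0 (by simp), ← hmem 1 (by simp), hX.geo_zero, hX.geo_one] at key
    exact key.1 hp
  intro t ht
  have hcont := hX.continuousOn_geo_param p q t ht
  by_cases htZ : geo p q t ∈ Z
  · obtain ⟨-, δ, hδ, hsub⟩ := mem_portalInterior_iff.1 ((hmem t ht).2 htZ)
    filter_upwards [hcont (Metric.ball_mem_nhds _ hδ), self_mem_nhdsWithin] with s hs hs'
    exact iff_of_true htZ (hsub _ (h s hs').1 (Metric.mem_ball'.1 hs))
  · filter_upwards [hcont ((isClosed_of_halfSpaces hZ.halfSpaces).isOpen_compl.mem_nhds htZ)] with s hs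
    exact iff_of_false htZ hs

/-- A translate of `W` that comes close to `p` passes through `p`, so it meets `W` and equals it.
Thus near `p` the preimage of the split wall lies in `W`. -/
lemma exists_pos_mem_portalInterior {p : X} (hp : p ∈ portalInterior Z W) : ∃ δ > 0, ∀ y,
    quotMap K y ∈ splitAlong (bar S K W) (cE e) j → dist p y < δ → y ∈ portalInterior Z W := by
  obtain ⟨hpW, δ, hδ, h⟩ := mem_portalInterior_iff.1 hp
  obtain ⟨r, hr⟩ := S.exists_isGood p
  refine ⟨min δ r, lt_min hδ hr.pos, fun y hy hd => ?_⟩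
  obtain ⟨g, hg, hyg⟩ := exists_of_quotMap_mem_bar hy.1
  have hpg := hr.mem_wall (W.2.smul hcubes g) hyg (hd.trans_le (min_le_right _ _))
  rw [hK g hg W ⟨p, hpW, hpg⟩] at hyg
  exact (mem_portalInterior_iff_quotMap_mem hX hε hcubes hK hR hZ hW hcE he hx₀
    ⟨h y hyg (hd.trans_le (min_le_left _ _)), hyg⟩).2 hy

/-- After translation by `g⁻¹`, every wall that meets the short geodesic from `z` to `g⁻¹ • y`
passes through its endpoint `g⁻¹ • y`. No removed wall does, so the geodesic stays in the interior
of the portal. -/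
lemma exists_pos_eq_smul {y : X} (hy : quotMap K y ∈ splitAlong (bar S K W) (cE e) j) :
    ∃ δ > 0, ∀ g ∈ K, ∀ z ∈ portalInterior Z W, dist y (g • z) < δ →
      ∃ z' ∈ portalInterior Z W, g • z' = y := by
  obtain ⟨r, hr⟩ := S.exists_isGood y
  refine ⟨r, hr.pos, fun g hg z hz hd => ⟨g⁻¹ • y, ?_, smul_inv_smul g y⟩⟩
  have hzW := (portalInterior_subset_portal hX hε hZ hW hz).2
  have hyW : g⁻¹ • y ∈ W.1 := mem_smul_set_iff_inv_smul_mem.1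
    (hr.mem_wall (W.2.smul hcubes g) (smul_mem_smul_set hzW) hd)
  have hy' : quotMap K (g⁻¹ • y) ∈ splitAlong (bar S K W) (cE e) j := by
    rwa [quotMap_smul (inv_mem hg)]
  rw [quotMap_mem_splitAlong_iff hX hε hcubes hK hyW] at hy'
  refine mem_portalInterior_of_geo hX hε hcubes hK hR hZ hW hcE he hx₀ hz fun t ht => ?_
  have htW := W.2.geoConvex hX hε z hzW _ hyW t ht
  refine ⟨htW, (quotMap_mem_splitAlong_iff hX hε hcubes hK htW).2 fun W' hW' hne =>
    hy' W' ?_ hne⟩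
  refine mem_smul_set_iff_inv_smul_mem.1 (hr.mem_wall (W'.2.smul hcubes g) (smul_mem_smul_set hW') ?_)
  rw [hX.smul_geo g _ _ ht, smul_inv_smul, dist_comm, hX.dist_geo_right _ _ ht, dist_comm (g • z) y]
  exact (mul_le_of_le_one_left dist_nonneg (by linarith [ht.1])).trans_lt hd

/-- Here `g` preserves `W`, as `g • p` lies on both translates. It maps the geodesic from `p` to
`q`, which runs in the interior, to one with the same image in the quotient. -/
lemma smul_mem_portalInterior {g : G} (hg : g ∈ K) {p q : X} (hp : p ∈ portalInterior Z W)
    (hgp : g • p ∈ portalInterior Z W) (hq : q ∈ portalInterior Z W) :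
    g • q ∈ portalInterior Z W := by
  have hsub := portalInterior_subset_portal hX hε hZ hW
  have hgW := hK g hg W ⟨g • p, (hsub hgp).2, smul_mem_smul_set (hsub hp).2⟩
  refine mem_portalInterior_of_geo hX hε hcubes hK hR hZ hW hcE he hx₀ hgp fun t ht => ?_
  have hmem := geoConvex_portalInterior hX hε hZ hW p hp q hq t ht
  rw [← hX.smul_geo g p q ht, quotMap_smul hg]
  exact ⟨hgW ▸ smul_mem_smul_set (hsub hmem).2,
    (mem_portalInterior_iff_quotMap_mem hX hε hcubes hK hR hZ hW hcE he hx₀ (hsub hmem)).1 hmem⟩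

end Portal

end PortalCovers

/-! ### The lemma on portal covers -/

open PortalCovers CubeComplex
theorem lemma8p7
    {X G Q : Type*} [MetricSpace X] [Group G] [Group Q] [MulAction G X] [IsIsometricSMul G X]
    (S : CubeComplex X) (hX : IsCAT0 X)
    (hcubes : ∀ (g : G), ∀ C ∈ S.cubes, g • C ∈ S.cubes)
    (hproper : ActsProperly G X) (hcocompact : ActsCocompactlyOn (⊤ : Subgroup G) (univ : Set X))
    (R : ℝ) (hR : 1 < R) (hball : ∀ x : X, (⋃ g : G, g • Metric.ball x R) = univ)
    (φ : G →* Q) (hφ : MakesWallsFinite S R φ)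
    (k : ℕ) (hk : ∀ V, ((wallGraph S φ.ker R).neighborSet V).encard ≤ k)
    (j : ℕ) (Z : Set X) (H : Subgroup G) (c : X → Colouring S φ.ker R k)
    (hZ : IsColouredPiece j Z H c)
    (cE : Set X → Colouring S φ.ker R k) (hcE : IsEdgeColouring Z c cE)
    (W : S.Wall) (hW : IsJBoundaryWall j Z cE W)
    (e : Set X) (he : DualToPortal Z W e) (x₀ : X) (hx₀ : S.IsMidpoint e x₀) :
    -- the interior of the portal is the portal minus the other boundary walls
    portalInterior Z W =
      portal Z W \ ⋃ W' ∈ {W' : S.Wall | IsBoundaryWall Z W' ∧ W' ≠ W}, W'.1 ∧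
    -- the universal covering, and its group of deck transformations
    SimplyConnectedSpace (portalInterior Z W) ∧
    (∃ f : portalInterior Z W → connectedComponentIn
          (splitAlong (bar S φ.ker W) (cE e) j) (quotMap φ.ker x₀),
      (∀ p, (f p : QuotSpace φ.ker X) = quotMap φ.ker (p : X)) ∧
      IsCoveringMap f ∧ Function.Surjective f ∧
      ∃ KP : Subgroup G, (KP : Set G) = {g | g ∈ φ.ker ∧ g • x₀ ∈ portal Z W} ∧
        ∃ Φ : KP ≃* deckGroup f, ∀ (g : KP) (p : portalInterior Z W),
          (((Φ g : portalInterior Z W ≃ₜ portalInterior Z W) p : portalInterior Z W) : X)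
            = (g : G) • (p : X)) ∧
    -- the target is independent of the choices
    (∀ x ∈ portal Z W, S.IsWallVertex W x → ∀ c' ∈ (cE e).cls (bar S φ.ker W),
      connectedComponentIn (splitAlong (bar S φ.ker W) (cE e) j) (quotMap φ.ker x₀) =
        connectedComponentIn (splitAlong (bar S φ.ker W) c' j) (quotMap φ.ker x)) ∧
    (∀ e' x', DualToPortal Z W e' → S.IsMidpoint e' x' →
      connectedComponentIn (splitAlong (bar S φ.ker W) (cE e) j) (quotMap φ.ker x₀) =
        connectedComponentIn (splitAlong (bar S φ.ker W) (cE e') j) (quotMap φ.ker x')) := by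
  have hne : Nonempty X := ⟨x₀⟩
  obtain ⟨ε, hε⟩ := S.exists_isUniformScale hcubes hcocompact
  have hR0 : 0 ≤ R := by linarith
  have hK : ∀ g ∈ φ.ker, ∀ V : S.Wall, (V.1 ∩ g • V.1).Nonempty → g • V.1 = V.1 :=
    fun g hg V => hφ.smul_wall_eq hR0 hg V
  have hWb : IsBoundaryWall Z W := by
    obtain ⟨e₁, h₁, h₂, -⟩ := hW
    exact ⟨e₁, h₁, h₂⟩
  have hmem : ∀ {x}, x ∈ portal Z W → S.IsWallVertex W x → x ∈ portalInterior Z W := fun hx hv =>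
    mem_portalInterior_of_isWallVertex hX hε hcubes hK hR0 hZ hWb hcE he hx₀ hx hv
  have hsplit : ∀ {p}, p ∈ portal Z W → (p ∈ portalInterior Z W ↔
      quotMap φ.ker p ∈ splitAlong (bar S φ.ker W) (cE e) j) := fun hp =>
    mem_portalInterior_iff_quotMap_mem hX hε hcubes hK hR0 hZ hWb hcE he hx₀ hp
  have hsub := portalInterior_subset_portal hX hε hZ hWb
  have hx₀P := mem_portal_of_dualToPortal hX hε hZ.halfSpaces he hx₀
  have ho := hmem hx₀P ⟨e, he.1, hx₀⟩
  have hconv := geoConvex_portalInterior hX hε hZ hWb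
  have hconn := hX.isPreconnected_of_geoConvex hconv
  have hPA : ∀ p ∈ portalInterior Z W,
      quotMap φ.ker p ∈ splitAlong (bar S φ.ker W) (cE e) j := fun p hp => (hsplit (hsub hp)).1 hp
  have htarget : ∀ x ∈ portal Z W, S.IsWallVertex W x → ∀ c' ∈ (cE e).cls (bar S φ.ker W),
      connectedComponentIn (splitAlong (bar S φ.ker W) (cE e) j) (quotMap φ.ker x₀) =
        connectedComponentIn (splitAlong (bar S φ.ker W) c' j) (quotMap φ.ker x) := by
    intro x hx hv c' hc'
    rw [splitAlong_eq hX hε hcubes hK hR0 hc']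
    -- The images of `x₀` and `x` both lie in the image of the connected interior of the portal.
    exact connectedComponentIn_eq ((hconn.image _
      continuous_quotMap.continuousOn).subset_connectedComponentIn ⟨x₀, ho, rfl⟩ (by rintro _ ⟨p, hp, rfl⟩; exact hPA p hp) ⟨x, hmem hx hv, rfl⟩)
  refine ⟨portalInterior_eq hX hε hZ.halfSpaces hWb, ?_, ?_, htarget, ?_⟩
  · have := hX.contractibleSpace_of_geoConvex hconv ⟨x₀, ho⟩
    infer_instance
  · obtain ⟨f, hf, hcov, hsurj, KP, hKP, hΦ⟩ := exists_covering ho hconn hPA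
      (fun p hp => exists_pos_mem_portalInterior hX hε hcubes hK hR0 hZ hWb hcE he hx₀ hp)
      (fun y hy => exists_pos_eq_smul hX hε hcubes hK hR0 hZ hWb hcE he hx₀ hy)
      (fun g hg p hp hgp q hq =>
        smul_mem_portalInterior hX hε hcubes hK hR0 hZ hWb hcE he hx₀ hg hp hgp hq)
      (exists_pos_forall_eq_one hproper hφ.torsionFree)
    refine ⟨f, hf, hcov, hsurj, KP, hKP.trans ?_, hΦ⟩
    -- For translates of `x₀` by `K`, lying in the portal and lying in its interior are the same:
    -- they have the image of `x₀`, which avoids the removed walls.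
    ext g
    refine and_congr_right fun hg => ⟨fun h => hsub h, fun h => (hsplit h).2 ?_⟩
    rw [quotMap_smul hg]
    exact hPA x₀ ho
  · intro e' x' he' hx'
    have hx'P := mem_portal_of_dualToPortal hX hε hZ.halfSpaces he' hx'
    refine htarget x' hx'P ⟨e', he'.1, hx'⟩ (cE e') ?_
    obtain ⟨hdual, y, y', hy, hyZ, -⟩ := id he'
    rw [← cls_eq_of_dualToPortal hX hε hcubes hK hR0 hZ hWb hcE he hx₀ hx'P hdual.1.1 hx'.mem_edge
      hy.2.2.2.2.1 hy.2.1 hyZ, ← hcE e' W y hdual hy.2.1 hyZ hy.2.2.2.2.1]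
    exact Colouring.mem_cls_self
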